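/- For $\varepsilon>0$ and $A>0$ consider the equation $$\varepsilon\,\dot x_t = F(x_t,\lambda(t)),\qquad F(x,\lambda)=x-x^3+\lambda,\qquad \lambda(t)=-A\cos(2\pi t).$$ Let $\lambda_c=\frac{2}{3\sqrt3}$, $x_c=\frac1{\sqrt3}$ and $a_0=A-\lambda_c$. Denote the equilibrium branches of $F$ as follows: $X^\star_+(\lambda)$, for $\lambda\ge-\lambda_c$, is the solution of $F(x,\lambda)=0$ with $x\ge x_c$; $X^\star_-(\lambda)$, for $\lambda\le\lambda_c$, is the one with $x\le -x_c$; $X^\star_0(\lambda)$, for $|\lambda|\le\lambda_c$, is the one with $|x|\le x_c$. The area of a periodic solution $x$ is $\mathcal A(x)=-\int_{-1/2}^{1/2}x_t\,\lambda'(t)\,dt$. "Stable" means asymptotically stable, "unstable" means not Lyapunov stable, and a solution $y$ on some $[t_0,\infty)$ is attracted by $x$ if $y_t-x_t\to0$ as $t\to\infty$. The static area is $\mathcal A_0:=\int_{-\lambda_c}^{\lambda_c}\bigl(X^\star_+(\lambda)-X^\star_-(\lambda)\bigr)\,d\lambda=\frac32$, and there exist constants $\gamma_1>\gamma_0>0$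 and $\varepsilon_0>0$ such that the following holds for all $0<\varepsilon<\varepsilon_0$. **(1)** There is a constant $K$, independent of $\varepsilon$ and $A$, such that whenever $A>0$ and $a_0\le\gamma_0\varepsilon$, the equation has exactly three periodic solutions (of any period): two stable ones $x^+,x^-$ and an unstable one $x^0$, all of them of period $1$. They satisfy $$|x^\pm_t-X^\star_\pm(\lambda(t))|\le K\bigl(\varepsilon|a_0|^{-1/2}\wedge\sqrt\varepsilon\bigr),\qquad |x^0_t-X^\star_0(\lambda(t))|\le K\bigl(\varepsilon|a_0|^{-1/2}\wedge\sqrt\varepsilon\bigr)$$ for all $t$ at which the respective branch exists, i.e. $\lambda(t)\ge-\lambda_c$ for $x^+$, $\lambda(t)\le\lambda_c$ for $x^-$, $|\lambda(t)|\le\lambda_c$ for $x^0$ (with $|a_0|^{-1/2}=\infty$ if $a_0=0$). Every solution on some $[t_0,\infty)$ with $y_{t_0}\ne x^0_{t_0}$ is attracted by $x^+$ or by $x^-$. Each of the three periodic solutions $x$ encloses an area $\mathcal A(x)\asymp\varepsilon A$, uniformly for $A$ bounded away from $0$: there is a constant $C$ independent of $\varepsilon$ and $A$ with $\mathcal A(x)\le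 C\varepsilon A$, and for each $A_*>0$ there is a constant $c>0$ depending only on $A_*$ with $\mathcal A(x)\ge c\,\varepsilon A$ whenever $A\ge A_*$. **(2)** If $a_0\ge\gamma_1\varepsilon$, the equation has exactly one periodic solution (of any period) $x^{\mathrm{per}}=x^{\mathrm{per},\varepsilon}$. It has period $1$ and is stable. For each fixed $A>\lambda_c$ and each $t$, $$\lim_{\varepsilon\to0+}x^{\mathrm{per},\varepsilon}_t=\begin{cases}X^\star_+(\lambda(t))&\text{if }\lambda(t)>\lambda_c,\text{ or if }\lambda(t)\ge-\lambda_c\text{ and }\lambda'(t)<0,\\ X^\star_-(\lambda(t))&\text{otherwise.}\end{cases}$$ Its area satisfies $\mathcal A(x^{\mathrm{per}})-\mathcal A_0\asymp\varepsilon^{2/3}a_0^{1/3}$, uniformly for bounded $A$: there is a constant $c>0$ independent of $\varepsilon$ and $A$ with $\mathcal A(x^{\mathrm{per}})-\mathcal A_0\ge c\,\varepsilon^{2/3}a_0^{1/3}$, and for each $A^*>0$ there is a constant $C$ depending only on $A^*$ with $\mathcal A(x^{\mathrm{per}})-\mathcal A_0\le C\varepsilon^{2/3}a_0^{1/3}$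 whenever $A\le A^*$. -/

import Mathlib

noncomputable section

/-- The force `F(x, l) = x - x³ + l` of the double-well potential `x⁴/4 - x²/2 - l x`. -/
def force (x l : ℝ) : ℝ := x - x ^ 3 + l

/-- The periodic driving `λ(t) = -A cos(2πt)`. -/
def drive (A t : ℝ) : ℝ := -(A * Real.cos (2 * Real.pi * t))

/-- `λ_c = 2/(3√3)`. -/
def lamC : ℝ := 2 / (3 * Real.sqrt 3)

/-- `x_c = 1/√3`, the points where `∂F/∂x` vanishes are `±x_c`. -/
def xC : ℝ := 1 / Real.sqrt 3

/-- The upper (stable) equilibrium branch `X₊⋆(l)`, which exists for `l ≥ -λ_c`: there the set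
below has exactly one element (`F(·, l)` is strictly decreasing on `[x_c, ∞)`). -/
def branchPlus (l : ℝ) : ℝ := sSup {x | force x l = 0 ∧ xC ≤ x}

/-- The lower (stable) equilibrium branch `X₋⋆(l)`, which exists for `l ≤ λ_c`: there the set
below has exactly one element. -/
def branchMinus (l : ℝ) : ℝ := sSup {x | force x l = 0 ∧ x ≤ -xC}

/-- The middle (unstable) equilibrium branch `X₀⋆(l)`, which exists for `|l| ≤ λ_c`: there the
set below has exactly one element. -/
def branchZero (l : ℝ) : ℝ := sSup {x | force x l = 0 ∧ |x| ≤ xC}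

/-- `x` solves `ε ẋ = F(x, λ(t))` on the whole real line. -/
def IsGlobalSolution (ε A : ℝ) (x : ℝ → ℝ) : Prop :=
  ∀ t, HasDerivAt x (force (x t) (drive A t) / ε) t

/-- `y` solves `ε ẏ = F(y, λ(t))` on `[t₀, ∞)`. -/
def IsSolutionFrom (ε A t₀ : ℝ) (y : ℝ → ℝ) : Prop :=
  ∀ t ∈ Set.Ici t₀, HasDerivWithinAt y (force (y t) (drive A t) / ε) (Set.Ici t₀) t

/-- Periodic solutions; no particular period is prescribed. -/
def IsPeriodicSolution (ε A : ℝ) (x : ℝ → ℝ) : Prop :=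
  IsGlobalSolution ε A x ∧ ∃ T > 0, Function.Periodic x T

/-- The solution `y` is attracted by `x`. -/
def AttractedBy (y x : ℝ → ℝ) : Prop :=
  Filter.Tendsto (fun t => y t - x t) Filter.atTop (nhds 0)

/-- Stability of the solution `x` in the sense of Lyapunov. -/
def IsLyapunovStable (ε A : ℝ) (x : ℝ → ℝ) : Prop :=
  ∀ t₀ : ℝ, ∀ η > 0, ∃ δ > 0, ∀ y, IsSolutionFrom ε A t₀ y → |y t₀ - x t₀| < δ →
    ∀ t ≥ t₀, |y t - x t| < η

/-- Asymptotic stability of the solution `x`. -/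
def IsStableSolution (ε A : ℝ) (x : ℝ → ℝ) : Prop :=
  IsLyapunovStable ε A x ∧
    ∀ t₀ : ℝ, ∃ δ > 0, ∀ y, IsSolutionFrom ε A t₀ y → |y t₀ - x t₀| < δ → AttractedBy y x

/-- Instability of the solution `x`. -/
def IsUnstableSolution (ε A : ℝ) (x : ℝ → ℝ) : Prop :=
  ¬ IsLyapunovStable ε A x

/-- The area `-∫_{-1/2}^{1/2} x_t λ'(t) dt` of the cycle `t ↦ (λ(t), x_t)`. -/
def hysteresisArea (A : ℝ) (x : ℝ → ℝ) : ℝ :=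
  -∫ t in (-1 / 2 : ℝ)..(1 / 2 : ℝ), x t * deriv (drive A) t

/-- The static hysteresis area `𝒜₀ = ∫_{-λ_c}^{λ_c} (X₊⋆(l) - X₋⋆(l)) dl`. -/
def staticArea : ℝ := ∫ l in (-lamC)..lamC, (branchPlus l - branchMinus l)

/-- `ε |a₀|^{-1/2} ∧ √ε`, where `|a₀|^{-1/2} = ∞` for `a₀ = 0`. -/
def trackingScale (ε a₀ : ℝ) : ℝ :=
  if a₀ = 0 then Real.sqrt ε else min (ε / Real.sqrt |a₀|) (Real.sqrt ε)

open Classical in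
/-- The adiabatic limit of the periodic solution for `A > λ_c`: the upper branch while
`λ(t) > λ_c`, or while `λ(t) ≥ -λ_c` and `λ` decreases; the lower branch otherwise. -/
def adiabaticLimit (A t : ℝ) : ℝ :=
  if lamC < drive A t ∨ (-lamC ≤ drive A t ∧ deriv (drive A) t < 0) then
    branchPlus (drive A t)
  else
    branchMinus (drive A t)

end

open Set Filter Topology
open scoped NNReal

/-! ### Global existence for bounded Lipschitz fields -/

/-! Three elementary facts carry everything. The difference `D` of two solutions satisfies `ε D' = D
(1 - (x² + xy + y²))`; hence comparison with sub- and supersolutions holds, and differences contract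
where both solutions are beyond the same fold point and expand where both lie between the folds. The
symmetry `x(t) ↦ -x(t + 1/2)` reduces the lower fold to the upper one. For a periodic solution the
area equals the dissipation `∫ ε v²`, where `v = x'` (`hysteresisArea_eq`).

Small amplitude. With `w = x - x_c` the equation reads `ε w' = (λ + λ_c) - w² (w + 3 x_c)`, where `λ
+ λ_c = λ_c - A + 2A sin²(πt)` is never much below `-ε`. There is a profile `u` of size `sqrt
(sin²(πt) + ε + (λ_c - A)⁺)` for which both `x_c + u(t)` and `x_c - u(-t)` are strict subsolutions
(`bump_subsolution`). Crossing either of them upwards is irreversible, and no solution stays between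
them for a period (`not_forall_near_fold`). Above the upper barrier solutions contract, between the
middle barrier and its reflection they expand. This yields one periodic solution in each of the
three regions and the fate of every other solution. The velocity obeys `ε v' = (1 - 3x²) v + λ'`, so
at the maximum of `|v|` it equals `|λ'| / |1 - 3x²|`; the barriers bound this by a multiple of `A`.
Tracking and the upper bound on the area follow. For the lower bound `v` is tested against a
function `W` with `∫ v W = A/2`.

Large amplitude. Near each integer time the driving is well past the upper fold and every solution
falls below `-2 x_c` (`IsSolutionFrom.le_neg_two_xC_of_past_fold`); then all solutions contract,
which gives a unique attracting periodic solution. By uniqueness it is antisymmetric under the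
half-period shift, so its area is twice the dissipation on `[-1/2, 0]`. Past the fold `ε v² =
-(Ψ(x))' + v (λ + λ_c)`, where `Ψ` is the potential at the fold; its drop from `x_c` to `-2 x_c` is
`3/4`, half the static area. The excess is governed by how far `λ` has gone below `-λ_c` during the
jump, which is of order `ε^{2/3} a₀^{1/3}`. A linear barrier shows that the jump is delayed (lower
bound); the velocity equation bounds the lag before the fold and the duration of the fall (upper
bound). -/

theorem exists_global_solution_of_bounded_lipschitz {E : Type*} [NormedAddCommGroup E]
    [NormedSpace ℝ E] [CompleteSpace E] {f : ℝ → E → E} {K L : ℝ≥0}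
    (hlip : ∀ t, LipschitzWith K (f t)) (hcont : ∀ x, Continuous fun t => f t x)
    (hbd : ∀ t x, ‖f t x‖ ≤ L) (x₀ : E) :
    ∃ x : ℝ → E, x 0 = x₀ ∧ ∀ t, HasDerivAt x (f t (x t)) t := by
  have hloc : ∀ n : ℕ, ∃ α : ℝ → E, α 0 = x₀ ∧
      ∀ t ∈ Ioo (-(n + 1 : ℝ)) (n + 1), HasDerivAt α (f t (α t)) t := by
    intro n
    have h0 : (0 : ℝ) ∈ Icc (-(n + 1 : ℝ)) (n + 1) := ⟨by linarith [n.cast_nonneg (α := ℝ)],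
      by linarith [n.cast_nonneg (α := ℝ)]⟩
    -- A field bounded by `L` travels at most `L * (n + 1)` in time `n + 1`, so with this radius the
    -- local theorem covers the whole interval.
    have hPL : IsPicardLindelof f (⟨0, h0⟩ : Icc (-(n + 1 : ℝ)) (n + 1)) x₀
        (L * (n + 1)) 0 L K :=
      ⟨fun t _ => (hlip t).lipschitzOnWith, fun x _ => (hcont x).continuousOn,
        fun t _ x _ => hbd t x, by simp⟩
    obtain ⟨α, h1, h2⟩ := hPL.exists_eq_forall_mem_Icc_hasDerivWithinAt₀
    exact ⟨α, h1, fun t ht => (h2 t (Ioo_subset_Icc_self ht)).hasDerivAt (Icc_mem_nhds ht.1 ht.2)⟩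
  choose α hα0 hα using hloc
  have hagree : ∀ m n : ℕ, m ≤ n → EqOn (α m) (α n) (Ioo (-(m + 1 : ℝ)) (m + 1)) := by
    intro m n hmn
    have hmn' : (m : ℝ) ≤ n := by exact_mod_cast hmn
    have hm : (0 : ℝ) ≤ m := m.cast_nonneg
    refine ODE_solution_unique_of_mem_Ioo (v := f) (s := fun _ => univ) (K := K) (t₀ := 0)
      (fun t _ => (hlip t).lipschitzOnWith) ⟨by linarith, by linarith⟩
      (fun t ht => ⟨hα m t ht, trivial⟩)
      (fun t ht => ⟨hα n t ⟨by linarith [ht.1], by linarith [ht.2]⟩, trivial⟩)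
      (by rw [hα0, hα0])
  -- Gluing: `α n` solves on an interval of half-length `n + 1`, so `t` is interior to the domain of
  -- `α ⌈|t|⌉₊`.
  refine ⟨fun t => α ⌈|t|⌉₊ t, by simp [hα0], fun t => ?_⟩
  set N := ⌈|t|⌉₊ + 1 with hN
  have hmem : t ∈ Ioo (-(N : ℝ)) N := by
    have h := Nat.le_ceil |t|
    have := abs_le.1 h
    push_cast [hN]
    exact ⟨by linarith, by linarith⟩
  have heq : (fun t => α ⌈|t|⌉₊ t) =ᶠ[𝓝 t] α N := by
    filter_upwards [Ioo_mem_nhds hmem.1 hmem.2] with s hs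
    have h1 : ⌈|s|⌉₊ ≤ N := Nat.ceil_le.2 (abs_le.2 ⟨hs.1.le, hs.2.le⟩)
    refine hagree _ _ h1 ?_
    have := abs_le.1 (Nat.le_ceil |s|)
    exact ⟨by linarith, by linarith⟩
  have hval : α ⌈|t|⌉₊ t = α N t := heq.eq_of_nhds
  have := hα N t ⟨by linarith [hmem.1], by linarith [hmem.2]⟩
  rw [← hval] at this
  exact this.congr_of_eventuallyEq heq

/-! ### Elementary facts on the force and the driving -/

theorem force_sub (x y l : ℝ) :
    force x l - force y l = (x - y) * (1 - (x ^ 2 + x * y + y ^ 2)) := by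
  unfold force; ring

theorem force_neg (x l : ℝ) : force (-x) (-l) = -force x l := by unfold force; ring

theorem drive_add_one (A t : ℝ) : drive A (t + 1) = drive A t := by
  unfold drive
  rw [mul_add, mul_one, Real.cos_add_two_pi]

theorem drive_add_half (A t : ℝ) : drive A (t + 1 / 2) = -drive A t := by
  unfold drive
  rw [show 2 * Real.pi * (t + 1 / 2) = 2 * Real.pi * t + Real.pi by ring, Real.cos_add_pi]
  ring

theorem drive_add_int (A t : ℝ) (n : ℤ) : drive A (t + n) = drive A t := by
  unfold drive
  rw [show 2 * Real.pi * (t + n) = 2 * Real.pi * t + n * (2 * Real.pi) by ring,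
    Real.cos_add_int_mul_two_pi]

theorem hasDerivAt_drive (A t : ℝ) :
    HasDerivAt (drive A) (2 * Real.pi * A * Real.sin (2 * Real.pi * t)) t := by
  have h1 : HasDerivAt (fun t : ℝ => 2 * Real.pi * t) (2 * Real.pi) t := by
    simpa using (hasDerivAt_id t).const_mul (2 * Real.pi)
  have := ((h1.cos).const_mul A).neg
  convert! this using 1
  ring

theorem deriv_drive (A t : ℝ) : deriv (drive A) t = 2 * Real.pi * A * Real.sin (2 * Real.pi * t) :=
  (hasDerivAt_drive A t).deriv

theorem continuous_drive (A : ℝ) : Continuous (drive A) := by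
  unfold drive; fun_prop

theorem abs_drive_le {A : ℝ} (hA : 0 ≤ A) (t : ℝ) : |drive A t| ≤ A := by
  unfold drive
  rw [abs_neg, abs_mul, abs_of_nonneg hA]
  exact mul_le_of_le_one_right hA (Real.abs_cos_le_one _)

theorem xC_pos : 0 < xC := by unfold xC; positivity

theorem xC_sq : xC ^ 2 = 1 / 3 := by
  unfold xC
  rw [div_pow, Real.sq_sqrt (by norm_num)]; norm_num

theorem lamC_eq : lamC = 2 / 3 * xC := by
  unfold lamC xC
  field_simp

theorem lamC_pos : 0 < lamC := by rw [lamC_eq]; linarith [xC_pos]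

theorem xC_gt : 0.577 < xC := by
  nlinarith [xC_sq, xC_pos]

theorem xC_lt : xC < 0.578 := by
  nlinarith [xC_sq, xC_pos]

theorem lamC_gt : 0.384 < lamC := by rw [lamC_eq]; linarith [xC_gt]

theorem lamC_lt : lamC < 0.386 := by rw [lamC_eq]; linarith [xC_lt]

/-- The cubic `-F(·, -λ_c)` has the double zero `x_c` and the simple zero `-2 x_c`. -/
theorem force_eq_fold (x l : ℝ) :
    force x l = (l + lamC) - (x - xC) ^ 2 * (x + 2 * xC) := by
  unfold force
  rw [lamC_eq]
  linear_combination (-3 * x + 2 * xC) * xC_sq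

theorem force_xC (l : ℝ) : force xC l = l + lamC := by rw [force_eq_fold]; ring

theorem force_neg_two_xC (l : ℝ) : force (-(2 * xC)) l = l + lamC := by rw [force_eq_fold]; ring

theorem force_neg_xC (l : ℝ) : force (-xC) l = l - lamC := by
  have := force_neg xC (-l)
  rw [neg_neg, force_xC] at this
  rw [this]; ring

/-! ### Solutions: restriction, translation, reflection -/

section Solutions

variable {ε A t₀ : ℝ} {x y : ℝ → ℝ}

theorem IsGlobalSolution.solutionFrom (h : IsGlobalSolution ε A x) (t₀ : ℝ) :
    IsSolutionFrom ε A t₀ x := fun t _ => (h t).hasDerivWithinAt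

theorem IsSolutionFrom.mono (h : IsSolutionFrom ε A t₀ y) {t₁ : ℝ} (ht : t₀ ≤ t₁) :
    IsSolutionFrom ε A t₁ y := fun t h' =>
  (h t (ht.trans h')).mono (Ici_subset_Ici.2 ht)

theorem IsSolutionFrom.continuousOn (h : IsSolutionFrom ε A t₀ y) : ContinuousOn y (Ici t₀) :=
  fun t ht => (h t ht).continuousWithinAt

theorem IsSolutionFrom.hasDerivWithinAt_right (h : IsSolutionFrom ε A t₀ y) {t : ℝ} (ht : t₀ ≤ t) :
    HasDerivWithinAt y (force (y t) (drive A t) / ε) (Ici t) t :=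
  (h t ht).mono (Ici_subset_Ici.2 ht)

theorem IsSolutionFrom.hasDerivAt (h : IsSolutionFrom ε A t₀ y) {t : ℝ} (ht : t₀ < t) :
    HasDerivAt y (force (y t) (drive A t) / ε) t :=
  (h t ht.le).hasDerivAt (Ici_mem_nhds ht)

theorem IsSolutionFrom.comp_add_int (h : IsSolutionFrom ε A t₀ y) (n : ℤ) :
    IsSolutionFrom ε A (t₀ - n) fun t => y (t + n) := by
  intro t ht
  have ht' : t₀ ≤ t + n := by have : t₀ - n ≤ t := ht; linarith
  have h1 : HasDerivWithinAt (fun t : ℝ => t + n) 1 (Ici (t₀ - n)) t :=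
    (hasDerivWithinAt_id t _).add_const _
  have := (h (t + n) ht').scomp t h1 (fun s (hs : t₀ - n ≤ s) => by
    change t₀ ≤ s + n; linarith)
  rw [one_smul, drive_add_int] at this
  exact this

/-- The force is odd in `(x, λ)` and the driving changes sign after half a period. This symmetry
transfers every statement about the upper fold to the lower one. -/
theorem IsSolutionFrom.antisymm_shift (h : IsSolutionFrom ε A t₀ y) :
    IsSolutionFrom ε A (t₀ - 1 / 2) fun t => -y (t + 1 / 2) := by
  intro t ht
  have ht' : t₀ ≤ t + 1 / 2 := by have : t₀ - 1 / 2 ≤ t := ht; linarith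
  have h1 : HasDerivWithinAt (fun t : ℝ => t + 1 / 2) 1 (Ici (t₀ - 1 / 2)) t :=
    (hasDerivWithinAt_id t _).add_const _
  have := ((h (t + 1 / 2) ht').scomp t h1 (fun s (hs : t₀ - 1 / 2 ≤ s) => by
    change t₀ ≤ s + 1 / 2; linarith)).neg
  rw [one_smul, drive_add_half] at this
  convert! this using 1
  rw [← neg_div, ← force_neg, neg_neg]

theorem IsGlobalSolution.antisymm_shift (h : IsGlobalSolution ε A x) :
    IsGlobalSolution ε A fun t => -x (t + 1 / 2) := by
  intro t
  have h1 := ((h.solutionFrom (t + 1 / 2 - 1)).antisymm_shift).hasDerivAt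
    (t := t) (by linarith)
  exact h1

theorem IsGlobalSolution.continuous (h : IsGlobalSolution ε A x) : Continuous x :=
  continuous_iff_continuousAt.2 fun t => (h t).continuousAt

/-! ### Comparison -/

/-- Differential inequality `f' ≤ c f` wherever `f > 0` preserves `f ≤ 0`. -/
theorem nonpos_of_deriv_right_le_mul {f f' : ℝ → ℝ} {a b c : ℝ}
    (hf : ContinuousOn f (Icc a b)) (hf' : ∀ t ∈ Ico a b, HasDerivWithinAt f (f' t) (Ici t) t)
    (hb : ∀ t ∈ Ico a b, 0 < f t → f' t ≤ c * f t) (ha : f a ≤ 0) :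
    ∀ t ∈ Icc a b, f t ≤ 0 := by
  intro t ht
  -- The functions `η exp ((c + 1)(t - a))` grow strictly faster than rate `c` allows, so `f` cannot
  -- cross them; then `η` is chosen small enough for a contradiction.
  have key : ∀ η > 0, f t ≤ η * Real.exp ((c + 1) * (t - a)) := by
    intro η hη
    have hB : ∀ s, HasDerivAt (fun s => η * Real.exp ((c + 1) * (s - a)))
        (η * (Real.exp ((c + 1) * (s - a)) * (c + 1))) s := by
      intro s
      have h1 : HasDerivAt (fun s : ℝ => (c + 1) * (s - a)) (c + 1) s := by
        simpa using ((hasDerivAt_id s).sub_const a).const_mul (c + 1)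
      exact (h1.exp).const_mul η
    refine image_le_of_deriv_right_lt_deriv_boundary hf hf' ?_ hB ?_ ht
    · simp; linarith
    · intro s hs hfs
      have hpos : 0 < η * Real.exp ((c + 1) * (s - a)) := by positivity
      have h1 := hb s hs (by rw [hfs]; exact hpos)
      rw [hfs] at h1
      nlinarith
  by_contra! hpos
  have h2 := key (f t / (2 * Real.exp ((c + 1) * (t - a)))) (by positivity)
  have h3 : Real.exp ((c + 1) * (t - a)) ≠ 0 := (Real.exp_pos _).ne'
  have h4 : f t / (2 * Real.exp ((c + 1) * (t - a))) * Real.exp ((c + 1) * (t - a)) = f t / 2 := by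
    field_simp
  rw [h4] at h2
  linarith

/-- The force is one-sided Lipschitz with constant `1`, because `y² + yu + u² ≥ 0`. Hence `y - u`
grows at rate at most `1/ε` where positive, and no a priori bound on `y` is needed. -/
theorem IsSolutionFrom.le_of_supersolution (hε : 0 < ε) (hy : IsSolutionFrom ε A t₀ y)
    {u u' : ℝ → ℝ} {a b : ℝ} (ha : t₀ ≤ a) (hu : ∀ t, HasDerivAt u (u' t) t)
    (h : ∀ t ∈ Ico a b, force (u t) (drive A t) ≤ ε * u' t) (h0 : y a ≤ u a) :
    ∀ t ∈ Icc a b, y t ≤ u t := by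
  intro t ht
  have hc : ContinuousOn u (Icc a b) := fun s _ => (hu s).continuousAt.continuousWithinAt
  have := nonpos_of_deriv_right_le_mul (f := fun s => y s - u s)
    (f' := fun s => force (y s) (drive A s) / ε - u' s) (c := 1 / ε)
    ((hy.continuousOn.mono fun s hs => ha.trans hs.1).sub hc)
    (fun s hs => (hy.hasDerivWithinAt_right (ha.trans hs.1)).sub (hu s).hasDerivWithinAt)
    (fun s hs hpos => by
      have h1 := h s hs
      have h2 := force_sub (y s) (u s) (drive A s)
      have h3 : (y s - u s) * (1 - (y s ^ 2 + y s * u s + u s ^ 2)) ≤ y s - u s := by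
        nlinarith [mul_nonneg hpos.le (show 0 ≤ y s ^ 2 + y s * u s + u s ^ 2 by
          nlinarith [sq_nonneg (y s + u s), sq_nonneg (y s), sq_nonneg (u s)])]
      rw [div_sub' hε.ne', div_le_iff₀ hε, mul_comm (1 / ε), mul_assoc, one_div,
        inv_mul_cancel₀ hε.ne']
      linarith)
    (by simpa using h0) t ht
  simpa using this

/-- Reflection without time shift, at the price of changing the sign of `A`; it turns upper
comparison statements into lower ones. -/
theorem IsSolutionFrom.neg_subsolution_aux (hy : IsSolutionFrom ε A t₀ y) :
    IsSolutionFrom ε (-A) t₀ fun t => -y t := by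
  intro t ht
  have := (hy t ht).neg
  convert! this using 1
  rw [← neg_div, ← force_neg]
  congr 2
  unfold drive; ring

theorem IsSolutionFrom.ge_of_subsolution (hε : 0 < ε) (hy : IsSolutionFrom ε A t₀ y)
    {u u' : ℝ → ℝ} {a b : ℝ} (ha : t₀ ≤ a) (hu : ∀ t, HasDerivAt u (u' t) t)
    (h : ∀ t ∈ Ico a b, ε * u' t ≤ force (u t) (drive A t)) (h0 : u a ≤ y a) :
    ∀ t ∈ Icc a b, u t ≤ y t := by
  intro t ht
  have := hy.neg_subsolution_aux.le_of_supersolution hε (u := fun t => -u t)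
    (u' := fun t => -u' t) ha (fun t => (hu t).neg) (fun s hs => by
      have h1 := h s hs
      have h2 : drive (-A) s = -drive A s := by unfold drive; ring
      rw [h2, force_neg]; linarith) (by linarith) t ht
  linarith

theorem IsSolutionFrom.le_const (hε : 0 < ε) (hy : IsSolutionFrom ε A t₀ y)
    {z a b : ℝ} (ha : t₀ ≤ a) (h : ∀ t ∈ Ico a b, force z (drive A t) ≤ 0) (h0 : y a ≤ z) :
    ∀ t ∈ Icc a b, y t ≤ z :=
  hy.le_of_supersolution hε (u := fun _ => z) (u' := fun _ => 0) ha (fun t => hasDerivAt_const t z)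
    (fun t ht => by simpa using h t ht) h0

theorem IsSolutionFrom.ge_const (hε : 0 < ε) (hy : IsSolutionFrom ε A t₀ y)
    {z a b : ℝ} (ha : t₀ ≤ a) (h : ∀ t ∈ Ico a b, 0 ≤ force z (drive A t)) (h0 : z ≤ y a) :
    ∀ t ∈ Icc a b, z ≤ y t :=
  hy.ge_of_subsolution hε (u := fun _ => z) (u' := fun _ => 0) ha (fun t => hasDerivAt_const t z)
    (fun t ht => by simpa using h t ht) h0

/-- A solution above a strict subsolution is strictly above at later times. -/
theorem IsSolutionFrom.gt_of_strict_subsolution (hε : 0 < ε) (hy : IsSolutionFrom ε A t₀ y)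
    {u u' : ℝ → ℝ} {a b : ℝ} (ha : t₀ ≤ a) (hab : a < b) (hu : ∀ t, HasDerivAt u (u' t) t)
    (h : ∀ t, ε * u' t < force (u t) (drive A t)) (h0 : u a ≤ y a) : u b < y b := by
  have hle := hy.ge_of_subsolution hε ha hu (b := b) (fun t _ => (h t).le) h0
  -- If the graphs touched at `b`, the difference would vanish there with positive derivative, hence
  -- be negative just before.
  refine lt_of_le_of_ne (hle b ⟨hab.le, le_rfl⟩) fun heq => ?_
  have hd : HasDerivAt (fun t => y t - u t) (force (y b) (drive A b) / ε - u' b) b :=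
    (hy.hasDerivAt (ha.trans_lt hab)).sub (hu b)
  have hpos : 0 < force (y b) (drive A b) / ε - u' b := by
    rw [← heq, sub_pos, lt_div_iff₀ hε]
    linarith [h b]
  have h1 := (hasDerivAt_iff_tendsto_slope_left_right.1 hd).1
  have h2 : ∀ᶠ s in 𝓝[<] b, 0 < slope (fun t => y t - u t) b s := h1.eventually_const_lt hpos
  have h3 : ∀ᶠ s in 𝓝[<] b, s ∈ Ioo a b := Ioo_mem_nhdsLT hab
  obtain ⟨s, hs1, hs2⟩ := (h2.and h3).exists
  rw [slope_def_field, heq, sub_self, sub_zero] at hs1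
  have := hle s ⟨hs2.1.le, hs2.2.le⟩
  rcases div_pos_iff.1 hs1 with h | h
  · linarith [hs2.2, h.2]
  · linarith [h.1]

/-! ### Contraction and expansion of differences -/

/-- Squaring avoids the kink of the absolute value. The sign of the derivative is that of the secant
slope of the force minus `c`, so a bound on this slope makes the weighted square monotone. -/
theorem IsSolutionFrom.hasDerivAt_sq_sub (hx : IsSolutionFrom ε A t₀ x)
    (hy : IsSolutionFrom ε A t₀ y) {t : ℝ} (ht : t₀ < t) (c : ℝ) :
    HasDerivAt (fun t => (y t - x t) ^ 2 * Real.exp (-(2 * c / ε * t)))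
      (2 / ε * (y t - x t) ^ 2 * (1 - (x t ^ 2 + x t * y t + y t ^ 2) - c) *
        Real.exp (-(2 * c / ε * t))) t := by
  have h1 := ((hy.hasDerivAt ht).sub (hx.hasDerivAt ht)).pow 2
  have h2 : HasDerivAt (fun t : ℝ => -(2 * c / ε * t)) (-(2 * c / ε)) t := by
    convert! ((hasDerivAt_id t).const_mul (2 * c / ε)).neg using 1
    ring
  have h3 := h1.mul h2.exp
  convert! h3 using 1
  have := force_sub (y t) (x t) (drive A t)
  simp only [Pi.sub_apply, Pi.pow_apply]
  rw [← sub_div, this]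
  push_cast
  ring

theorem IsSolutionFrom.continuousOn_sq_sub (hx : IsSolutionFrom ε A t₀ x)
    (hy : IsSolutionFrom ε A t₀ y) (c : ℝ) :
    ContinuousOn (fun t => (y t - x t) ^ 2 * Real.exp (-(2 * c / ε * t))) (Ici t₀) := by
  have := hx.continuousOn
  have := hy.continuousOn
  fun_prop

theorem abs_le_of_sq_mul_exp_le {p q c ε a b : ℝ}
    (h : q ^ 2 * Real.exp (-(2 * c / ε * b)) ≤ p ^ 2 * Real.exp (-(2 * c / ε * a))) :
    |q| ≤ |p| * Real.exp (c * (b - a) / ε) := by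
  have h1 : q ^ 2 ≤ (|p| * Real.exp (c * (b - a) / ε)) ^ 2 := by
    have h2 : q ^ 2 = q ^ 2 * Real.exp (-(2 * c / ε * b)) * Real.exp (2 * c / ε * b) := by
      rw [mul_assoc, ← Real.exp_add]; simp
    rw [h2, mul_pow, sq_abs, ← Real.exp_nat_mul]
    refine (mul_le_mul_of_nonneg_right h (Real.exp_pos _).le).trans_eq ?_
    rw [mul_assoc, ← Real.exp_add]
    congr 2
    push_cast; ring
  rw [← sq_abs q] at h1
  exact (pow_le_pow_iff_left₀ (abs_nonneg _) (by positivity) (by norm_num)).1 h1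

/-- Contraction estimate: `1 - (x² + xy + y²)` is the slope of the secant of the cubic between the
two solutions, and an upper bound on it acts as a growth rate. -/
theorem IsSolutionFrom.abs_sub_le (hε : 0 < ε) (hx : IsSolutionFrom ε A t₀ x)
    (hy : IsSolutionFrom ε A t₀ y) {a b c : ℝ} (ha : t₀ ≤ a) (hab : a ≤ b)
    (h : ∀ t ∈ Ioo a b, 1 - (x t ^ 2 + x t * y t + y t ^ 2) ≤ c) :
    |y b - x b| ≤ |y a - x a| * Real.exp (c * (b - a) / ε) := by
  refine abs_le_of_sq_mul_exp_le ?_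
  have hanti : AntitoneOn (fun t => (y t - x t) ^ 2 * Real.exp (-(2 * c / ε * t))) (Icc a b) := by
    refine antitoneOn_of_hasDerivWithinAt_nonpos (convex_Icc a b)
      ((hx.continuousOn_sq_sub hy c).mono fun s hs => ha.trans hs.1)
      (fun t ht => (hx.hasDerivAt_sq_sub hy ?_ c).hasDerivWithinAt) fun t ht => ?_
    · rw [interior_Icc] at ht; exact ha.trans_lt ht.1
    · rw [interior_Icc] at ht
      have := h t ht
      have h1 : 0 ≤ 2 / ε * (y t - x t) ^ 2 := by positivity
      exact mul_nonpos_of_nonpos_of_nonneg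
        (mul_nonpos_of_nonneg_of_nonpos h1 (by linarith)) (Real.exp_pos _).le
  exact hanti ⟨le_rfl, hab⟩ ⟨hab, le_rfl⟩ hab

theorem IsSolutionFrom.le_abs_sub (hε : 0 < ε) (hx : IsSolutionFrom ε A t₀ x)
    (hy : IsSolutionFrom ε A t₀ y) {a b c : ℝ} (ha : t₀ ≤ a) (hab : a ≤ b)
    (h : ∀ t ∈ Ioo a b, c ≤ 1 - (x t ^ 2 + x t * y t + y t ^ 2)) :
    |y a - x a| * Real.exp (c * (b - a) / ε) ≤ |y b - x b| := by
  have hmono : MonotoneOn (fun t => (y t - x t) ^ 2 * Real.exp (-(2 * c / ε * t))) (Icc a b) := by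
    refine monotoneOn_of_hasDerivWithinAt_nonneg (convex_Icc a b)
      ((hx.continuousOn_sq_sub hy c).mono fun s hs => ha.trans hs.1)
      (fun t ht => (hx.hasDerivAt_sq_sub hy ?_ c).hasDerivWithinAt) fun t ht => ?_
    · rw [interior_Icc] at ht; exact ha.trans_lt ht.1
    · rw [interior_Icc] at ht
      have := h t ht
      have h1 : 0 ≤ 2 / ε * (y t - x t) ^ 2 := by positivity
      exact mul_nonneg (mul_nonneg h1 (by linarith)) (Real.exp_pos _).le
  have h2 := abs_le_of_sq_mul_exp_le (hmono ⟨le_rfl, hab⟩ ⟨hab, le_rfl⟩ hab)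
  have h3 : Real.exp (c * (a - b) / ε) * Real.exp (c * (b - a) / ε) = 1 := by
    rw [← Real.exp_add, ← Real.exp_zero]; congr 1; ring
  calc |y a - x a| * Real.exp (c * (b - a) / ε)
      ≤ |y b - x b| * Real.exp (c * (a - b) / ε) * Real.exp (c * (b - a) / ε) := by gcongr
    _ = |y b - x b| := by rw [mul_assoc, h3, mul_one]

theorem IsSolutionFrom.abs_sub_le_exp (hε : 0 < ε) (hx : IsSolutionFrom ε A t₀ x)
    (hy : IsSolutionFrom ε A t₀ y) {a b : ℝ} (ha : t₀ ≤ a) (hab : a ≤ b) :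
    |y b - x b| ≤ |y a - x a| * Real.exp ((b - a) / ε) := by
  have := hx.abs_sub_le hε hy ha hab (c := 1) (fun t _ => by
    nlinarith [sq_nonneg (x t + y t), sq_nonneg (x t), sq_nonneg (y t)])
  simpa using this

end Solutions

/-! ### Existence of solutions and of fixed points of the period map -/

/-- The vector field with the state variable clamped to `[-M, M]`. -/
noncomputable def clampedField (ε A M t x : ℝ) : ℝ :=
  force (max (-M) (min M x)) (drive A t) / ε

section Existence

variable {ε A : ℝ}

theorem clampedField_eq {M t x : ℝ} (h1 : -M ≤ x) (h2 : x ≤ M) :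
    clampedField ε A M t x = force x (drive A t) / ε := by
  unfold clampedField
  rw [min_eq_right h2, max_eq_right h1]

theorem abs_clamp_le {M : ℝ} (hM : 0 ≤ M) (x : ℝ) : |max (-M) (min M x)| ≤ M :=
  abs_le.2 ⟨le_max_left _ _, max_le (by linarith) (min_le_left _ _)⟩

theorem abs_clamp_sub_clamp_le (M x y : ℝ) :
    |max (-M) (min M x) - max (-M) (min M y)| ≤ |x - y| := by
  refine (abs_max_sub_max_le_max _ _ _ _).trans (max_le (by simp) ?_)
  refine (abs_min_sub_min_le_max _ _ _ _).trans (max_le (by simp) le_rfl)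

theorem clampedField_lipschitz (hε : 0 < ε) {M : ℝ} (hM : 0 ≤ M) (t : ℝ) :
    LipschitzWith (Real.toNNReal ((1 + 3 * M ^ 2) / ε)) (clampedField ε A M t) := by
  refine LipschitzWith.of_dist_le_mul fun x y => ?_
  rw [Real.coe_toNNReal _ (by positivity), Real.dist_eq, Real.dist_eq]
  unfold clampedField
  set p := max (-M) (min M x)
  set q := max (-M) (min M y)
  have hp : |p| ≤ M := abs_clamp_le hM x
  have hq : |q| ≤ M := abs_clamp_le hM y
  have hpq : |p - q| ≤ |x - y| := abs_clamp_sub_clamp_le M x y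
  rw [← sub_div, force_sub, abs_div, abs_of_pos hε, abs_mul, div_mul_eq_mul_div]
  have hp' := abs_le.1 hp
  have hq' := abs_le.1 hq
  rw [mul_comm (1 + 3 * M ^ 2)]
  refine div_le_div_of_nonneg_right (mul_le_mul hpq ?_ (abs_nonneg _) (abs_nonneg _)) hε.le
  rw [abs_le]
  constructor <;> nlinarith [sq_nonneg (p + q), sq_nonneg (p - q), sq_nonneg p, sq_nonneg q,
    mul_nonneg (sub_nonneg.2 hp'.1) (sub_nonneg.2 hp'.2),
    mul_nonneg (sub_nonneg.2 hq'.1) (sub_nonneg.2 hq'.2)]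

theorem exists_clamped_solution (hε : 0 < ε) (hA : 0 ≤ A) {M : ℝ} (hM : 0 ≤ M) (x₀ : ℝ) :
    ∃ x : ℝ → ℝ, x 0 = x₀ ∧ ∀ t, HasDerivAt x (clampedField ε A M t (x t)) t := by
  refine exists_global_solution_of_bounded_lipschitz
    (L := Real.toNNReal ((M + M ^ 3 + A) / ε)) (clampedField_lipschitz hε hM) ?_ ?_ x₀
  · intro x
    have := continuous_drive A
    unfold clampedField force
    fun_prop
  · intro t x
    rw [Real.coe_toNNReal _ (by positivity), Real.norm_eq_abs]
    unfold clampedField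
    set p := max (-M) (min M x)
    have hp : |p| ≤ M := abs_clamp_le hM x
    have hd := abs_drive_le hA t
    rw [abs_div, abs_of_pos hε]
    gcongr
    unfold force
    have h3 : |p ^ 3| ≤ M ^ 3 := by rw [abs_pow]; gcongr
    calc |p - p ^ 3 + drive A t| ≤ |p - p ^ 3| + |drive A t| := abs_add_le _ _
      _ ≤ |p| + |p ^ 3| + |drive A t| := by gcongr; exact abs_sub _ _
      _ ≤ M + M ^ 3 + A := by gcongr

/-- The field points inwards at `±(A + 2)`, which makes `[-(A + 2), A + 2]` a trapping interval. -/
theorem force_add_two_neg (hA : 0 ≤ A) (t : ℝ) : force (A + 2) (drive A t) < 0 := by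
  have := (abs_le.1 (abs_drive_le hA t)).2
  unfold force
  nlinarith [pow_pos (show 0 < A + 2 by linarith) 2, mul_nonneg hA hA]

theorem force_neg_add_two_pos (hA : 0 ≤ A) (t : ℝ) : 0 < force (-(A + 2)) (drive A t) := by
  have h := force_add_two_neg hA (t + 1 / 2)
  rw [drive_add_half] at h
  have := force_neg (A + 2) (-drive A t)
  rw [neg_neg] at this
  linarith

/-- By the inward field at the ends the clamp is never active in forward time, so clamped solutions
solve the original equation there. -/
theorem clamped_solution_mem (hε : 0 < ε) (hA : 0 ≤ A) {x : ℝ → ℝ}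
    (hx : ∀ t, HasDerivAt x (clampedField ε A (A + 2) t (x t)) t) (h0 : |x 0| ≤ A + 2) {t : ℝ}
    (ht : 0 ≤ t) : |x t| ≤ A + 2 := by
  have hc : ContinuousOn x (Icc 0 t) := fun s _ => (hx s).continuousAt.continuousWithinAt
  have h0' := abs_le.1 h0
  refine abs_le.2 ⟨?_, ?_⟩
  · have := image_le_of_deriv_right_lt_deriv_boundary (f := fun s => -x s)
      (B := fun _ => A + 2) (B' := fun _ => 0) hc.neg
      (fun s _ => (hx s).neg.hasDerivWithinAt) (by linarith) (fun s => hasDerivAt_const s _)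
      (fun s _ hs => by
        have hs' : x s = -(A + 2) := by linarith
        rw [clampedField_eq hs'.ge (by linarith), hs']
        have := div_pos (force_neg_add_two_pos hA s) hε
        linarith) (right_mem_Icc.2 ht)
    linarith
  · exact image_le_of_deriv_right_lt_deriv_boundary (f := x)
      (B := fun _ => A + 2) (B' := fun _ => 0) hc
      (fun s _ => (hx s).hasDerivWithinAt) (by linarith) (fun s => hasDerivAt_const s _)
      (fun s _ hs => by
        rw [clampedField_eq (by linarith) hs.le, hs]
        exact div_neg_of_neg_of_pos (force_add_two_neg hA s) hε) (right_mem_Icc.2 ht)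

theorem clamped_solution_solutionFrom (hε : 0 < ε) (hA : 0 ≤ A) {x : ℝ → ℝ}
    (hx : ∀ t, HasDerivAt x (clampedField ε A (A + 2) t (x t)) t) (h0 : |x 0| ≤ A + 2) :
    IsSolutionFrom ε A 0 x := by
  intro t ht
  have hm := abs_le.1 (clamped_solution_mem hε hA hx h0 ht)
  have := hx t
  rw [clampedField_eq hm.1 hm.2] at this
  exact this.hasDerivWithinAt

theorem exists_solutionFrom_zero (hε : 0 < ε) (hA : 0 ≤ A) {x₀ : ℝ} (h0 : |x₀| ≤ A + 2) :
    ∃ y, y 0 = x₀ ∧ IsSolutionFrom ε A 0 y := by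
  obtain ⟨x, hx0, hx⟩ := exists_clamped_solution (M := A + 2) hε hA (by linarith) x₀
  exact ⟨x, hx0, clamped_solution_solutionFrom hε hA hx (by rw [hx0]; exact h0)⟩

/-- If the period map displaces the two ends of an interval in opposite directions, a periodic
solution starts in the interval. -/
theorem exists_periodic_of_displacement (hε : 0 < ε) (hA : 0 ≤ A) {p q : ℝ} (hpq : p ≤ q)
    (hp : |p| ≤ A + 2) (hq : |q| ≤ A + 2)
    (h : (∀ y, IsSolutionFrom ε A 0 y → (y 0 = p → p ≤ y 1) ∧ (y 0 = q → y 1 ≤ q)) ∨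
      (∀ y, IsSolutionFrom ε A 0 y → (y 0 = p → y 1 ≤ p) ∧ (y 0 = q → q ≤ y 1))) :
    ∃ x, IsGlobalSolution ε A x ∧ Function.Periodic x 1 ∧ x 0 ∈ Icc p q := by
  have hM : (0 : ℝ) ≤ A + 2 := by linarith
  choose φ hφ0 hφ using fun x₀ => exists_clamped_solution (M := A + 2) hε hA hM x₀
  have hmem : ∀ c ∈ Icc p q, |c| ≤ A + 2 := fun c hc => by
    have := abs_le.1 hp; have := abs_le.1 hq
    exact abs_le.2 ⟨by linarith [hc.1], by linarith [hc.2]⟩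
  have hsol : ∀ c ∈ Icc p q, IsSolutionFrom ε A 0 (φ c) := fun c hc =>
    clamped_solution_solutionFrom hε hA (hφ c) (by rw [hφ0]; exact hmem c hc)
  have hlip : LipschitzOnWith (Real.toNNReal (Real.exp (1 / ε))) (fun c => φ c 1) (Icc p q) := by
    refine LipschitzOnWith.of_dist_le_mul fun c hc d hd => ?_
    have := (hsol d hd).abs_sub_le_exp hε (hsol c hc) le_rfl (zero_le_one)
    rw [hφ0, hφ0] at this
    rw [Real.coe_toNNReal _ (Real.exp_pos _).le, Real.dist_eq, Real.dist_eq, mul_comm]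
    simpa using this
  have hcont : ContinuousOn (fun c => φ c 1 - c) (uIcc p q) := by
    rw [uIcc_of_le hpq]
    exact hlip.continuousOn.sub continuousOn_id
  have hmem0 : (0 : ℝ) ∈ uIcc (φ p 1 - p) (φ q 1 - q) := by
    rw [mem_uIcc]
    rcases h with h | h
    · right
      have h1 := (h _ (hsol p (left_mem_Icc.2 hpq))).1 (hφ0 p)
      have h2 := (h _ (hsol q (right_mem_Icc.2 hpq))).2 (hφ0 q)
      constructor <;> linarith
    · left
      have h1 := (h _ (hsol p (left_mem_Icc.2 hpq))).1 (hφ0 p)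
      have h2 := (h _ (hsol q (right_mem_Icc.2 hpq))).2 (hφ0 q)
      constructor <;> linarith
  obtain ⟨c, hc, hc0⟩ := intermediate_value_uIcc hcont hmem0
  rw [uIcc_of_le hpq] at hc
  -- The shifted function solves the same clamped equation with the same value at `0`. Uniqueness
  -- for the clamped field works in both time directions, so periodicity holds on the whole line.
  have hper : Function.Periodic (φ c) 1 := by
    have hshift : ∀ t, HasDerivAt (fun t => φ c (t + 1))
        (clampedField ε A (A + 2) t (φ c (t + 1))) t := by
      intro t
      have := (hφ c (t + 1)).comp_add_const t 1
      unfold clampedField at this ⊢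
      rwa [drive_add_one] at this
    have heq := ODE_solution_unique_univ (v := clampedField ε A (A + 2)) (s := fun _ => univ)
      (t₀ := 0) (fun t => (clampedField_lipschitz hε hM t).lipschitzOnWith)
      (fun t => ⟨hshift t, trivial⟩) (fun t => ⟨hφ c t, trivial⟩)
      (by simp only [zero_add]; rw [hφ0]; linarith [hc0])
    exact fun t => congrFun heq t
  refine ⟨φ c, fun t => ?_, hper, by rw [hφ0]; exact hc⟩
  -- The trapping bound is only known for nonnegative times; periodicity carries it to negative
  -- ones, so the clamp is inactive everywhere.
  obtain ⟨n, hn⟩ := exists_nat_ge (-t)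
  have hb : |φ c t| ≤ A + 2 := by
    have := clamped_solution_mem hε hA (hφ c) (by rw [hφ0]; exact hmem c hc)
      (show 0 ≤ t + n * 1 by linarith)
    rwa [hper.nat_mul n] at this
  have := hφ c t
  rwa [clampedField_eq (abs_le.1 hb).1 (abs_le.1 hb).2] at this

end Existence

/-! ### Periodic solutions -/

section Periodic

variable {ε A : ℝ} {x y z : ℝ → ℝ}

/-- The period of a periodic solution is a multiple of that of the driving. -/
theorem IsPeriodicSolution.exists_int_period (hε : 0 < ε) (hA : 0 < A)
    (hx : IsPeriodicSolution ε A x) : ∃ n : ℕ, 0 < n ∧ Function.Periodic x n := by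
  obtain ⟨hsol, T, hT, hper⟩ := hx
  have hd : force (x (0 + T)) (drive A (0 + T)) / ε = force (x 0) (drive A 0) / ε := by
    -- The derivatives at `T` and `0` agree along with the values, so the driving agrees too; `cos
    -- (2πT) = 1` makes `T` an integer.
    have h1 := (hsol (0 + T)).comp_add_const 0 T
    have h2 : (fun t => x (t + T)) = x := funext hper
    rw [h2] at h1
    exact h1.unique (hsol 0)
  rw [hper 0, div_left_inj' hε.ne', zero_add] at hd
  unfold force drive at hd
  have hcos : Real.cos (2 * Real.pi * T) = 1 := by
    simp only [mul_zero, Real.cos_zero, mul_one] at hd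
    have : A * Real.cos (2 * Real.pi * T) = A * 1 := by linarith
    exact mul_left_cancel₀ hA.ne' this
  obtain ⟨k, hk⟩ := (Real.cos_eq_one_iff _).1 hcos
  have hkT : (k : ℝ) = T := by
    have : (2 * Real.pi) * k = (2 * Real.pi) * T := by linarith
    exact mul_left_cancel₀ (by positivity) this
  have hk0 : 0 < k := by
    have : (0 : ℝ) < k := by rw [hkT]; exact hT
    exact_mod_cast this
  lift k to ℕ using hk0.le
  exact ⟨k, by exact_mod_cast hk0, by rw [← hkT] at hper; exact_mod_cast hper⟩

/-- Along the times `t + k n` the difference is constant, and it tends to `0`. Attraction thus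
yields uniqueness of periodic solutions. -/
theorem eq_of_periodic_of_tendsto_zero {n : ℕ} (hn : 0 < n) (hx : Function.Periodic x n)
    (hz : Function.Periodic z n) (h : AttractedBy z x) : z = x := by
  funext t
  have h1 : Tendsto (fun k : ℕ => t + k * (n : ℝ)) atTop atTop := by
    refine tendsto_atTop_add_const_left _ _ ?_
    exact tendsto_natCast_atTop_atTop.atTop_mul_const (by exact_mod_cast hn)
  have h2 := h.comp h1
  have h3 : ((fun t => z t - x t) ∘ fun k : ℕ => t + k * (n : ℝ)) = fun _ => z t - x t := by
    funext k
    simp only [Function.comp_apply]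
    rw [hx.nat_mul k, hz.nat_mul k]
  rw [h3] at h2
  have := tendsto_nhds_unique h2 tendsto_const_nhds
  linarith

theorem Function.Periodic.natCast_of_one (hx : Function.Periodic x 1) (n : ℕ) :
    Function.Periodic x n := by
  simpa using hx.nat_mul n

theorem IsPeriodicSolution.eq_of_attracted (hε : 0 < ε) (hA : 0 < A)
    (hz : IsPeriodicSolution ε A z) (hx : Function.Periodic x 1) (h : AttractedBy z x) :
    z = x := by
  obtain ⟨n, hn, hper⟩ := hz.exists_int_period hε hA
  exact eq_of_periodic_of_tendsto_zero hn (hx.natCast_of_one n) hper h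

theorem IsPeriodicSolution.eq_of_eq_zero (hε : 0 < ε) (hA : 0 < A)
    (hz : IsPeriodicSolution ε A z) (hx : IsGlobalSolution ε A x) (hx1 : Function.Periodic x 1)
    (h : z 0 = x 0) : z = x := by
  refine hz.eq_of_attracted hε hA hx1 ?_
  refine tendsto_const_nhds.congr' ?_
  filter_upwards [eventually_ge_atTop 0] with t ht
  have := (hx.solutionFrom 0).abs_sub_le_exp hε (hz.1.solutionFrom 0) le_rfl ht
  rw [h, sub_self, abs_zero, zero_mul] at this
  exact (abs_nonpos_iff.1 this).symm

theorem exists_forall_le_of_periodic {f : ℝ → ℝ} (hf : Continuous f) {T : ℝ} (hT : 0 < T)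
    (hper : Function.Periodic f T) : ∃ s, ∀ t, f t ≤ f s := by
  obtain ⟨s, -, hs⟩ := isCompact_Icc.exists_isMaxOn (nonempty_Icc.2 hT.le)
    (hf.continuousOn (s := Icc 0 T))
  refine ⟨s, fun t => ?_⟩
  obtain ⟨r, hr, hrt⟩ := hper.exists_mem_Ico₀ hT t
  rw [hrt]
  exact hs (Ico_subset_Icc_self hr)

/-- At a maximum of the solution the force vanishes, which is impossible above `A + 2`. -/
theorem IsPeriodicSolution.le_add_two (hε : 0 < ε) (hA : 0 ≤ A) (hx : IsPeriodicSolution ε A x)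
    (t : ℝ) : x t ≤ A + 2 := by
  obtain ⟨hsol, T, hT, hper⟩ := hx
  obtain ⟨s, hs⟩ := exists_forall_le_of_periodic hsol.continuous hT hper
  refine (hs t).trans ?_
  have h0 : force (x s) (drive A s) / ε = 0 :=
    IsLocalMax.hasDerivAt_eq_zero (Eventually.of_forall hs) (hsol s)
  have h1 : force (x s) (drive A s) = 0 := (div_eq_zero_iff.1 h0).resolve_right hε.ne'
  by_contra! hlt
  have h2 := force_sub (x s) (A + 2) (drive A s)
  have h3 := force_add_two_neg hA s
  have h4 : (x s - (A + 2)) * (1 - (x s ^ 2 + x s * (A + 2) + (A + 2) ^ 2)) ≤ 0 :=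
    mul_nonpos_of_nonneg_of_nonpos (by linarith) (by nlinarith)
  linarith

theorem IsPeriodicSolution.antisymm_shift (hx : IsPeriodicSolution ε A x) :
    IsPeriodicSolution ε A fun t => -x (t + 1 / 2) := by
  obtain ⟨hsol, T, hT, hper⟩ := hx
  refine ⟨hsol.antisymm_shift, T, hT, fun t => ?_⟩
  change -x (t + T + 1 / 2) = -x (t + 1 / 2)
  rw [show t + T + 1 / 2 = t + 1 / 2 + T by ring, hper]

theorem IsPeriodicSolution.abs_le_add_two (hε : 0 < ε) (hA : 0 ≤ A)
    (hx : IsPeriodicSolution ε A x) (t : ℝ) : |x t| ≤ A + 2 := by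
  refine abs_le.2 ⟨?_, hx.le_add_two hε hA t⟩
  have := hx.antisymm_shift.le_add_two hε hA (t - 1 / 2)
  rw [sub_add_cancel] at this
  linarith

/-! ### The velocity and the area -/

/-- The velocity `x'` of a solution. -/
noncomputable def velocity (ε A : ℝ) (x : ℝ → ℝ) (t : ℝ) : ℝ := force (x t) (drive A t) / ε

theorem hasDerivAt_velocity (hx : IsGlobalSolution ε A x) (t : ℝ) :
    HasDerivAt (velocity ε A x)
      (((1 - 3 * x t ^ 2) * velocity ε A x t + 2 * Real.pi * A * Real.sin (2 * Real.pi * t)) / ε)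
      t := by
  have h1 := hx t
  have h2 := (((h1.sub (h1.pow 3)).add (hasDerivAt_drive A t)).div_const ε)
  convert! h2 using 1
  unfold velocity
  push_cast
  ring

theorem continuous_velocity (hx : IsGlobalSolution ε A x) : Continuous (velocity ε A x) :=
  continuous_iff_continuousAt.2 fun t => (hasDerivAt_velocity hx t).continuousAt

theorem velocity_periodic (hx : Function.Periodic x 1) :
    Function.Periodic (velocity ε A x) 1 := by
  intro t
  unfold velocity
  rw [hx, drive_add_one]

/-- At a maximum of the speed of a periodic solution the linearized force balances `λ'`. -/
theorem abs_velocity_le (hx : IsGlobalSolution ε A x) (hε : 0 < ε)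
    (hper : Function.Periodic x 1) {V : ℝ} (hV : 0 ≤ V)
    (h : ∀ t v, (1 - 3 * x t ^ 2) * v + 2 * Real.pi * A * Real.sin (2 * Real.pi * t) = 0 → |v| ≤ V)
    (t : ℝ) : |velocity ε A x t| ≤ V := by
  have hc : Continuous fun t => velocity ε A x t ^ 2 := (continuous_velocity hx).pow 2
  obtain ⟨s, hs⟩ := exists_forall_le_of_periodic hc one_pos
    (fun t => by simp only [velocity_periodic hper t])
  have h0 := IsLocalMax.hasDerivAt_eq_zero (Eventually.of_forall hs)
    ((hasDerivAt_velocity hx s).pow 2)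
  have hsV : |velocity ε A x s| ≤ V := by
    by_cases hv : velocity ε A x s = 0
    · rw [hv, abs_zero]; exact hV
    · refine h s _ ?_
      have h1 : 2 * velocity ε A x s * (((1 - 3 * x s ^ 2) * velocity ε A x s +
          2 * Real.pi * A * Real.sin (2 * Real.pi * s)) / ε) = 0 := by
        simpa using h0
      rcases mul_eq_zero.1 h1 with h2 | h2
      · exact absurd (by linarith) hv
      · exact (div_eq_zero_iff.1 h2).resolve_right hε.ne'
  exact (sq_le_sq.1 (hs t)).trans hsV

/-- The area is the dissipated energy `ε ∫ x'²`. -/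
theorem hysteresisArea_eq (hx : IsGlobalSolution ε A x) (hε : 0 < ε)
    (hper : Function.Periodic x 1) :
    hysteresisArea A x = ∫ t in (-1 / 2 : ℝ)..(1 / 2 : ℝ), ε * velocity ε A x t ^ 2 := by
  -- `W` is minus the potential; along a solution its derivative is `ε v² + x λ'`, and its increment
  -- over a period is zero.
  set W : ℝ → ℝ := fun t => x t ^ 2 / 2 - x t ^ 4 / 4 + x t * drive A t with hW
  have hWd : ∀ t, HasDerivAt W
      (ε * velocity ε A x t ^ 2 + x t * deriv (drive A) t) t := by
    intro t
    have h1 := hx t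
    have h2 := (((h1.pow 2).div_const 2).sub ((h1.pow 4).div_const 4)).add
      (h1.mul (hasDerivAt_drive A t))
    convert! h2 using 1
    rw [deriv_drive]
    unfold velocity force
    push_cast
    field_simp
    ring
  have hv := continuous_velocity hx
  have hc1 : Continuous fun t => ε * velocity ε A x t ^ 2 := by fun_prop
  have hc2 : Continuous fun t => x t * deriv (drive A) t := by
    have := hx.continuous
    simp only [deriv_drive]
    fun_prop
  have hint := intervalIntegral.integral_eq_sub_of_hasDerivAt
    (fun t _ => hWd t) ((hc1.add hc2).intervalIntegrable (-1 / 2) (1 / 2))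
  have hW0 : W (1 / 2) = W (-1 / 2) := by
    have h1 : x (1 / 2) = x (-1 / 2) := by rw [← hper (-1 / 2)]; norm_num
    have h2 : drive A (1 / 2) = drive A (-1 / 2) := by
      rw [← drive_add_one A (-1 / 2)]; norm_num
    simp only [hW, h1, h2]
  rw [intervalIntegral.integral_add (hc1.intervalIntegrable _ _) (hc2.intervalIntegrable _ _),
    hW0, sub_self] at hint
  unfold hysteresisArea
  linarith

end Periodic

/-! ### Equilibrium branches -/

/-- Two distinct zeros would satisfy `x² + xz + z² = 1`, but the sum exceeds `3 x_c² = 1` for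
distinct points above `x_c`. -/
theorem eq_of_force_eq_zero_upper {x z l : ℝ} (hx : force x l = 0) (hz : force z l = 0)
    (hx1 : xC ≤ x) (hz1 : xC ≤ z) : z = x := by
  by_contra hne
  have h := force_sub z x l
  rw [hx, hz, sub_self, eq_comm, mul_eq_zero] at h
  have h2 := h.resolve_left (sub_ne_zero.2 hne)
  have := xC_sq
  have := xC_pos
  rcases lt_or_gt_of_ne hne with h3 | h3 <;> nlinarith

theorem branchPlus_eq {x l : ℝ} (hx : force x l = 0) (hx1 : xC ≤ x) : branchPlus l = x := by
  unfold branchPlus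
  have : {x | force x l = 0 ∧ xC ≤ x} = {x} := by
    ext z
    simp only [mem_ofPred_eq, mem_singleton_iff]
    constructor
    · rintro ⟨h1, h2⟩
      exact eq_of_force_eq_zero_upper hx h1 hx1 h2
    · rintro rfl
      exact ⟨hx, hx1⟩
  rw [this, csSup_singleton]

theorem branchMinus_eq {x l : ℝ} (hx : force x l = 0) (hx1 : x ≤ -xC) : branchMinus l = x := by
  unfold branchMinus
  have : {x | force x l = 0 ∧ x ≤ -xC} = {x} := by
    ext z
    simp only [mem_ofPred_eq, mem_singleton_iff]
    constructor
    · rintro ⟨h1, h2⟩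
      have := eq_of_force_eq_zero_upper (x := -x) (z := -z) (l := -l)
        (by rw [force_neg, hx, neg_zero]) (by rw [force_neg, h1, neg_zero]) (by linarith)
        (by linarith)
      linarith
    · rintro rfl
      exact ⟨hx, hx1⟩
  rw [this, csSup_singleton]

theorem branchZero_eq {x l : ℝ} (hx : force x l = 0) (hx1 : |x| ≤ xC) : branchZero l = x := by
  unfold branchZero
  have : {x | force x l = 0 ∧ |x| ≤ xC} = {x} := by
    ext z
    simp only [mem_ofPred_eq, mem_singleton_iff]
    constructor
    · rintro ⟨hz, h2⟩
      by_contra hne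
      have h := force_sub z x l
      rw [hx, hz, sub_self, eq_comm, mul_eq_zero] at h
      have h3 := h.resolve_left (sub_ne_zero.2 hne)
      have := xC_sq
      have := xC_pos
      have hx2 := abs_le.1 hx1
      have hz2 := abs_le.1 h2
      rcases lt_or_gt_of_ne hne with h4 | h4 <;>
        nlinarith [mul_nonneg (sub_nonneg.2 hx2.1) (sub_nonneg.2 hx2.2),
          mul_nonneg (sub_nonneg.2 hz2.1) (sub_nonneg.2 hz2.2)]
    · rintro rfl
      exact ⟨hx, hx1⟩
  rw [this, csSup_singleton]

theorem continuous_force (l : ℝ) : Continuous fun x => force x l := by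
  unfold force; fun_prop

theorem exists_upper_equilibrium {l : ℝ} (hl : -lamC ≤ l) : ∃ x, force x l = 0 ∧ xC ≤ x := by
  have hle : xC ≤ |l| + 2 := by linarith [xC_lt, abs_nonneg l]
  have h0 : (0 : ℝ) ∈ Icc (force (|l| + 2) l) (force xC l) := by
    constructor
    · unfold force
      nlinarith [le_abs_self l, abs_nonneg l, pow_nonneg (abs_nonneg l) 2,
        pow_nonneg (abs_nonneg l) 3]
    · rw [force_xC]; linarith
  obtain ⟨x, hx, hx0⟩ := intermediate_value_Icc' hle (continuous_force l).continuousOn h0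
  exact ⟨x, hx0, hx.1⟩

theorem exists_lower_equilibrium {l : ℝ} (hl : l ≤ lamC) : ∃ x, force x l = 0 ∧ x ≤ -xC := by
  obtain ⟨x, h1, h2⟩ := exists_upper_equilibrium (l := -l) (by linarith)
  refine ⟨-x, ?_, by linarith⟩
  have := force_neg x (-l)
  rwa [neg_neg, h1, neg_zero] at this

theorem exists_middle_equilibrium {l : ℝ} (hl : |l| ≤ lamC) : ∃ x, force x l = 0 ∧ |x| ≤ xC := by
  have hl' := abs_le.1 hl
  have h0 : (0 : ℝ) ∈ Icc (force (-xC) l) (force xC l) := by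
    rw [force_xC, force_neg_xC]
    constructor <;> linarith
  obtain ⟨x, hx, hx0⟩ := intermediate_value_Icc (by linarith [xC_pos])
    (continuous_force l).continuousOn h0
  exact ⟨x, hx0, abs_le.2 hx⟩

theorem branchMinus_eq_neg {l : ℝ} (hl : l ≤ lamC) : branchMinus l = -branchPlus (-l) := by
  obtain ⟨x, h1, h2⟩ := exists_lower_equilibrium hl
  rw [branchMinus_eq h1 h2, branchPlus_eq (x := -x) (by rw [force_neg, h1, neg_zero])
    (by linarith), neg_neg]

/-! ### The static area -/

theorem monotoneOn_branchPlus : MonotoneOn branchPlus (Ici (-lamC)) := by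
  intro a ha b hb hab
  obtain ⟨x, hx, hx1⟩ := exists_upper_equilibrium ha
  obtain ⟨z, hz, hz1⟩ := exists_upper_equilibrium hb
  rw [branchPlus_eq hx hx1, branchPlus_eq hz hz1]
  by_contra! hlt
  have h1 := force_sub x z b
  have h2 : force x b = b - a := by unfold force at *; linarith
  rw [h2, hz] at h1
  have := xC_sq
  have := xC_pos
  have h3 : 1 < x ^ 2 + x * z + z ^ 2 := by nlinarith
  nlinarith

theorem image_cube_sub : (fun x : ℝ => x ^ 3 - x) '' Icc xC (2 * xC) = Icc (-lamC) lamC := by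
  have hpos := xC_pos
  have hsq := xC_sq
  have h1 : xC ^ 3 - xC = -lamC := by rw [lamC_eq]; linear_combination xC * hsq
  have h2 : (2 * xC) ^ 3 - 2 * xC = lamC := by rw [lamC_eq]; linear_combination 8 * xC * hsq
  have hmono : MonotoneOn (fun x : ℝ => x ^ 3 - x) (Icc xC (2 * xC)) := by
    intro a ha b hb hab
    have : 0 ≤ (b - a) * (b ^ 2 + a * b + a ^ 2 - 1) :=
      mul_nonneg (by linarith) (by nlinarith [ha.1, hb.1])
    change a ^ 3 - a ≤ b ^ 3 - b
    linarith
  apply Subset.antisymm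
  · rintro _ ⟨x, hx, rfl⟩
    constructor
    · rw [← h1]; exact hmono (left_mem_Icc.2 (by linarith)) hx hx.1
    · rw [← h2]; exact hmono hx (right_mem_Icc.2 (by linarith)) hx.2
  · have := intermediate_value_Icc (show xC ≤ 2 * xC by linarith)
      (show ContinuousOn (fun x : ℝ => x ^ 3 - x) (Icc xC (2 * xC)) by fun_prop)
    simpa only [h1, h2] using this

/-- On `[x_c, 2 x_c]` the map `x ↦ x³ - x` inverts the branch, so substitution turns the integral
into that of `x (3x² - 1)`. -/
theorem integral_branchPlus : ∫ l in (-lamC)..lamC, branchPlus l = 3 / 4 := by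
  have hpos := xC_pos
  have hsq := xC_sq
  have hl := lamC_pos
  rw [intervalIntegral.integral_of_le (by linarith), ← MeasureTheory.integral_Icc_eq_integral_Ioc,
    ← image_cube_sub]
  have hder : ∀ x ∈ Icc xC (2 * xC),
      HasDerivWithinAt (fun x : ℝ => x ^ 3 - x) (3 * x ^ 2 - 1) (Icc xC (2 * xC)) x := by
    intro x _
    have := ((hasDerivAt_pow 3 x).sub (hasDerivAt_id x)).hasDerivWithinAt (s := Icc xC (2 * xC))
    simpa using! this
  have hinj : InjOn (fun x : ℝ => x ^ 3 - x) (Icc xC (2 * xC)) := by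
    intro a ha b hb hab
    refine eq_of_force_eq_zero_upper (l := a ^ 3 - a) ?_ ?_ hb.1 ha.1
    · simp only at hab; unfold force; linarith
    · unfold force; ring
  rw [MeasureTheory.integral_image_eq_integral_abs_deriv_smul measurableSet_Icc hder hinj]
  have hcongr : ∀ x ∈ Icc xC (2 * xC),
      |3 * x ^ 2 - 1| • branchPlus (x ^ 3 - x) = 3 * x ^ 3 - x := by
    intro x hx
    rw [branchPlus_eq (x := x) (by unfold force; ring) hx.1,
      abs_of_nonneg (by nlinarith [hx.1]), smul_eq_mul]
    ring
  rw [MeasureTheory.setIntegral_congr_fun measurableSet_Icc hcongr,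
    MeasureTheory.integral_Icc_eq_integral_Ioc,
    ← intervalIntegral.integral_of_le (by linarith)]
  have hF : ∀ x ∈ uIcc xC (2 * xC),
      HasDerivAt (fun x : ℝ => 3 / 4 * x ^ 4 - x ^ 2 / 2) (3 * x ^ 3 - x) x := by
    intro x _
    have := ((hasDerivAt_pow 4 x).const_mul (3 / 4)).sub ((hasDerivAt_pow 2 x).div_const 2)
    convert! this using 1
    push_cast; ring
  rw [intervalIntegral.integral_eq_sub_of_hasDerivAt hF
    (Continuous.intervalIntegrable (by fun_prop) _ _)]
  have h4 : xC ^ 4 = 1 / 9 := by rw [show xC ^ 4 = (xC ^ 2) ^ 2 by ring, hsq]; norm_num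
  nlinarith

theorem staticArea_eq : staticArea = 3 / 2 := by
  have hl := lamC_pos
  have hint : IntervalIntegrable branchPlus MeasureTheory.volume (-lamC) lamC := by
    refine MonotoneOn.intervalIntegrable (monotoneOn_branchPlus.mono ?_)
    rw [uIcc_of_le (by linarith)]
    exact Icc_subset_Ici_self
  have hint' : IntervalIntegrable (fun l => branchPlus (-l)) MeasureTheory.volume (-lamC) lamC := by
    refine AntitoneOn.intervalIntegrable fun a ha b hb hab => ?_
    rw [uIcc_of_le (by linarith)] at ha hb
    exact monotoneOn_branchPlus (neg_le_neg hb.2) (neg_le_neg ha.2) (neg_le_neg hab)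
  unfold staticArea
  have hcongr : ∀ l ∈ uIcc (-lamC) lamC,
      branchPlus l - branchMinus l = branchPlus l + branchPlus (-l) := by
    intro l hl'
    rw [uIcc_of_le (by linarith)] at hl'
    rw [branchMinus_eq_neg hl'.2]; ring
  rw [intervalIntegral.integral_congr hcongr, intervalIntegral.integral_add hint hint',
    intervalIntegral.integral_comp_neg, neg_neg, integral_branchPlus]
  norm_num

/-! ### Barriers for small amplitude -/

/-- The distance scale from the fold point at time `t`. -/
noncomputable def foldScale (ε A t : ℝ) : ℝ :=
  Real.sqrt (Real.sin (Real.pi * t) ^ 2 + ε + max 0 (lamC - A))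

/-- The profile of the barriers that separate the branches near the upper fold. -/
noncomputable def bump (ε A t : ℝ) : ℝ :=
  1 / 4000 * (foldScale ε A t - Real.sin (Real.pi * t) * Real.cos (Real.pi * t) / 2)

/-- The derivative of `bump`. -/
noncomputable def bumpDeriv (ε A t : ℝ) : ℝ :=
  1 / 4000 * (Real.pi * (Real.sin (Real.pi * t) * Real.cos (Real.pi * t) / foldScale ε A t -
    1 / 2 + Real.sin (Real.pi * t) ^ 2))

section SmallAmplitude

variable {ε A t₀ : ℝ} {x y : ℝ → ℝ}

theorem foldScale_sq (hε : 0 < ε) (t : ℝ) :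
    foldScale ε A t ^ 2 = Real.sin (Real.pi * t) ^ 2 + ε + max 0 (lamC - A) :=
  Real.sq_sqrt (by positivity)

theorem foldScale_pos (hε : 0 < ε) (t : ℝ) : 0 < foldScale ε A t :=
  Real.sqrt_pos.2 (by positivity)

theorem foldScale_neg (t : ℝ) : foldScale ε A (-t) = foldScale ε A t := by
  unfold foldScale; simp

theorem abs_sin_le_foldScale (hε : 0 < ε) (t : ℝ) :
    |Real.sin (Real.pi * t)| ≤ foldScale ε A t := by
  refine Real.le_sqrt_of_sq_le ?_
  rw [sq_abs]
  have : 0 ≤ max 0 (lamC - A) := le_max_left _ _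
  linarith

theorem sqrt_le_foldScale (t : ℝ) : Real.sqrt (ε + max 0 (lamC - A)) ≤ foldScale ε A t := by
  refine Real.sqrt_le_sqrt ?_
  nlinarith [sq_nonneg (Real.sin (Real.pi * t))]

theorem foldScale_le_two (hε1 : ε < 1 / 1000) (hA : 0 < A) (t : ℝ) : foldScale ε A t ≤ 2 := by
  refine Real.sqrt_le_iff.2 ⟨by norm_num, ?_⟩
  have h1 := Real.sin_sq_le_one (Real.pi * t)
  have h2 : max 0 (lamC - A) ≤ 1 := max_le (by norm_num) (by linarith [lamC_lt])
  linarith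

theorem abs_sin_mul_cos_le (hε : 0 < ε) (t : ℝ) :
    |Real.sin (Real.pi * t) * Real.cos (Real.pi * t)| ≤ foldScale ε A t := by
  rw [abs_mul]
  exact (mul_le_of_le_one_right (abs_nonneg _) (Real.abs_cos_le_one _)).trans
    (abs_sin_le_foldScale hε t)

theorem bump_ge (hε : 0 < ε) (t : ℝ) : foldScale ε A t / 8000 ≤ bump ε A t := by
  have := abs_le.1 (abs_sin_mul_cos_le (A := A) hε t)
  unfold bump
  linarith

theorem bump_le (hε : 0 < ε) (t : ℝ) : bump ε A t ≤ 3 / 8000 * foldScale ε A t := by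
  have := abs_le.1 (abs_sin_mul_cos_le (A := A) hε t)
  unfold bump
  linarith

theorem bump_pos (hε : 0 < ε) (t : ℝ) : 0 < bump ε A t :=
  lt_of_lt_of_le (by linarith [foldScale_pos (A := A) hε t]) (bump_ge hε t)

theorem bump_le_small (hε : 0 < ε) (hε1 : ε < 1 / 1000) (hA : 0 < A) (t : ℝ) :
    bump ε A t ≤ 1 / 1000 := by
  have := bump_le (A := A) hε t
  have := foldScale_le_two hε1 hA t
  linarith

theorem bump_add_one (t : ℝ) : bump ε A (t + 1) = bump ε A t := by
  unfold bump foldScale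
  rw [mul_add, mul_one, Real.sin_add_pi, Real.cos_add_pi]
  ring_nf

theorem bump_add_int (t : ℝ) (n : ℤ) : bump ε A (t + n) = bump ε A t := by
  have h : Function.Periodic (bump ε A) 1 := bump_add_one
  simpa using h.int_mul n t

theorem hasDerivAt_bump (hε : 0 < ε) (t : ℝ) : HasDerivAt (bump ε A) (bumpDeriv ε A t) t := by
  have h0 : HasDerivAt (fun t : ℝ => Real.pi * t) Real.pi t := by
    simpa using (hasDerivAt_id t).const_mul Real.pi
  have hne : Real.sin (Real.pi * t) ^ 2 + ε + max 0 (lamC - A) ≠ 0 := by positivity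
  have h1 := ((((h0.sin.pow 2).add_const ε).add_const (max 0 (lamC - A))).sqrt hne)
  have h2 := (h1.sub ((h0.sin.mul h0.cos).div_const 2)).const_mul (1 / 4000)
  convert! h2 using 1
  unfold bumpDeriv foldScale
  have hs : Real.sqrt (Real.sin (Real.pi * t) ^ 2 + ε + max 0 (lamC - A)) ≠ 0 :=
    (Real.sqrt_pos.2 (by positivity)).ne'
  simp only [Pi.pow_apply]
  field_simp
  have := Real.sin_sq_add_cos_sq (Real.pi * t)
  push_cast
  linear_combination (Real.sqrt (Real.sin (Real.pi * t) ^ 2 + ε + max 0 (lamC - A))) * this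

theorem drive_add_lamC (A t : ℝ) :
    drive A t + lamC = (lamC - A) + 2 * A * Real.sin (Real.pi * t) ^ 2 := by
  unfold drive
  rw [show 2 * Real.pi * t = 2 * (Real.pi * t) by ring, Real.cos_two_mul]
  linear_combination (-2 * A) * Real.sin_sq_add_cos_sq (Real.pi * t)

theorem drive_neg (A t : ℝ) : drive A (-t) = drive A t := by
  unfold drive; simp

/-- The driving is quadratic in `sin (πt)` about its minimum. The coefficient `0.09` is dictated by
small `A`, where the quadratic term is weak but `(λ_c - A)/2 ≥ λ_c/4` replaces it. -/
theorem drive_add_lamC_ge (hA : 0 < A) (hA1 : A - lamC ≤ ε / 8000) (hε : 0 < ε) (t : ℝ) :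
    -(ε / 8000) + max 0 (lamC - A) / 2 + 0.09 * Real.sin (Real.pi * t) ^ 2 ≤
      drive A t + lamC := by
  rw [drive_add_lamC]
  have hs0 := sq_nonneg (Real.sin (Real.pi * t))
  have hs1 := Real.sin_sq_le_one (Real.pi * t)
  have hl := lamC_gt
  rcases le_total lamC A with h | h
  · rw [max_eq_left (by linarith)]
    nlinarith
  · rw [max_eq_right (by linarith)]
    rcases le_total (lamC / 2) A with h1 | h1
    · nlinarith
    · nlinarith [mul_nonneg hA.le hs0]

/-- The barrier must survive a driving slightly past the fold. The correction `-sin cos / 2` in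
`bump` gives it slope `-π/8000` at integer times, and this descent pays for the deficit `ε/8000`.
The numerical factor of `bump` makes the quadratic and cubic terms negligible. -/
theorem bump_subsolution (hε : 0 < ε) (hε1 : ε < 1 / 1000) (hA : 0 < A)
    (hA1 : A - lamC ≤ ε / 8000) (t : ℝ) :
    ε * bumpDeriv ε A t + bump ε A t ^ 2 * (bump ε A t + 3 * xC) < drive A t + lamC := by
  have hR := drive_add_lamC_ge hA hA1 hε t
  have hu0 := bump_pos (A := A) hε t
  have hu1 := bump_le (A := A) hε t
  have hu2 := bump_le_small hε hε1 hA t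
  have hρ := foldScale_pos (A := A) hε t
  have hρ2 := foldScale_sq (A := A) hε t
  have hm : 0 ≤ max 0 (lamC - A) := le_max_left _ _
  have hs0 := sq_nonneg (Real.sin (Real.pi * t))
  have hs1 := Real.sin_sq_le_one (Real.pi * t)
  have hc1 := Real.cos_sq_le_one (Real.pi * t)
  have hsc := abs_le.1 (abs_sin_mul_cos_le (A := A) hε t)
  have hpi := Real.pi_gt_three
  have hpi2 := Real.pi_lt_four
  unfold bumpDeriv
  set s := Real.sin (Real.pi * t)
  set c := Real.cos (Real.pi * t)
  set ρ := foldScale ε A t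
  set u := bump ε A t
  set m := max 0 (lamC - A)
  have hcub : u ^ 2 * (u + 3 * xC) ≤ 1 / 1000000 * (s ^ 2 + ε + m) := by
    rw [← hρ2]
    have h1 : u ^ 2 ≤ (3 / 8000 * ρ) ^ 2 := by gcongr
    have h2 : u + 3 * xC ≤ 3 := by linarith [xC_lt]
    have h3 : u ^ 2 * (u + 3 * xC) ≤ u ^ 2 * 3 := by gcongr
    nlinarith
  have hK1 : s * c / ρ ≤ 1 := (div_le_one hρ).2 hsc.2
  set K := s * c / ρ with hK
  -- For small `K` the barrier descends enough, up to a term in `s²` absorbed by the driving. For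
  -- large `K` one has `s² > ρ²/64`, so the driving term `0.09 s²` dominates everything of order
  -- `ε`.
  rcases le_or_gt K (1 / 8) with h | h
  · have h1 : Real.pi * (K - 1 / 2 + s ^ 2) ≤ 3 * (-(3 / 8)) + 4 * s ^ 2 := by nlinarith
    have h2 : ε * (1 / 4000 * (Real.pi * (K - 1 / 2 + s ^ 2))) ≤
        ε * (1 / 4000 * (3 * (-(3 / 8)) + 4 * s ^ 2)) := by gcongr
    nlinarith [mul_nonneg hε.le hs0, mul_le_mul_of_nonneg_right hε1.le hs0]
  · have h1 : Real.pi * (K - 1 / 2 + s ^ 2) ≤ 2 + 4 * s ^ 2 := by nlinarith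
    have h2 : ε * (1 / 4000 * (Real.pi * (K - 1 / 2 + s ^ 2))) ≤
        ε * (1 / 4000 * (2 + 4 * s ^ 2)) := by gcongr
    have h3 : ρ / 8 < s * c := by
      have := (lt_div_iff₀ hρ).1 h
      linarith
    have h4 : (ρ / 8) ^ 2 < (s * c) ^ 2 := by gcongr
    have h5 : (s * c) ^ 2 ≤ s ^ 2 := by rw [mul_pow]; nlinarith
    nlinarith [mul_le_mul_of_nonneg_right hε1.le hs0]

end SmallAmplitude

/-! ### Invariant regions, attraction and periodic solutions for small amplitude. -/

section SmallAmplitudeDynamics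

variable {ε A t₀ : ℝ} {x y : ℝ → ℝ}

theorem force_xC_add (u l : ℝ) : force (xC + u) l = l + lamC - u ^ 2 * (u + 3 * xC) := by
  rw [force_eq_fold]; ring

theorem hasDerivAt_upperBarrier (hε : 0 < ε) (t : ℝ) :
    HasDerivAt (fun t => xC + bump ε A t) (bumpDeriv ε A t) t :=
  (hasDerivAt_bump hε t).const_add xC

theorem hasDerivAt_middleBarrier (hε : 0 < ε) (t : ℝ) :
    HasDerivAt (fun t => xC - bump ε A (-t)) (bumpDeriv ε A (-t)) t := by
  have := ((hasDerivAt_bump (A := A) hε (-t)).scomp t (hasDerivAt_neg t)).const_sub xC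
  simpa using! this

theorem upperBarrier_strict (hε : 0 < ε) (hε1 : ε < 1 / 1000) (hA : 0 < A)
    (hA1 : A - lamC ≤ ε / 8000) (t : ℝ) :
    ε * bumpDeriv ε A t < force (xC + bump ε A t) (drive A t) := by
  rw [force_xC_add]
  linarith [bump_subsolution hε hε1 hA hA1 t]

/-- Reflecting the offset and reversing time preserves the derivative term; the driving is even in
time, and the cubic term only gains from the change of sign. -/
theorem middleBarrier_strict (hε : 0 < ε) (hε1 : ε < 1 / 1000) (hA : 0 < A)
    (hA1 : A - lamC ≤ ε / 8000) (t : ℝ) :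
    ε * bumpDeriv ε A (-t) < force (xC - bump ε A (-t)) (drive A t) := by
  have h := bump_subsolution hε hε1 hA hA1 (-t)
  have hu := bump_pos (A := A) hε (-t)
  rw [drive_neg] at h
  rw [sub_eq_add_neg, force_xC_add]
  nlinarith [pow_pos hu 3]

theorem upper_invariant (hε : 0 < ε) (hε1 : ε < 1 / 1000) (hA : 0 < A)
    (hA1 : A - lamC ≤ ε / 8000) (hy : IsSolutionFrom ε A t₀ y) {a b : ℝ} (ha : t₀ ≤ a)
    (hab : a ≤ b) (h : xC + bump ε A a ≤ y a) : xC + bump ε A b ≤ y b :=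
  hy.ge_of_subsolution hε ha (hasDerivAt_upperBarrier hε)
    (fun t _ => (upperBarrier_strict hε hε1 hA hA1 t).le) h b ⟨hab, le_rfl⟩

theorem middle_invariant (hε : 0 < ε) (hε1 : ε < 1 / 1000) (hA : 0 < A)
    (hA1 : A - lamC ≤ ε / 8000) (hy : IsSolutionFrom ε A t₀ y) {a b : ℝ} (ha : t₀ ≤ a)
    (hab : a ≤ b) (h : xC - bump ε A (-a) ≤ y a) : xC - bump ε A (-b) ≤ y b :=
  hy.ge_of_subsolution hε ha (hasDerivAt_middleBarrier hε)
    (fun t _ => (middleBarrier_strict hε hε1 hA hA1 t).le) h b ⟨hab, le_rfl⟩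

theorem le_bump_scale (hε : 0 < ε) (t : ℝ) :
    Real.sqrt (ε + max 0 (lamC - A)) / 8000 ≤ bump ε A t := by
  have := bump_ge (A := A) hε t
  have := sqrt_le_foldScale (ε := ε) (A := A) t
  linarith

theorem scale_pos (hε : 0 < ε) : 0 < Real.sqrt (ε + max 0 (lamC - A)) :=
  Real.sqrt_pos.2 (by positivity)

/-- Two solutions above the upper barrier approach each other exponentially. -/
theorem upper_contraction (hε : 0 < ε) (hε1 : ε < 1 / 1000) (hA : 0 < A)
    (hA1 : A - lamC ≤ ε / 8000) (hx : IsSolutionFrom ε A t₀ x) (hy : IsSolutionFrom ε A t₀ y)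
    (h1 : xC + bump ε A t₀ ≤ x t₀) (h2 : xC + bump ε A t₀ ≤ y t₀) {t : ℝ} (ht : t₀ ≤ t) :
    |y t - x t| ≤ |y t₀ - x t₀| *
      Real.exp (-(Real.sqrt (ε + max 0 (lamC - A)) / 8000) * (t - t₀) / ε) := by
  refine hx.abs_sub_le hε hy le_rfl ht fun s hs => ?_
  have hx1 := upper_invariant hε hε1 hA hA1 hx le_rfl hs.1.le h1
  have hy1 := upper_invariant hε hε1 hA hA1 hy le_rfl hs.1.le h2
  have hb := le_bump_scale (A := A) hε s
  have hp := scale_pos (A := A) hε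
  have hsq := xC_sq
  have hgt := xC_gt
  set d := Real.sqrt (ε + max 0 (lamC - A)) / 8000 with hd
  have hd0 : 0 < d := by positivity
  -- Above `x_c + d` the secant slope is at most `1 - 3 (x_c + d)² ≤ -6 x_c d ≤ -d`.
  have hx2 : xC + d ≤ x s := by linarith
  have hy2 : xC + d ≤ y s := by linarith
  have e1 : (xC + d) ^ 2 ≤ x s ^ 2 := by gcongr
  have e2 : (xC + d) ^ 2 ≤ y s ^ 2 := by gcongr
  have e3 : (xC + d) * (xC + d) ≤ x s * y s := by
    apply mul_le_mul hx2 hy2 <;> linarith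
  nlinarith

theorem attracted_of_abs_sub_le_exp {D c : ℝ} (hc : 0 < c) (hε : 0 < ε)
    (h : ∀ t ≥ t₀, |y t - x t| ≤ D * Real.exp (-c * (t - t₀) / ε)) : AttractedBy y x := by
  unfold AttractedBy
  refine (tendsto_zero_iff_abs_tendsto_zero _).2 ?_
  have h1 : Tendsto (fun t : ℝ => D * Real.exp (-c * (t - t₀) / ε)) atTop (𝓝 (D * 0)) := by
    refine Tendsto.const_mul D (Real.tendsto_exp_atBot.comp ?_)
    have h2 : Tendsto (fun t : ℝ => (c / ε) * (t - t₀)) atTop atTop :=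
      (tendsto_atTop_add_const_right _ (-t₀) tendsto_id).const_mul_atTop (by positivity)
    refine (tendsto_neg_atTop_atBot.comp h2).congr fun t => ?_
    simp only [Function.comp_apply]; ring
  rw [mul_zero] at h1
  refine tendsto_of_tendsto_of_tendsto_of_le_of_le' tendsto_const_nhds h1
    (Eventually.of_forall fun t => abs_nonneg _) ?_
  filter_upwards [eventually_ge_atTop t₀] with t ht using h t ht

theorem upper_attracted (hε : 0 < ε) (hε1 : ε < 1 / 1000) (hA : 0 < A)
    (hA1 : A - lamC ≤ ε / 8000) (hx : IsSolutionFrom ε A t₀ x) (hy : IsSolutionFrom ε A t₀ y)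
    (h1 : xC + bump ε A t₀ ≤ x t₀) (h2 : xC + bump ε A t₀ ≤ y t₀) : AttractedBy y x :=
  attracted_of_abs_sub_le_exp (c := Real.sqrt (ε + max 0 (lamC - A)) / 8000)
    (by have := scale_pos (A := A) hε; positivity) hε
    fun _ ht => upper_contraction hε hε1 hA hA1 hx hy h1 h2 ht

/-- The period map sends the interval between the upper barrier and `A + 2` into itself. Strictness
of the subsolution, applied after sufficiently many periods, makes the inequality strict at all
times. -/
theorem exists_upper_periodic (hε : 0 < ε) (hε1 : ε < 1 / 1000) (hA : 0 < A)
    (hA1 : A - lamC ≤ ε / 8000) :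
    ∃ x, IsGlobalSolution ε A x ∧ Function.Periodic x 1 ∧ ∀ t, xC + bump ε A t < x t := by
  have hb := bump_pos (A := A) hε 0
  have hb1 := bump_le_small hε hε1 hA 0
  have hxC := xC_pos
  have hxC1 := xC_lt
  obtain ⟨x, hx, hper, h0⟩ := exists_periodic_of_displacement (p := xC + bump ε A 0)
    (q := A + 2) hε hA.le (by linarith) (by rw [abs_of_pos (by linarith)]; linarith)
    (by rw [abs_of_pos (by linarith)]) (Or.inl fun y hy => ⟨fun h => by
      have := upper_invariant hε hε1 hA hA1 hy le_rfl zero_le_one h.ge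
      have h4 : bump ε A 1 = bump ε A 0 := by rw [← bump_add_one 0, zero_add]
      rwa [h4] at this,
      fun h => hy.le_const hε le_rfl (fun t _ => (force_add_two_neg hA.le t).le) h.le 1
        ⟨zero_le_one, le_rfl⟩⟩)
  refine ⟨x, hx, hper, fun t => ?_⟩
  obtain ⟨n, hn⟩ := exists_nat_gt (-t)
  have := (hx.solutionFrom 0).gt_of_strict_subsolution hε le_rfl (show 0 < t + n by linarith)
    (hasDerivAt_upperBarrier hε) (upperBarrier_strict hε hε1 hA hA1) h0.1
  rw [hper.natCast_of_one n t] at this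
  rw [show bump ε A (t + n) = bump ε A t by exact_mod_cast bump_add_int t n] at this
  exact this

/-- Both ends of the interval between the reflected middle barrier and the middle barrier are pushed
outwards by the period map, so it has a fixed point inside. -/
theorem exists_middle_periodic (hε : 0 < ε) (hε1 : ε < 1 / 1000) (hA : 0 < A)
    (hA1 : A - lamC ≤ ε / 8000) :
    ∃ x, IsGlobalSolution ε A x ∧ Function.Periodic x 1 ∧
      ∀ t, x t < xC - bump ε A (-t) ∧ -(xC - bump ε A (-(t + 1 / 2))) < x t := by
  have hb1 := bump_le_small hε hε1 hA 0
  have hb2 := bump_le_small hε hε1 hA (1 / 2)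
  have hb1' := bump_pos (A := A) hε 0
  have hb2' := bump_pos (A := A) hε (1 / 2)
  have hxC := xC_gt
  have hxC1 := xC_lt
  obtain ⟨x, hx, hper, h0⟩ := exists_periodic_of_displacement
    (p := -(xC - bump ε A (1 / 2))) (q := xC - bump ε A 0) hε hA.le (by linarith)
    (abs_le.2 ⟨by linarith, by linarith⟩)
    (abs_le.2 ⟨by linarith, by linarith⟩) (Or.inr fun y hy => ⟨fun h => by
      have h3 := middle_invariant hε hε1 hA hA1 hy.antisymm_shift (a := -(1 / 2)) (b := 1 / 2)
        (by linarith) (by norm_num) (by norm_num at h ⊢; linarith)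
      norm_num at h3 ⊢
      have h4 : bump ε A (-(1 / 2)) = bump ε A (1 / 2) := by
        rw [← bump_add_one]; norm_num
      rw [h4] at h3
      linarith, fun h => by
      have := middle_invariant hε hε1 hA hA1 hy le_rfl zero_le_one (by rw [neg_zero]; exact h.ge)
      have h4 : bump ε A (-1) = bump ε A 0 := by
        rw [← bump_add_one]; norm_num
      rwa [h4] at this⟩)
  refine ⟨x, hx, hper, fun t => ⟨?_, ?_⟩⟩
  -- A crossing at any time would leave the solution strictly beyond the barrier at a later integer
  -- time, where periodicity returns its value to `x 0`.
  · by_contra! hle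
    obtain ⟨n, hn⟩ := exists_nat_gt t
    have h1 := (hx.solutionFrom t).gt_of_strict_subsolution hε le_rfl hn
      (hasDerivAt_middleBarrier hε) (middleBarrier_strict hε hε1 hA hA1) hle
    have h2 : bump ε A (-(n : ℝ)) = bump ε A 0 := by
      have := bump_add_int (ε := ε) (A := A) (-(n : ℝ)) n
      rw [← this]; simp
    have h3 : x n = x 0 := by have := hper.natCast_of_one n 0; rwa [zero_add] at this
    rw [h2, h3] at h1
    exact absurd h0.2 (not_le.2 h1)
  · by_contra! hle
    obtain ⟨n, hn⟩ := exists_nat_gt t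
    have h1 := (hx.antisymm_shift.solutionFrom (t - 1 / 2)).gt_of_strict_subsolution hε le_rfl
      (b := n - 1 / 2) (by linarith)
      (hasDerivAt_middleBarrier hε) (middleBarrier_strict hε hε1 hA hA1) (by
        rw [sub_add_cancel]
        have : bump ε A (-(t - 1 / 2)) = bump ε A (-(t + 1 / 2)) := by
          rw [← bump_add_one (-(t + 1 / 2))]; congr 1; ring
        rw [this]; linarith)
    have h2 : bump ε A (-((n : ℝ) - 1 / 2)) = bump ε A (1 / 2) := by
      have := bump_add_int (ε := ε) (A := A) (-((n : ℝ) - 1 / 2)) n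
      rw [← this]; congr 1; push_cast; ring
    have h3 : x n = x 0 := by have := hper.natCast_of_one n 0; rwa [zero_add] at this
    rw [h2, sub_add_cancel, h3] at h1
    linarith [h0.1]

/-- A solution cannot stay in the band around the fold for a whole period. -/
theorem not_forall_near_fold (hε : 0 < ε) (hε1 : ε < 1 / 1000) (hA : 0 < A)
    (hA1 : A - lamC ≤ ε / 8000) (hy : IsSolutionFrom ε A t₀ y)
    (h : ∀ t ≥ t₀, |y t - xC| ≤ 3 / 8000 * foldScale ε A t) : False := by
  have hpi := Real.pi_pos
  -- In the band the force is at least `g' = 0.08 sin² - ε/4000`. Its mean is about `0.04`, so over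
  -- a period the solution would rise by at least `30`, far more than the width of the band.
  set g : ℝ → ℝ := fun t => 0.08 * (t / 2 - Real.sin (2 * Real.pi * t) / (4 * Real.pi)) -
    ε / 4000 * t with hg
  have hgd : ∀ t, HasDerivAt g (0.08 * Real.sin (Real.pi * t) ^ 2 - ε / 4000) t := by
    intro t
    have h0 : HasDerivAt (fun t : ℝ => 2 * Real.pi * t) (2 * Real.pi) t := by
      simpa using (hasDerivAt_id t).const_mul (2 * Real.pi)
    have h1 := ((((hasDerivAt_id t).div_const 2).sub (h0.sin.div_const (4 * Real.pi))).const_mul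
      0.08).sub ((hasDerivAt_id t).const_mul (ε / 4000))
    convert! h1 using 1
    rw [show 2 * Real.pi * t = 2 * (Real.pi * t) by ring, Real.cos_two_mul]
    have := Real.sin_sq_add_cos_sq (Real.pi * t)
    field_simp
    linear_combination (2560 : ℝ) * this
  have hmono : MonotoneOn (fun t => y t - g t / ε) (Icc t₀ (t₀ + 1)) := by
    refine monotoneOn_of_hasDerivWithinAt_nonneg (convex_Icc _ _)
      ((hy.continuousOn.mono fun s hs => hs.1).sub
        (fun s _ => ((hgd s).div_const ε).continuousAt.continuousWithinAt))
      (fun t ht => ((hy.hasDerivAt (t := t) ?_).sub ((hgd t).div_const ε)).hasDerivWithinAt)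
      fun t ht => ?_
    · rw [interior_Icc] at ht; exact ht.1
    · rw [interior_Icc] at ht
      rw [← sub_div]
      refine div_nonneg ?_ hε.le
      have h1 := h t ht.1.le
      have h2 := drive_add_lamC_ge hA hA1 hε t
      have h3 : force (y t) (drive A t) =
          drive A t + lamC - (y t - xC) ^ 2 * ((y t - xC) + 3 * xC) := by
        rw [← force_xC_add]; congr 1; ring
      have h4 := foldScale_sq (A := A) hε t
      have h5 := foldScale_le_two hε1 hA t
      have h6 : 0 ≤ max 0 (lamC - A) := le_max_left _ _
      have h7 := abs_le.1 h1
      have h8 : (y t - xC) ^ 2 ≤ (3 / 8000 * foldScale ε A t) ^ 2 := by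
        rw [← sq_abs]; gcongr
      have h9 : (y t - xC) + 3 * xC ≤ 3 := by linarith [xC_lt]
      have h10 : (y t - xC) ^ 2 * ((y t - xC) + 3 * xC) ≤ (y t - xC) ^ 2 * 3 := by gcongr
      rw [h3]
      nlinarith [sq_nonneg (Real.sin (Real.pi * t))]
  have h1 := hmono (left_mem_Icc.2 (by linarith)) (right_mem_Icc.2 (by linarith))
    (by linarith : t₀ ≤ t₀ + 1)
  have h2 : g (t₀ + 1) - g t₀ = 0.04 - ε / 4000 := by
    simp only [hg]
    rw [show 2 * Real.pi * (t₀ + 1) = 2 * Real.pi * t₀ + 2 * Real.pi by ring,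
      Real.sin_add_two_pi]
    ring
  have h3 : (g (t₀ + 1) - g t₀) / ε ≤ y (t₀ + 1) - y t₀ := by
    rw [sub_div]; simp only at h1; linarith
  have h4 : (30 : ℝ) ≤ (g (t₀ + 1) - g t₀) / ε := by
    rw [h2, le_div_iff₀ hε]; linarith
  have h5 := abs_le.1 (h t₀ le_rfl)
  have h6 := abs_le.1 (h (t₀ + 1) (by simp))
  have h7 := foldScale_le_two hε1 hA t₀
  have h8 := foldScale_le_two hε1 hA (t₀ + 1)
  linarith

/-- A solution that passes the middle barrier passes the upper barrier later. -/
theorem exists_upper_of_middle (hε : 0 < ε) (hε1 : ε < 1 / 1000) (hA : 0 < A)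
    (hA1 : A - lamC ≤ ε / 8000) (hy : IsSolutionFrom ε A t₀ y)
    (h : xC - bump ε A (-t₀) ≤ y t₀) : ∃ t ≥ t₀, xC + bump ε A t ≤ y t := by
  by_contra! hlt
  refine not_forall_near_fold hε hε1 hA hA1 hy fun t ht => ?_
  have h1 := hlt t ht
  have h2 := middle_invariant hε hε1 hA hA1 hy le_rfl ht h
  have h3 := bump_le (A := A) hε t
  have h4 := bump_le (A := A) hε (-t)
  rw [foldScale_neg] at h4
  exact abs_le.2 ⟨by linarith, by linarith⟩

/-- Every solution other than the middle one eventually passes one of the outer barriers. -/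
theorem exists_upper_or_lower (hε : 0 < ε) (hε1 : ε < 1 / 1000) (hA : 0 < A)
    (hA1 : A - lamC ≤ ε / 8000) (hx : IsGlobalSolution ε A x)
    (hxm : ∀ t, x t < xC - bump ε A (-t) ∧ -(xC - bump ε A (-(t + 1 / 2))) < x t)
    (hy : IsSolutionFrom ε A t₀ y) (hne : y t₀ ≠ x t₀) :
    (∃ t ≥ t₀, xC + bump ε A t ≤ y t) ∨
      ∃ t ≥ t₀ - 1 / 2, xC + bump ε A t ≤ -y (t + 1 / 2) := by
  by_cases h1 : ∃ t ≥ t₀, xC - bump ε A (-t) ≤ y t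
  · obtain ⟨t, ht, h⟩ := h1
    obtain ⟨s, hs, h'⟩ := exists_upper_of_middle hε hε1 hA hA1 (hy.mono ht) h
    exact Or.inl ⟨s, ht.trans hs, h'⟩
  by_cases h2 : ∃ t ≥ t₀ - 1 / 2, xC - bump ε A (-t) ≤ -y (t + 1 / 2)
  · obtain ⟨t, ht, h⟩ := h2
    obtain ⟨s, hs, h'⟩ := exists_upper_of_middle hε hε1 hA hA1 (hy.antisymm_shift.mono ht) h
    exact Or.inr ⟨s, le_trans ht hs, h'⟩
  exfalso
  push Not at h1 h2
  -- If neither middle barrier is ever crossed, both solutions stay within `|·| ≤ x_c - d`. There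
  -- the secant slope is at least `d`, and their bounded distance would grow exponentially.
  set d := Real.sqrt (ε + max 0 (lamC - A)) / 8000 with hd
  have hd0 : 0 < d := by have := scale_pos (A := A) hε; positivity
  have hyb : ∀ t ≥ t₀, |y t| ≤ xC - d := by
    intro t ht
    have e1 := h1 t ht
    have e2 := h2 (t - 1 / 2) (by linarith)
    rw [sub_add_cancel] at e2
    have e3 := le_bump_scale (A := A) hε (-t)
    have e4 := le_bump_scale (A := A) hε (-(t - 1 / 2))
    exact abs_le.2 ⟨by linarith, by linarith⟩
  have hxb : ∀ t, |x t| ≤ xC - d := by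
    intro t
    have e1 := hxm t
    have e3 := le_bump_scale (A := A) hε (-t)
    have e4 := le_bump_scale (A := A) hε (-(t + 1 / 2))
    exact abs_le.2 ⟨by linarith, by linarith⟩
  have hgrow : ∀ t ≥ t₀, |y t₀ - x t₀| * Real.exp (d * (t - t₀) / ε) ≤ 2 := by
    intro t ht
    refine ((hx.solutionFrom t₀).le_abs_sub hε hy le_rfl ht fun s hs => ?_).trans ?_
    · have e1 := hyb s hs.1.le
      have e2 := hxb s
      have e3 : y s ^ 2 ≤ (xC - d) ^ 2 := by rw [← sq_abs]; gcongr
      have e4 : x s ^ 2 ≤ (xC - d) ^ 2 := by rw [← sq_abs]; gcongr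
      have e5 : x s * y s ≤ (xC - d) ^ 2 := by nlinarith [sq_nonneg (x s - y s)]
      have := xC_sq
      have := xC_gt
      have e6 : 0 ≤ xC - d := (abs_nonneg _).trans e2
      nlinarith
    · have e1 := abs_le.1 (hyb t ht)
      have e2 := abs_le.1 (hxb t)
      exact abs_le.2 ⟨by linarith [xC_lt], by linarith [xC_lt]⟩
  have hpos : 0 < |y t₀ - x t₀| := abs_pos.2 (sub_ne_zero.2 hne)
  set D := |y t₀ - x t₀|
  -- The time is chosen to make the exponent `2/D`; then `D exp (2/D) ≥ D + 2` contradicts the bound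
  -- `2`.
  have h3 := hgrow (t₀ + 2 / D * ε / d) (by simp; positivity)
  have h4 : d * (t₀ + 2 / D * ε / d - t₀) / ε = 2 / D := by field_simp; ring
  rw [h4] at h3
  have h5 := Real.add_one_le_exp (2 / D)
  have h6 : D * (2 / D + 1) ≤ 2 := (mul_le_mul_of_nonneg_left h5 hpos.le).trans h3
  have h7 : D * (2 / D + 1) = 2 + D := by field_simp
  linarith

end SmallAmplitudeDynamics

/-! ### Reflected solutions -/

section Reflection

variable {ε A t₀ : ℝ} {x y : ℝ → ℝ}

theorem IsSolutionFrom.antisymm_shift_back (h : IsSolutionFrom ε A t₀ y) :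
    IsSolutionFrom ε A (t₀ + 1 / 2) fun t => -y (t - 1 / 2) := by
  have := h.antisymm_shift.comp_add_int (-1)
  convert this using 1
  · push_cast; ring
  · funext t; push_cast; congr 2; ring

theorem attracted_antisymm_shift (h : AttractedBy (fun t => -y (t - 1 / 2)) x) :
    AttractedBy y fun t => -x (t + 1 / 2) := by
  have h1 : Tendsto (fun t : ℝ => t + 1 / 2) atTop atTop :=
    tendsto_atTop_add_const_right _ _ tendsto_id
  have h2 := (h.comp h1).neg
  rw [neg_zero] at h2
  refine h2.congr fun t => ?_
  simp only [Function.comp_apply, add_sub_cancel_right]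
  ring

theorem IsStableSolution.antisymm_shift (h : IsStableSolution ε A x) :
    IsStableSolution ε A fun t => -x (t + 1 / 2) := by
  constructor
  · intro t₀ η hη
    obtain ⟨δ, hδ, h1⟩ := h.1 (t₀ + 1 / 2) η hη
    refine ⟨δ, hδ, fun y hy hd t ht => ?_⟩
    have h2 := h1 _ hy.antisymm_shift_back (by
      rw [add_sub_cancel_right, ← abs_neg]; convert hd using 2; ring) (t + 1 / 2) (by linarith)
    rw [add_sub_cancel_right, ← abs_neg] at h2
    convert h2 using 2; ring
  · intro t₀
    obtain ⟨δ, hδ, h1⟩ := h.2 (t₀ + 1 / 2)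
    refine ⟨δ, hδ, fun y hy hd => attracted_antisymm_shift ?_⟩
    exact h1 _ hy.antisymm_shift_back (by
      rw [add_sub_cancel_right, ← abs_neg]; convert hd using 2; ring)

theorem periodic_antisymm_shift (hx : Function.Periodic x 1) :
    Function.Periodic (fun t => -x (t + 1 / 2)) 1 := by
  intro t
  change -x (t + 1 + 1 / 2) = -x (t + 1 / 2)
  rw [show t + 1 + 1 / 2 = t + 1 / 2 + 1 by ring, hx]

end Reflection

/-! ### Small amplitude: velocity, tracking, area -/

section SmallAmplitudeEstimates

variable {ε A t₀ : ℝ} {x y : ℝ → ℝ}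

/-- At maximal speed `|v| = |λ'| / |1 - 3x²|` with `λ' = 4πA sin cos`. Numerator and lower bound on
the denominator vanish together near the fold, so the ratio is bounded uniformly in `ε`; `4π · 4750
< 60000`. -/
theorem abs_velocity_le_of_hyperbolic (hx : IsGlobalSolution ε A x) (hε : 0 < ε) (hA : 0 < A)
    (hper : Function.Periodic x 1)
    (h : ∀ t, 0 < |1 - 3 * x t ^ 2| ∧
      |Real.sin (Real.pi * t) * Real.cos (Real.pi * t)| ≤ 4750 * |1 - 3 * x t ^ 2|) (t : ℝ) :
    |velocity ε A x t| ≤ 60000 * A := by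
  refine abs_velocity_le hx hε hper (by positivity) (fun s v hv => ?_) t
  obtain ⟨h1, h2⟩ := h s
  have h3 : |1 - 3 * x s ^ 2| * |v| =
      4 * Real.pi * A * |Real.sin (Real.pi * s) * Real.cos (Real.pi * s)| := by
    rw [← abs_mul, eq_neg_of_add_eq_zero_left hv, abs_neg,
      show 2 * Real.pi * s = 2 * (Real.pi * s) by ring, Real.sin_two_mul,
      show 2 * Real.pi * A * (2 * Real.sin (Real.pi * s) * Real.cos (Real.pi * s)) =
        (4 * Real.pi * A) * (Real.sin (Real.pi * s) * Real.cos (Real.pi * s)) by ring, abs_mul,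
      abs_of_pos (show 0 < 4 * Real.pi * A by positivity)]
  refine le_of_mul_le_mul_left ?_ h1
  rw [h3]
  have hpi := Real.pi_lt_d4
  have hpi0 := Real.pi_pos
  calc 4 * Real.pi * A * |Real.sin (Real.pi * s) * Real.cos (Real.pi * s)|
      ≤ 4 * Real.pi * A * (4750 * |1 - 3 * x s ^ 2|) := by gcongr
    _ = (4 * 4750 * Real.pi) * (A * |1 - 3 * x s ^ 2|) := by ring
    _ ≤ 60000 * (A * |1 - 3 * x s ^ 2|) := by gcongr; linarith
    _ = |1 - 3 * x s ^ 2| * (60000 * A) := by ring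

theorem abs_velocity_upper_le (hε : 0 < ε) (hA : 0 < A) (hx : IsGlobalSolution ε A x)
    (hper : Function.Periodic x 1) (hxu : ∀ t, xC + bump ε A t < x t) (t : ℝ) :
    |velocity ε A x t| ≤ 60000 * A := by
  refine abs_velocity_le_of_hyperbolic hx hε hA hper (fun s => ?_) t
  have h1 := hxu s
  have h2 := bump_ge (A := A) hε s
  have h3 := abs_sin_mul_cos_le (A := A) hε s
  have h4 := foldScale_pos (A := A) hε s
  have h5 := xC_sq
  have h6 := xC_gt
  have h7 : 3 * foldScale ε A s / 8000 ≤ 3 * x s ^ 2 - 1 := by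
    have : (xC + foldScale ε A s / 8000) ^ 2 ≤ x s ^ 2 := by gcongr; linarith
    nlinarith [sq_nonneg (foldScale ε A s)]
  rw [abs_sub_comm, abs_of_pos (a := 3 * x s ^ 2 - 1) (by linarith)]
  constructor <;> linarith

/-- The upper barrier controls the distance to `x_c` through `sin`, its reflection the distance to
`-x_c` through `cos`; `|sin cos|` lies below both. In `(x_c - x)(x_c + x)` one factor is at least
`x_c`, whatever the sign of `x`. -/
theorem middle_hyperbolic (hε : 0 < ε)
    (hxm : ∀ t, x t < xC - bump ε A (-t) ∧ -(xC - bump ε A (-(t + 1 / 2))) < x t) (t : ℝ) :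
    0.577 * (Real.sqrt (ε + max 0 (lamC - A)) / 8000) ≤ xC ^ 2 - x t ^ 2 ∧
      0.577 * (|Real.sin (Real.pi * t) * Real.cos (Real.pi * t)| / 8000) ≤ xC ^ 2 - x t ^ 2 := by
  obtain ⟨h1, h2⟩ := hxm t
  have e1 := le_bump_scale (A := A) hε (-t)
  have e2 := le_bump_scale (A := A) hε (-(t + 1 / 2))
  have e3 := bump_ge (A := A) hε (-t)
  have e4 := bump_ge (A := A) hε (-(t + 1 / 2))
  rw [foldScale_neg] at e3 e4
  have e5 := abs_sin_le_foldScale (A := A) hε t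
  have e6 := abs_sin_le_foldScale (A := A) hε (t + 1 / 2)
  rw [show Real.pi * (t + 1 / 2) = Real.pi * t + Real.pi / 2 by ring, Real.sin_add_pi_div_two] at e6
  have hs := Real.abs_sin_le_one (Real.pi * t)
  have hc := Real.abs_cos_le_one (Real.pi * t)
  have hs0 := abs_nonneg (Real.sin (Real.pi * t))
  have hc0 := abs_nonneg (Real.cos (Real.pi * t))
  have hxC := xC_gt
  have hσ := scale_pos (A := A) hε
  rw [abs_mul]
  have h3 : xC ^ 2 - x t ^ 2 = (xC - x t) * (xC + x t) := by ring
  rw [h3]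
  have hsc1 : |Real.sin (Real.pi * t)| * |Real.cos (Real.pi * t)| ≤ |Real.sin (Real.pi * t)| :=
    mul_le_of_le_one_right hs0 hc
  have hsc2 : |Real.sin (Real.pi * t)| * |Real.cos (Real.pi * t)| ≤ |Real.cos (Real.pi * t)| :=
    mul_le_of_le_one_left hc0 hs
  have hsc0 := mul_nonneg hs0 hc0
  rcases le_total 0 (x t) with h | h
  · constructor
    · rw [mul_comm 0.577]; apply mul_le_mul <;> linarith
    · rw [mul_comm 0.577]; apply mul_le_mul <;> linarith
  · constructor
    · apply mul_le_mul <;> linarith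
    · apply mul_le_mul <;> linarith

theorem abs_velocity_middle_le (hε : 0 < ε) (hA : 0 < A) (hx : IsGlobalSolution ε A x)
    (hper : Function.Periodic x 1)
    (hxm : ∀ t, x t < xC - bump ε A (-t) ∧ -(xC - bump ε A (-(t + 1 / 2))) < x t) (t : ℝ) :
    |velocity ε A x t| ≤ 60000 * A := by
  refine abs_velocity_le_of_hyperbolic hx hε hA hper (fun s => ?_) t
  obtain ⟨h1, h2⟩ := middle_hyperbolic hε hxm s
  have h3 := scale_pos (A := A) hε
  have h5 := xC_sq
  rw [abs_of_pos (a := 1 - 3 * x s ^ 2) (by linarith)]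
  constructor <;> linarith

theorem abs_force_eq (hε : 0 < ε) (t : ℝ) :
    |force (x t) (drive A t)| = ε * |velocity ε A x t| := by
  unfold velocity
  rw [abs_div, abs_of_pos hε, mul_div_cancel₀ _ hε.ne']

/-- For `a₀ < 0` the scale contains `|a₀|`; for `a₀ > 0` it contains `ε`, which exceeds `|a₀|` by
the smallness assumption. -/
theorem div_scale_le_trackingScale (hε : 0 < ε) (hA1 : A - lamC ≤ ε / 8000) :
    ε / Real.sqrt (ε + max 0 (lamC - A)) ≤ trackingScale ε (A - lamC) := by
  have hm : 0 ≤ max 0 (lamC - A) := le_max_left _ _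
  have hs : 0 < Real.sqrt ε := Real.sqrt_pos.2 hε
  have h1 : ε / Real.sqrt (ε + max 0 (lamC - A)) ≤ Real.sqrt ε := by
    rw [div_le_iff₀ (scale_pos hε)]
    calc ε = Real.sqrt ε * Real.sqrt ε := (Real.mul_self_sqrt hε.le).symm
      _ ≤ _ := by gcongr; linarith
  unfold trackingScale
  split_ifs with h0
  · exact h1
  · refine le_min ?_ h1
    have hpos : 0 < |A - lamC| := abs_pos.2 h0
    refine div_le_div_of_nonneg_left hε.le (Real.sqrt_pos.2 hpos) (Real.sqrt_le_sqrt ?_)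
    rcases le_total A lamC with h | h
    · rw [abs_of_nonpos (by linarith)]
      have := le_max_right 0 (lamC - A)
      linarith
    · rw [abs_of_nonneg (by linarith)]
      linarith

/-- The distance to the equilibrium is the force, equal to `ε v`, divided by the secant slope. The
constant comes from `60000 · 16000 < 10⁹`. -/
theorem tracking_of_factor (hε : 0 < ε) (hA2 : A ≤ 1) (hA1 : A - lamC ≤ ε / 8000)
    {p X l : ℝ} (hX : force X l = 0) (hp : |force p l| ≤ ε * (60000 * A))
    (hf : Real.sqrt (ε + max 0 (lamC - A)) / 16000 ≤ |1 - (p ^ 2 + p * X + X ^ 2)|) :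
    |p - X| ≤ 1000000000 * trackingScale ε (A - lamC) := by
  have h1 := force_sub p X l
  rw [hX, sub_zero] at h1
  have hσ := scale_pos (A := A) hε
  have h2 : |p - X| * (Real.sqrt (ε + max 0 (lamC - A)) / 16000) ≤ ε * 60000 := by
    calc _ ≤ |p - X| * |1 - (p ^ 2 + p * X + X ^ 2)| := by gcongr
      _ = |force p l| := by rw [← abs_mul, h1]
      _ ≤ ε * (60000 * A) := hp
      _ ≤ ε * (60000 * 1) := by gcongr
      _ = ε * 60000 := by ring
  have h3 : |p - X| ≤ 960000000 * (ε / Real.sqrt (ε + max 0 (lamC - A))) := by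
    rw [mul_div_assoc', le_div_iff₀ hσ]
    linarith
  have h4 := div_scale_le_trackingScale hε hA1
  have h5 : 0 ≤ ε / Real.sqrt (ε + max 0 (lamC - A)) := by positivity
  linarith

theorem amplitude_le_one (hε1 : ε < 1 / 1000) (hA1 : A - lamC ≤ ε / 8000) : A ≤ 1 := by
  linarith [lamC_lt]

theorem upper_tracking (hε : 0 < ε) (hε1 : ε < 1 / 1000) (hA : 0 < A)
    (hA1 : A - lamC ≤ ε / 8000) (hx : IsGlobalSolution ε A x)
    (hper : Function.Periodic x 1) (hxu : ∀ t, xC + bump ε A t < x t) (t : ℝ)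
    (ht : -lamC ≤ drive A t) :
    |x t - branchPlus (drive A t)| ≤ 1000000000 * trackingScale ε (A - lamC) := by
  obtain ⟨X, hX, hX1⟩ := exists_upper_equilibrium ht
  rw [branchPlus_eq hX hX1]
  refine tracking_of_factor hε (amplitude_le_one hε1 hA1) hA1 hX ?_ ?_
  · rw [abs_force_eq hε]
    have := abs_velocity_upper_le hε hA hx hper hxu t
    gcongr
  · have h1 := hxu t
    have h2 := le_bump_scale (A := A) hε t
    have h3 := scale_pos (A := A) hε
    have h4 := xC_sq
    have h5 := xC_gt
    set d := Real.sqrt (ε + max 0 (lamC - A)) / 8000 with hd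
    have hd0 : 0 < d := by positivity
    have e1 : (xC + d) ^ 2 ≤ x t ^ 2 := by gcongr; linarith
    have e2 : xC ^ 2 ≤ X ^ 2 := by gcongr
    have e3 : xC * xC ≤ x t * X := by apply mul_le_mul <;> linarith
    have e4 : d ≤ x t ^ 2 + x t * X + X ^ 2 - 1 := by nlinarith
    rw [abs_sub_comm, abs_of_nonneg (by linarith)]
    linarith

theorem middle_tracking (hε : 0 < ε) (hε1 : ε < 1 / 1000) (hA : 0 < A)
    (hA1 : A - lamC ≤ ε / 8000) (hx : IsGlobalSolution ε A x)
    (hper : Function.Periodic x 1)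
    (hxm : ∀ t, x t < xC - bump ε A (-t) ∧ -(xC - bump ε A (-(t + 1 / 2))) < x t) (t : ℝ)
    (ht : |drive A t| ≤ lamC) :
    |x t - branchZero (drive A t)| ≤ 1000000000 * trackingScale ε (A - lamC) := by
  obtain ⟨X, hX, hX1⟩ := exists_middle_equilibrium ht
  rw [branchZero_eq hX hX1]
  refine tracking_of_factor hε (amplitude_le_one hε1 hA1) hA1 hX ?_ ?_
  · rw [abs_force_eq hε]
    have := abs_velocity_middle_le hε hA hx hper hxm t
    gcongr
  · obtain ⟨h1, -⟩ := middle_hyperbolic hε hxm t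
    have h3 := scale_pos (A := A) hε
    have h4 := xC_sq
    have e2 : X ^ 2 ≤ xC ^ 2 := by rw [← sq_abs]; gcongr
    have e3 : x t * X ≤ xC ^ 2 := by nlinarith [sq_nonneg (x t - X)]
    rw [abs_of_nonneg (by linarith)]
    linarith

theorem hysteresisArea_le_of_velocity (hε : 0 < ε) (hA : 0 < A) (hA2 : A ≤ 1)
    (hx : IsGlobalSolution ε A x) (hper : Function.Periodic x 1)
    (hv : ∀ t, |velocity ε A x t| ≤ 60000 * A) :
    hysteresisArea A x ≤ 3600000000 * (ε * A) := by
  rw [hysteresisArea_eq hx hε hper]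
  have hc : Continuous fun t => ε * velocity ε A x t ^ 2 := by
    have := continuous_velocity hx
    fun_prop
  have h1 : ∀ t ∈ Icc (-1 / 2 : ℝ) (1 / 2), ε * velocity ε A x t ^ 2 ≤ 3600000000 * (ε * A) := by
    intro t _
    have h2 : velocity ε A x t ^ 2 ≤ (60000 * A) ^ 2 := by
      rw [← sq_abs]; gcongr; exact hv t
    have h3 : (60000 * A) ^ 2 ≤ 3600000000 * A := by nlinarith
    calc ε * velocity ε A x t ^ 2 ≤ ε * (3600000000 * A) := by gcongr; linarith
      _ = _ := by ring
  have h2 := intervalIntegral.integral_mono_on (μ := MeasureTheory.volume) (by norm_num) (hc.intervalIntegrable _ _)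
    (intervalIntegrable_const) h1
  rw [intervalIntegral.integral_const] at h2
  norm_num at h2 ⊢
  exact h2

/-- A periodic solution cannot be too slow, as it has to balance the driving. -/
theorem hysteresisArea_ge_sq (hε : 0 < ε) (hε1 : ε < 1 / 1000) (hx : IsGlobalSolution ε A x)
    (hper : Function.Periodic x 1) (hb : ∀ t, |x t| ≤ 3) :
    ε * (A ^ 2 / 3600) ≤ hysteresisArea A x := by
  rw [hysteresisArea_eq hx hε hper]
  have hpi := Real.pi_gt_three
  -- Duality: `v² ≥ 2θ v W - θ² W²` for `W = (3x² - 1) sin / (2π) - ε cos`. By the equation `v W` is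
  -- `A cos²` plus a total derivative, so its integral over a period is `A/2`. As `W² ≤ 900`, this
  -- `θ` maximizes `θ A - 900 θ²`.
  set θ := A / 1800 with hθ
  set g : ℝ → ℝ := fun t => ε * (2 * θ * ((x t ^ 3 - x t) * Real.sin (2 * Real.pi * t) /
    (2 * Real.pi)) + 2 * θ * A * (t / 2 + Real.sin (2 * (2 * Real.pi * t)) / (8 * Real.pi)) -
      θ ^ 2 * 900 * t) with hg
  set g' : ℝ → ℝ := fun t => ε * (2 * θ * ((3 * x t ^ 2 - 1) * velocity ε A x t *
    Real.sin (2 * Real.pi * t) / (2 * Real.pi) + (x t ^ 3 - x t) * Real.cos (2 * Real.pi * t)) +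
      2 * θ * A * Real.cos (2 * Real.pi * t) ^ 2 - θ ^ 2 * 900) with hg'
  have hgd : ∀ t, HasDerivAt g (g' t) t := by
    intro t
    have h0 : HasDerivAt (fun t : ℝ => 2 * Real.pi * t) (2 * Real.pi) t := by
      simpa using (hasDerivAt_id t).const_mul (2 * Real.pi)
    have h1 := hx t
    have h2 := (((((h1.pow 3).sub h1).mul h0.sin).div_const (2 * Real.pi)).const_mul (2 * θ)).add
      ((((hasDerivAt_id t).div_const 2).add ((h0.const_mul 2).sin.div_const
        (8 * Real.pi))).const_mul (2 * θ * A))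
    have h3 := (h2.sub ((hasDerivAt_id t).const_mul (θ ^ 2 * 900))).const_mul ε
    convert! h3 using 1
    simp only [hg', Pi.pow_apply, Pi.sub_apply]
    rw [Real.cos_two_mul]
    unfold velocity
    push_cast
    field_simp
    ring
  have hv := continuous_velocity hx
  have hc : Continuous fun t => ε * velocity ε A x t ^ 2 := by fun_prop
  have hg'c : Continuous g' := by
    have := hx.continuous
    simp only [hg']
    fun_prop
  have hle : ∀ t ∈ Icc (-1 / 2 : ℝ) (1 / 2), g' t ≤ ε * velocity ε A x t ^ 2 := by
    intro t _
    have hxb := hb t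
    set v := velocity ε A x t with hvt
    set S := Real.sin (2 * Real.pi * t)
    set C := Real.cos (2 * Real.pi * t) with hC
    have hS : |S| ≤ 1 := Real.abs_sin_le_one _
    have hC1 : |C| ≤ 1 := Real.abs_cos_le_one _
    have hvd : ε * v = x t - x t ^ 3 - A * C := by
      rw [hvt, velocity, mul_div_cancel₀ _ hε.ne']
      unfold force drive; rw [hC]; ring
    set W := (3 * x t ^ 2 - 1) * S / (2 * Real.pi) - ε * C with hW
    have hWb : |W| ≤ 30 := by
      have h1 : |3 * x t ^ 2 - 1| ≤ 28 := by
        have : x t ^ 2 ≤ 3 ^ 2 := by rw [← sq_abs]; gcongr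
        rw [abs_le]; constructor <;> nlinarith [sq_nonneg (x t)]
      have h2 : |(3 * x t ^ 2 - 1) * S / (2 * Real.pi)| ≤ 28 := by
        rw [abs_div, abs_mul, abs_of_pos (show 0 < 2 * Real.pi by linarith)]
        refine (div_le_self (by positivity) (by linarith)).trans ?_
        nlinarith [abs_nonneg S, abs_nonneg (3 * x t ^ 2 - 1)]
      have h3 : |ε * C| ≤ 1 := by
        rw [abs_mul, abs_of_pos hε]
        nlinarith [abs_nonneg C]
      calc |W| ≤ _ := abs_sub _ _
        _ ≤ 30 := by linarith
    have hW2 : W ^ 2 ≤ 900 := by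
      rw [← sq_abs]
      calc |W| ^ 2 ≤ 30 ^ 2 := by gcongr
        _ = 900 := by norm_num
    have hgW : g' t = ε * (2 * θ * (v * W) - θ ^ 2 * 900) := by
      simp only [hg', hW]
      linear_combination (2 * θ * C * ε) * hvd
    rw [hgW]
    refine mul_le_mul_of_nonneg_left ?_ hε.le
    nlinarith [sq_nonneg (v - θ * W), mul_le_mul_of_nonneg_left hW2 (sq_nonneg θ)]
  have h2 := intervalIntegral.integral_mono_on (μ := MeasureTheory.volume) (by norm_num) (hg'c.intervalIntegrable _ _)
    (hc.intervalIntegrable _ _) hle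
  rw [intervalIntegral.integral_eq_sub_of_hasDerivAt (fun t _ => hgd t)
    (hg'c.intervalIntegrable _ _)] at h2
  refine le_trans (le_of_eq ?_) h2
  simp only [hg]
  rw [show 2 * Real.pi * (1 / 2) = Real.pi by ring,
    show 2 * Real.pi * (-1 / 2) = -Real.pi by ring, Real.sin_pi, Real.sin_neg, Real.sin_pi,
    show 2 * -Real.pi = -(2 * Real.pi) by ring, Real.sin_neg, Real.sin_two_pi, hθ]
  ring

end SmallAmplitudeEstimates

/-! ### Small amplitude: the periodic solutions -/

section SmallAmplitudeConclusion

variable {ε A t₀ : ℝ} {x y : ℝ → ℝ}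

theorem upper_stable (hε : 0 < ε) (hε1 : ε < 1 / 1000) (hA : 0 < A)
    (hA1 : A - lamC ≤ ε / 8000) (hx : IsGlobalSolution ε A x)
    (hxu : ∀ t, xC + bump ε A t < x t) : IsStableSolution ε A x := by
  have hnear : ∀ (t₀ : ℝ) (y : ℝ → ℝ), |y t₀ - x t₀| <
      x t₀ - (xC + bump ε A t₀) → xC + bump ε A t₀ ≤ y t₀ :=
    fun t₀ y h => by linarith [(abs_lt.1 h).1]
  constructor
  · intro t₀ η hη
    refine ⟨min η (x t₀ - (xC + bump ε A t₀)), lt_min hη (by linarith [hxu t₀]), ?_⟩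
    intro y hy hd t ht
    have h1 := upper_contraction hε hε1 hA hA1 (hx.solutionFrom t₀) hy (hxu t₀).le
      (hnear t₀ y (hd.trans_le (min_le_right _ _))) ht
    refine (h1.trans ?_).trans_lt (hd.trans_le (min_le_left _ _))
    refine mul_le_of_le_one_right (abs_nonneg _) (Real.exp_le_one_iff.2 ?_)
    have h2 := scale_pos (A := A) hε
    have h3 : 0 ≤ Real.sqrt (ε + max 0 (lamC - A)) / 8000 * (t - t₀) / ε :=
      div_nonneg (mul_nonneg (by positivity) (by linarith)) hε.le
    rw [neg_mul, neg_div]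
    linarith
  · intro t₀
    exact ⟨x t₀ - (xC + bump ε A t₀), by linarith [hxu t₀], fun y hy hd =>
      upper_attracted hε hε1 hA hA1 (hx.solutionFrom t₀) hy (hxu t₀).le (hnear t₀ y hd)⟩

theorem attracted_upper_or_lower (hε : 0 < ε) (hε1 : ε < 1 / 1000) (hA : 0 < A)
    (hA1 : A - lamC ≤ ε / 8000) {xp x0 : ℝ → ℝ} (hp : IsGlobalSolution ε A xp)
    (hpu : ∀ t, xC + bump ε A t < xp t) (h0 : IsGlobalSolution ε A x0)
    (h0m : ∀ t, x0 t < xC - bump ε A (-t) ∧ -(xC - bump ε A (-(t + 1 / 2))) < x0 t)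
    (hper : Function.Periodic xp 1)
    (hy : IsSolutionFrom ε A t₀ y) (hne : y t₀ ≠ x0 t₀) :
    AttractedBy y xp ∨ AttractedBy y fun t => -xp (t + 1 / 2) := by
  rcases exists_upper_or_lower hε hε1 hA hA1 h0 h0m hy hne with ⟨t, ht, h⟩ | ⟨t, ht, h⟩
  · exact Or.inl (upper_attracted hε hε1 hA hA1 (hp.solutionFrom t) (hy.mono ht) (hpu t).le h)
  · right
    have h1 := upper_attracted hε hε1 hA hA1 (hp.solutionFrom t) (hy.antisymm_shift.mono ht)
      (hpu t).le h
    have h2 : Tendsto (fun t : ℝ => t - 1 / 2) atTop atTop :=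
      tendsto_atTop_add_const_right _ (-(1 / 2)) tendsto_id
    have h3 := (h1.comp h2).neg
    rw [neg_zero] at h3
    refine h3.congr fun s => ?_
    simp only [Function.comp_apply, sub_add_cancel]
    have : xp (s - 1 / 2) = xp (s + 1 / 2) := by
      rw [← hper (s - 1 / 2)]; congr 1; ring
    rw [this]; ring

/-- Under stability a slightly displaced solution would remain within `η` of the middle one, yet it
is attracted by an outer solution at distance at least `2η`. -/
theorem middle_unstable (hε : 0 < ε) (hε1 : ε < 1 / 1000) (hA : 0 < A)
    (hA1 : A - lamC ≤ ε / 8000) {xp x0 : ℝ → ℝ} (hp : IsGlobalSolution ε A xp)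
    (hpu : ∀ t, xC + bump ε A t < xp t) (h0 : IsGlobalSolution ε A x0)
    (h0m : ∀ t, x0 t < xC - bump ε A (-t) ∧ -(xC - bump ε A (-(t + 1 / 2))) < x0 t)
    (hper : Function.Periodic xp 1) : IsUnstableSolution ε A x0 := by
  intro hst
  set η := Real.sqrt (ε + max 0 (lamC - A)) / 8000 with hη
  have hη0 : 0 < η := by have := scale_pos (A := A) hε; positivity
  obtain ⟨δ, hδ, hδs⟩ := hst 0 η hη0
  have hx0 := h0m 0
  have hb1 := bump_pos (A := A) hε (-0)
  have hb2 := bump_pos (A := A) hε (-(0 + 1 / 2))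
  have hxC := xC_lt
  set r := min (δ / 2) 1 with hr
  have hr0 : 0 < r := lt_min (by linarith) one_pos
  have hr1 : r ≤ 1 := min_le_right _ _
  have hr2 : r ≤ δ / 2 := min_le_left _ _
  obtain ⟨y, hy0, hy⟩ := exists_solutionFrom_zero (ε := ε) (A := A) (x₀ := x0 0 + r) hε hA.le
    (abs_le.2 ⟨by linarith, by linarith⟩)
  have hclose := hδs y hy (by rw [hy0, add_sub_cancel_left, abs_of_pos hr0]; linarith)
  have hatt := attracted_upper_or_lower hε hε1 hA hA1 hp hpu h0 h0m hper hy
    (by rw [hy0]; linarith)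
  have hfar : ∀ t, 2 * η ≤ |xp t - x0 t| ∧ 2 * η ≤ |-xp (t + 1 / 2) - x0 t| := by
    intro t
    have e1 := le_bump_scale (A := A) hε t
    have e2 := le_bump_scale (A := A) hε (-t)
    have e3 := le_bump_scale (A := A) hε (t + 1 / 2)
    have e4 := le_bump_scale (A := A) hε (-(t + 1 / 2))
    have e5 := hpu t
    have e6 := hpu (t + 1 / 2)
    have e7 := h0m t
    constructor
    · exact le_trans (by linarith) (le_abs_self _)
    · exact le_trans (by linarith) (neg_le_abs _)
  have key : ∀ z : ℝ → ℝ, (∀ t, 2 * η ≤ |z t - x0 t|) → ¬ AttractedBy y z := by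
    intro z hz hatt
    have h1 := (Metric.tendsto_nhds.1 hatt) η hη0
    obtain ⟨t, ht1, ht2⟩ := (h1.and (eventually_ge_atTop 0)).exists
    rw [Real.dist_eq, sub_zero] at ht1
    have h2 := hclose t ht2
    have h3 := hz t
    have h4 : |z t - x0 t| ≤ |y t - z t| + |y t - x0 t| := by
      rw [abs_sub_comm (y t) (z t)]
      exact abs_sub_le _ _ _
    linarith
  rcases hatt with h | h
  · exact key _ (fun t => (hfar t).1) h
  · exact key _ (fun t => (hfar t).2) h

theorem lower_tracking (hε : 0 < ε) (hε1 : ε < 1 / 1000) (hA : 0 < A)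
    (hA1 : A - lamC ≤ ε / 8000) (hx : IsGlobalSolution ε A x)
    (hper : Function.Periodic x 1) (hxu : ∀ t, xC + bump ε A t < x t) (t : ℝ)
    (ht : drive A t ≤ lamC) :
    |-x (t + 1 / 2) - branchMinus (drive A t)| ≤ 1000000000 * trackingScale ε (A - lamC) := by
  have h := upper_tracking hε hε1 hA hA1 hx hper hxu (t + 1 / 2)
    (by rw [drive_add_half]; linarith)
  rw [drive_add_half] at h
  rw [branchMinus_eq_neg ht, ← abs_neg]
  convert h using 2
  ring

/-- A periodic solution either agrees with the middle one at time `0` or is attracted by an outer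
one; in both cases periodicity forces equality. -/
theorem small_amplitude_periodic_solutions (hε : 0 < ε) (hε1 : ε < 1 / 1000) (hA : 0 < A)
    (hA1 : A - lamC ≤ ε / 8000) :
    ∃ xp x0 : ℝ → ℝ, IsGlobalSolution ε A xp ∧ Function.Periodic xp 1 ∧
      (∀ t, xC + bump ε A t < xp t) ∧ IsGlobalSolution ε A x0 ∧ Function.Periodic x0 1 ∧
      (∀ t, x0 t < xC - bump ε A (-t) ∧ -(xC - bump ε A (-(t + 1 / 2))) < x0 t) ∧
      {x | IsPeriodicSolution ε A x} = {xp, fun t => -xp (t + 1 / 2), x0} := by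
  obtain ⟨xp, hp, hpper, hpu⟩ := exists_upper_periodic hε hε1 hA hA1
  obtain ⟨x0, h0, h0per, h0m⟩ := exists_middle_periodic hε hε1 hA hA1
  refine ⟨xp, x0, hp, hpper, hpu, h0, h0per, h0m, ?_⟩
  ext z
  simp only [mem_ofPred_eq, mem_insert_iff, mem_singleton_iff]
  constructor
  · intro hz
    by_cases hz0 : z 0 = x0 0
    · exact Or.inr (Or.inr (hz.eq_of_eq_zero hε hA h0 h0per hz0))
    · rcases attracted_upper_or_lower hε hε1 hA hA1 hp hpu h0 h0m hpper (hz.1.solutionFrom 0)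
        hz0 with h | h
      · exact Or.inl (hz.eq_of_attracted hε hA hpper h)
      · exact Or.inr (Or.inl (hz.eq_of_attracted hε hA (periodic_antisymm_shift hpper) h))
  · rintro (rfl | rfl | rfl)
    · exact ⟨hp, 1, one_pos, hpper⟩
    · exact ⟨hp.antisymm_shift, 1, one_pos, periodic_antisymm_shift hpper⟩
    · exact ⟨h0, 1, one_pos, h0per⟩

theorem small_amplitude_dynamics (hε : 0 < ε) (hε1 : ε < 1 / 1000) (hA : 0 < A)
    (hA1 : A - lamC ≤ ε / 8000) :
    ∃ xp xm x0 : ℝ → ℝ,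
      xp ≠ xm ∧ xp ≠ x0 ∧ xm ≠ x0 ∧
      {x | IsPeriodicSolution ε A x} = {xp, xm, x0} ∧
      Function.Periodic xp 1 ∧ Function.Periodic xm 1 ∧ Function.Periodic x0 1 ∧
      IsStableSolution ε A xp ∧ IsStableSolution ε A xm ∧ IsUnstableSolution ε A x0 ∧
      (∀ t, -lamC ≤ drive A t →
        |xp t - branchPlus (drive A t)| ≤ 1000000000 * trackingScale ε (A - lamC)) ∧
      (∀ t, drive A t ≤ lamC →
        |xm t - branchMinus (drive A t)| ≤ 1000000000 * trackingScale ε (A - lamC)) ∧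
      (∀ t, |drive A t| ≤ lamC →
        |x0 t - branchZero (drive A t)| ≤ 1000000000 * trackingScale ε (A - lamC)) ∧
      (∀ (t₀ : ℝ) (y : ℝ → ℝ), IsSolutionFrom ε A t₀ y → y t₀ ≠ x0 t₀ →
        AttractedBy y xp ∨ AttractedBy y xm) := by
  obtain ⟨xp, x0, hp, hpper, hpu, h0, h0per, h0m, hset⟩ :=
    small_amplitude_periodic_solutions hε hε1 hA hA1
  have hxC := xC_pos
  have hb := fun t => bump_pos (A := A) hε t
  have hst := upper_stable hε hε1 hA hA1 hp hpu
  refine ⟨xp, fun t => -xp (t + 1 / 2), x0, fun h => ?_, fun h => ?_, fun h => ?_, hset, hpper,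
    periodic_antisymm_shift hpper, h0per, hst, hst.antisymm_shift,
    middle_unstable hε hε1 hA hA1 hp hpu h0 h0m hpper,
    upper_tracking hε hε1 hA hA1 hp hpper hpu, lower_tracking hε hε1 hA hA1 hp hpper hpu,
    middle_tracking hε hε1 hA hA1 h0 h0per h0m,
    fun t₀ y hy hne => attracted_upper_or_lower hε hε1 hA hA1 hp hpu h0 h0m hpper hy hne⟩
  · have h1 : xp 0 = -xp (0 + 1 / 2) := congrFun h 0
    linarith [hpu 0, hpu (0 + 1 / 2), hb 0, hb (0 + 1 / 2)]
  · have h1 : xp 0 = x0 0 := congrFun h 0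
    linarith [hpu 0, (h0m 0).1, hb 0, hb (-0)]
  · have h1 : -xp (0 + 1 / 2) = x0 0 := congrFun h 0
    linarith [hpu (0 + 1 / 2), (h0m 0).2, hb (0 + 1 / 2), hb (-(0 + 1 / 2))]

theorem small_amplitude_area_le (hε : 0 < ε) (hε1 : ε < 1 / 1000) (hA : 0 < A)
    (hA1 : A - lamC ≤ ε / 8000) (hx : IsPeriodicSolution ε A x) :
    hysteresisArea A x ≤ 3600000000 * (ε * A) := by
  obtain ⟨xp, x0, hp, hpper, hpu, h0, h0per, h0m, hset⟩ :=
    small_amplitude_periodic_solutions hε hε1 hA hA1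
  have hA2 := amplitude_le_one hε1 hA1
  have hv := abs_velocity_upper_le hε hA hp hpper hpu
  have hmem : x ∈ ({xp, fun t => -xp (t + 1 / 2), x0} : Set (ℝ → ℝ)) := hset ▸ hx
  simp only [mem_insert_iff, mem_singleton_iff] at hmem
  rcases hmem with rfl | rfl | rfl
  · exact hysteresisArea_le_of_velocity hε hA hA2 hp hpper hv
  · refine hysteresisArea_le_of_velocity hε hA hA2 hp.antisymm_shift
      (periodic_antisymm_shift hpper) fun t => ?_
    have h1 := hv (t + 1 / 2)
    unfold velocity at h1 ⊢
    rw [drive_add_half] at h1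
    have h2 := force_neg (-xp (t + 1 / 2)) (drive A t)
    rw [neg_neg] at h2
    rwa [h2, neg_div, abs_neg] at h1
  · exact hysteresisArea_le_of_velocity hε hA hA2 h0 h0per
      (abs_velocity_middle_le hε hA h0 h0per h0m)

theorem small_amplitude_area_ge (hε : 0 < ε) (hε1 : ε < 1 / 1000) (hA : 0 < A)
    (hA1 : A - lamC ≤ ε / 8000) (hx : IsPeriodicSolution ε A x) :
    ε * (A ^ 2 / 3600) ≤ hysteresisArea A x := by
  obtain ⟨xp, x0, hp, hpper, hpu, h0, h0per, h0m, hset⟩ :=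
    small_amplitude_periodic_solutions hε hε1 hA hA1
  have hA2 := amplitude_le_one hε1 hA1
  have hper : Function.Periodic x 1 := by
    have hmem : x ∈ ({xp, fun t => -xp (t + 1 / 2), x0} : Set (ℝ → ℝ)) := hset ▸ hx
    simp only [mem_insert_iff, mem_singleton_iff] at hmem
    rcases hmem with rfl | rfl | rfl
    exacts [hpper, periodic_antisymm_shift hpper, h0per]
  exact hysteresisArea_ge_sq hε hε1 hx.1 hper fun t =>
    (hx.abs_le_add_two hε hA.le t).trans (by linarith)

end SmallAmplitudeConclusion

/-! ### Large amplitude: passage of the fold and contraction -/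

section LargeAmplitude

variable {ε A t₀ : ℝ} {x y : ℝ → ℝ}

/-- Past the fold, by at least `s²` in the driving, every solution falls to the lower branch
within time `6 ε / s`. -/
theorem IsSolutionFrom.le_neg_two_xC_of_past_fold (hε : 0 < ε) (hy : IsSolutionFrom ε A t₀ y)
    {p q s : ℝ} (hp : t₀ ≤ p) (hs : 0 < s)
    (hl : ∀ t ∈ Icc p q, drive A t ≤ -lamC - s ^ 2) (hpq : 6 * ε / s ≤ q - p) :
    y q ≤ -(2 * xC) := by
  by_contra! hq
  have hxC := xC_pos
  have hsq := xC_sq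
  have hlam := lamC_pos
  set r := p + 5 * ε / s with hr
  have hεs : 0 < ε / s := by positivity
  have h5 : 5 * ε / s = 5 * (ε / s) := by ring
  have h6 : 6 * ε / s = 6 * (ε / s) := by ring
  have hpr : p < r := by rw [hr, h5]; linarith
  have hrq : r + ε / s ≤ q := by rw [hr, h5]; rw [h6] at hpq; linarith
  -- The region below `-2 x_c` is absorbing past the fold, so ending above it means never having
  -- entered it. The same argument applies to `-x_c` below.
  have hgt : ∀ t ∈ Icc p q, -(2 * xC) < y t := by
    intro t ht
    by_contra! hle
    refine absurd (hy.le_const hε (hp.trans ht.1) (b := q) (fun u hu => ?_) hle q ⟨ht.2, le_rfl⟩)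
      (not_le.2 hq)
    rw [force_neg_two_xC]
    nlinarith [hl u ⟨ht.1.trans hu.1, hu.2.le⟩]
  have hrle : y r ≤ -xC := by
    by_contra! hlt
    have hgt' : ∀ t ∈ Icc p r, -xC < y t := by
      intro t ht
      by_contra! hle
      refine absurd (hy.le_const hε (hp.trans ht.1) (b := r) (fun u hu => ?_) hle r
        ⟨ht.2, le_rfl⟩) (not_le.2 hlt)
      rw [force_neg_xC]
      nlinarith [hl u ⟨ht.1.trans hu.1, by linarith [hu.2]⟩]
    -- Above `-x_c` the force is at most `-(s² + Y²/2)`, a Riccati inequality. `arctan (k Y)` then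
    -- decreases at rate `2s/(3ε)`, so time `5ε/s` costs `10/3 > π`: the fall takes bounded scaled
    -- time from any height.
    set k := 2 / (3 * s) with hk
    have hk0 : 0 < k := by positivity
    have hanti : AntitoneOn (fun t => Real.arctan (k * (y t - xC)) + 2 * s / (3 * ε) * t)
        (Icc p r) := by
      refine antitoneOn_of_hasDerivWithinAt_nonpos (convex_Icc p r)
        (f' := fun t => 1 / (1 + (k * (y t - xC)) ^ 2) * (k * (force (y t) (drive A t) / ε)) +
          2 * s / (3 * ε)) ?_ (fun t ht => ?_) fun t ht => ?_
      · have := hy.continuousOn.mono (fun t (ht : t ∈ Icc p r) => hp.trans ht.1)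
        fun_prop
      · rw [interior_Icc] at ht
        have h1 := (((hy.hasDerivAt (hp.trans_lt ht.1)).sub_const xC).const_mul k).arctan
        have h2 := h1.add ((hasDerivAt_id t).const_mul (2 * s / (3 * ε)))
        rw [mul_one] at h2
        exact h2.hasDerivWithinAt
      · rw [interior_Icc] at ht
        have h1 := hl t ⟨ht.1.le, by linarith [ht.2]⟩
        have h2 := hgt' t ⟨ht.1.le, ht.2.le⟩
        set Y := y t - xC with hY
        have hF : force (y t) (drive A t) ≤ -(s ^ 2 * (1 + (k * Y) ^ 2)) := by
          have h3 : force (y t) (drive A t) = drive A t + lamC - Y ^ 2 * (Y + 3 * xC) := by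
            rw [← force_xC_add]; congr 1; rw [hY]; ring
          have h4 : 1 / 2 ≤ Y + 3 * xC := by linarith [xC_gt]
          have h5 : Y ^ 2 * (1 / 2) ≤ Y ^ 2 * (Y + 3 * xC) := by gcongr
          have h6 : s ^ 2 * (1 + (k * Y) ^ 2) = s ^ 2 + 4 / 9 * Y ^ 2 := by
            rw [hk]; field_simp; ring
          rw [h3, h6]
          nlinarith [sq_nonneg Y]
        have hpos : 0 < 1 + (k * Y) ^ 2 := by positivity
        have h7 : 1 / (1 + (k * Y) ^ 2) * (k * (force (y t) (drive A t) / ε)) ≤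
            1 / (1 + (k * Y) ^ 2) * (k * (-(s ^ 2 * (1 + (k * Y) ^ 2)) / ε)) := by gcongr
        have h8 : 1 / (1 + (k * Y) ^ 2) * (k * (-(s ^ 2 * (1 + (k * Y) ^ 2)) / ε)) =
            -(2 * s / (3 * ε)) := by
          rw [hk] at hpos ⊢; field_simp
        linarith
    have h1 := hanti (left_mem_Icc.2 hpr.le) (right_mem_Icc.2 hpr.le) hpr.le
    have h2 := Real.neg_pi_div_two_lt_arctan (k * (y r - xC))
    have h3 := Real.arctan_lt_pi_div_two (k * (y p - xC))
    have h4 : 2 * s / (3 * ε) * r - 2 * s / (3 * ε) * p = 10 / 3 := by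
      rw [hr]; field_simp; ring
    have := Real.pi_lt_d2
    simp only at h1
    linarith
  have hle : ∀ t ∈ Icc r q, y t ≤ -xC := by
    refine hy.le_const hε (hp.trans hpr.le) (fun u hu => ?_) hrle
    rw [force_neg_xC]
    nlinarith [hl u ⟨by linarith [hu.1], hu.2.le⟩]
  have hrq' : r ≤ q := by linarith
  -- Below `-x_c`, with `v² = y + 2 x_c`, the force is at most `-(s² + v²) ≤ -2 s v`. Hence `v`
  -- decreases at rate `s/ε` and, starting below `1`, reaches zero within the remaining time `ε/s`.
  have hanti : AntitoneOn (fun t => Real.sqrt (y t + 2 * xC) + s / ε * t) (Icc r q) := by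
    refine antitoneOn_of_hasDerivWithinAt_nonpos (convex_Icc r q)
      (f' := fun t => force (y t) (drive A t) / ε / (2 * Real.sqrt (y t + 2 * xC)) + s / ε)
      ?_ (fun t ht => ?_) fun t ht => ?_
    · have := hy.continuousOn.mono (fun t (ht : t ∈ Icc r q) => (hp.trans hpr.le).trans ht.1)
      fun_prop
    · rw [interior_Icc] at ht
      have hpos : 0 < y t + 2 * xC := by linarith [hgt t ⟨by linarith [ht.1], ht.2.le⟩]
      have h1 := ((hy.hasDerivAt ((hp.trans hpr.le).trans_lt ht.1)).add_const (2 * xC)).sqrt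
        hpos.ne'
      have h2 := h1.add ((hasDerivAt_id t).const_mul (s / ε))
      rw [mul_one] at h2
      exact h2.hasDerivWithinAt
    · rw [interior_Icc] at ht
      have hpos : 0 < y t + 2 * xC := by linarith [hgt t ⟨by linarith [ht.1], ht.2.le⟩]
      have h1 := hl t ⟨by linarith [ht.1], ht.2.le⟩
      have h2 := hle t ⟨ht.1.le, ht.2.le⟩
      set v := Real.sqrt (y t + 2 * xC) with hv
      have hv0 : 0 < v := Real.sqrt_pos.2 hpos
      have hv2 : v ^ 2 = y t + 2 * xC := Real.sq_sqrt hpos.le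
      have hF : force (y t) (drive A t) ≤ -(2 * s * v) := by
        rw [force_eq_fold, ← hv2]
        have h3 : 1 ≤ (y t - xC) ^ 2 := by nlinarith
        nlinarith [sq_nonneg (s - v), mul_le_mul_of_nonneg_right h3 (sq_nonneg v)]
      have h4 : force (y t) (drive A t) / ε / (2 * v) ≤ -(2 * s * v) / ε / (2 * v) := by gcongr
      have h5 : -(2 * s * v) / ε / (2 * v) = -(s / ε) := by field_simp
      linarith
  have h1 := hanti (left_mem_Icc.2 hrq') (right_mem_Icc.2 hrq') hrq'
  have h2 : 0 ≤ Real.sqrt (y q + 2 * xC) := Real.sqrt_nonneg _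
  have h3 : Real.sqrt (y r + 2 * xC) < 1 := by
    rw [Real.sqrt_lt' one_pos]; linarith [xC_lt]
  have h4 : 1 ≤ s / ε * q - s / ε * r := by
    have : s / ε * (ε / s) ≤ s / ε * (q - r) := by gcongr; linarith
    rw [div_mul_div_cancel₀ hε.ne', div_self hs.ne'] at this
    linarith
  simp only at h1
  linarith

theorem drive_le_near_int (hε : 0 < ε) (hε1 : ε < 1 / 1000) (hA : 100 * ε ≤ A - lamC) (n : ℤ)
    {t : ℝ} (ht : (t - n) ^ 2 ≤ 5 / 2 * ε) : drive A t ≤ -lamC - 50 * ε := by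
  have h1 : drive A t = drive A (t - n) := by
    rw [← drive_add_int A (t - n) n, sub_add_cancel]
  have h2 := drive_add_lamC A (t - n)
  have h3 : Real.sin (Real.pi * (t - n)) ^ 2 ≤ 25 * ε := by
    have h4 : Real.sin (Real.pi * (t - n)) ^ 2 ≤ (Real.pi * (t - n)) ^ 2 := by
      rw [← sq_abs, ← sq_abs (Real.pi * (t - n))]
      exact pow_le_pow_left₀ (abs_nonneg _) Real.abs_sin_le_abs 2
    have h5 : Real.pi ^ 2 ≤ 10 := by nlinarith [Real.pi_lt_d2, Real.pi_pos]
    rw [mul_pow] at h4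
    nlinarith [sq_nonneg (t - n)]
  have h6 := lamC_lt
  have h7 := lamC_pos
  have h8 := sq_nonneg (Real.sin (Real.pi * (t - n)))
  rw [h1]
  nlinarith

/-- During a time `√(5ε/2)` before an integer the driving is at least `50 ε` past the fold. The
product of `√(5ε/2)` and `√(50ε)` exceeds `6ε`, the time needed to fall. -/
theorem IsSolutionFrom.le_neg_two_xC_at_int (hε : 0 < ε) (hε1 : ε < 1 / 1000)
    (hA : 100 * ε ≤ A - lamC) (hy : IsSolutionFrom ε A t₀ y) {n : ℤ} (hn : t₀ ≤ n - 1 / 4) :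
    y n ≤ -(2 * xC) := by
  set w := Real.sqrt (5 / 2 * ε) with hw
  have hw2 : w ^ 2 = 5 / 2 * ε := Real.sq_sqrt (by linarith)
  have hw0 : 0 < w := Real.sqrt_pos.2 (by linarith)
  have hw1 : w ≤ 1 / 4 := by nlinarith
  set s := Real.sqrt (50 * ε) with hs
  have hs2 : s ^ 2 = 50 * ε := Real.sq_sqrt (by linarith)
  have hs0 : 0 < s := Real.sqrt_pos.2 (by linarith)
  refine hy.le_neg_two_xC_of_past_fold hε (p := n - w) (s := s) (by linarith) hs0
    (fun t ht => ?_) ?_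
  · rw [hs2]
    refine drive_le_near_int hε hε1 hA n ?_
    rw [← hw2]
    nlinarith [ht.1, ht.2]
  · rw [sub_sub_cancel, div_le_iff₀ hs0]
    have h1 : (6 * ε) ^ 2 ≤ (w * s) ^ 2 := by rw [mul_pow w, hw2, hs2]; nlinarith
    exact (abs_le_of_sq_le_sq' h1 (by positivity)).2

theorem drive_nonpos_of_mem {n : ℤ} (hA : 0 ≤ A) {t : ℝ} (ht : t ∈ Icc (n : ℝ) (n + 1 / 4)) :
    drive A t ≤ 0 := by
  rw [show t = (t - n) + n by ring, drive_add_int]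
  unfold drive
  have : 0 ≤ Real.cos (2 * Real.pi * (t - n)) := by
    apply Real.cos_nonneg_of_neg_pi_div_two_le_of_le
    · nlinarith [Real.pi_pos, ht.1]
    · nlinarith [Real.pi_pos, ht.2]
  nlinarith

/-- After the fall solutions stay below `-1` for a quarter period, as `F(-1, λ) = λ ≤ 0`, and
contract at rate at least `2/ε`. The next quarter expands at rate at most `1/ε`, leaving a net
exponent `-1/(4ε)`. -/
theorem half_period_contraction_int (hε : 0 < ε) (hε1 : ε < 1 / 1000) (hA : 100 * ε ≤ A - lamC)
    (hx : IsSolutionFrom ε A t₀ x) (hy : IsSolutionFrom ε A t₀ y) {n : ℤ} (hn : t₀ ≤ n - 1 / 4) :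
    |y (n + 1 / 2) - x (n + 1 / 2)| ≤ |y n - x n| * Real.exp (-(1 / 4) / ε) := by
  have hA0 : 0 ≤ A := by linarith [lamC_pos]
  have hn0 : t₀ ≤ n := by linarith
  have hlow : ∀ z, IsSolutionFrom ε A t₀ z → ∀ t ∈ Icc (n : ℝ) (n + 1 / 4), z t ≤ -1 := by
    intro z hz
    refine hz.le_const hε hn0 (fun t ht => ?_) ?_
    · have := drive_nonpos_of_mem hA0 (n := n) ⟨ht.1, ht.2.le⟩
      unfold force; linarith
    · have := hz.le_neg_two_xC_at_int hε hε1 hA hn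
      linarith [xC_gt]
  have h1 := hx.abs_sub_le hε hy (a := n) (b := n + 1 / 4) (c := -2) hn0 (by linarith)
    (fun t ht => by
      have e1 := hlow x hx t ⟨ht.1.le, ht.2.le⟩
      have e2 := hlow y hy t ⟨ht.1.le, ht.2.le⟩
      nlinarith)
  have h2 := hx.abs_sub_le_exp hε hy (a := n + 1 / 4) (b := n + 1 / 2) (by linarith) (by linarith)
  refine h2.trans ((mul_le_mul_of_nonneg_right h1 (Real.exp_pos _).le).trans_eq ?_)
  rw [mul_assoc, ← Real.exp_add]
  congr 2
  ring

theorem period_contraction (hε : 0 < ε) (hε1 : ε < 1 / 1000) (hA : 100 * ε ≤ A - lamC)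
    (hx : IsSolutionFrom ε A t₀ x) (hy : IsSolutionFrom ε A t₀ y) {n : ℤ} (hn : t₀ ≤ n - 1 / 4) :
    |y (n + 1) - x (n + 1)| ≤ |y n - x n| * Real.exp (-(1 / 2) / ε) := by
  have h1 := half_period_contraction_int hε hε1 hA hx hy hn
  have h2 := half_period_contraction_int hε hε1 hA hx.antisymm_shift hy.antisymm_shift (n := n)
    (by linarith)
  have e1 : (n : ℝ) + 1 / 2 + 1 / 2 = n + 1 := by ring
  rw [e1, neg_sub_neg, neg_sub_neg, abs_sub_comm (x _), abs_sub_comm (x _)] at h2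
  refine h2.trans ((mul_le_mul_of_nonneg_right h1 (Real.exp_pos _).le).trans_eq ?_)
  rw [mul_assoc, ← Real.exp_add]
  congr 2
  ring

theorem iterate_period_contraction (hε : 0 < ε) (hε1 : ε < 1 / 1000) (hA : 100 * ε ≤ A - lamC)
    (hx : IsSolutionFrom ε A t₀ x) (hy : IsSolutionFrom ε A t₀ y) {N : ℤ} (hN : t₀ ≤ N - 1 / 4)
    (k : ℕ) : |y (N + k) - x (N + k)| ≤ |y N - x N| * Real.exp (-(1 / 2) * k / ε) := by
  induction k with
  | zero => simp
  | succ k ih =>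
    have h1 := period_contraction hε hε1 hA hx hy (n := N + k)
      (by push_cast; linarith [k.cast_nonneg (α := ℝ)])
    push_cast at h1 ⊢
    rw [← add_assoc]
    refine h1.trans ((mul_le_mul_of_nonneg_right ih (Real.exp_pos _).le).trans_eq ?_)
    rw [mul_assoc, ← Real.exp_add]
    congr 2
    ring

/-- Whole periods starting at integer times contract. The factor `exp (4/ε)` covers the initial
stretch up to such a time and the final fraction of a period. -/
theorem large_amplitude_contraction (hε : 0 < ε) (hε1 : ε < 1 / 1000) (hA : 100 * ε ≤ A - lamC)
    (hx : IsSolutionFrom ε A t₀ x) (hy : IsSolutionFrom ε A t₀ y) {t : ℝ} (ht : t₀ ≤ t) :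
    |y t - x t| ≤ |y t₀ - x t₀| * Real.exp (4 / ε) * Real.exp (-(1 / 2) * (t - t₀) / ε) := by
  set N : ℤ := ⌈t₀ + 1 / 4⌉ with hN
  have hN1 : t₀ + 1 / 4 ≤ N := Int.le_ceil _
  have hN2 : (N : ℝ) < t₀ + 1 / 4 + 1 := Int.ceil_lt_add_one _
  rw [mul_assoc, ← Real.exp_add]
  rcases le_total t N with h | h
  · refine (hx.abs_sub_le_exp hε hy le_rfl ht).trans ?_
    gcongr
    rw [← add_div]
    gcongr
    linarith
  · set k : ℕ := ⌊t - N⌋₊ with hk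
    have hk1 : (k : ℝ) ≤ t - N := Nat.floor_le (by linarith)
    have hk2 : t - N < k + 1 := Nat.lt_floor_add_one _
    have h1 := hx.abs_sub_le_exp hε hy (a := N + k) (b := t)
      (by linarith [k.cast_nonneg (α := ℝ)]) (by linarith)
    have h2 := iterate_period_contraction hε hε1 hA hx hy (N := N) (by linarith) k
    have h3 := hx.abs_sub_le_exp hε hy (a := t₀) (b := N) le_rfl (by linarith)
    calc |y t - x t| ≤ |y (N + k) - x (N + k)| * Real.exp ((t - (N + k)) / ε) := h1
      _ ≤ (|y N - x N| * Real.exp (-(1 / 2) * k / ε)) * Real.exp ((t - (N + k)) / ε) := by gcongr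
      _ ≤ ((|y t₀ - x t₀| * Real.exp ((N - t₀) / ε)) * Real.exp (-(1 / 2) * k / ε)) *
          Real.exp ((t - (N + k)) / ε) := by gcongr
      _ = |y t₀ - x t₀| * Real.exp (((N - t₀) + -(1 / 2) * k + (t - (N + k))) / ε) := by
          rw [mul_assoc, mul_assoc, ← Real.exp_add, ← Real.exp_add]
          congr 2
          ring
      _ ≤ _ := by
          gcongr
          rw [← add_div]
          exact div_le_div_of_nonneg_right (by linarith) hε.le

theorem large_amplitude_attracted (hε : 0 < ε) (hε1 : ε < 1 / 1000) (hA : 100 * ε ≤ A - lamC)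
    (hx : IsSolutionFrom ε A t₀ x) (hy : IsSolutionFrom ε A t₀ y) : AttractedBy y x :=
  attracted_of_abs_sub_le_exp (c := 1 / 2) (by norm_num) hε fun _ ht =>
    large_amplitude_contraction hε hε1 hA hx hy ht

theorem large_amplitude_stable (hε : 0 < ε) (hε1 : ε < 1 / 1000) (hA : 100 * ε ≤ A - lamC)
    (hx : IsGlobalSolution ε A x) : IsStableSolution ε A x := by
  constructor
  · intro t₀ η hη
    refine ⟨η * Real.exp (-(4 / ε)), by positivity, fun y hy hd t ht => ?_⟩
    refine (large_amplitude_contraction hε hε1 hA (hx.solutionFrom t₀) hy ht).trans_lt ?_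
    have h1 : Real.exp (-(1 / 2) * (t - t₀) / ε) ≤ 1 := by
      rw [Real.exp_le_one_iff]
      exact div_nonpos_of_nonpos_of_nonneg (by linarith) hε.le
    calc |y t₀ - x t₀| * Real.exp (4 / ε) * Real.exp (-(1 / 2) * (t - t₀) / ε)
        ≤ |y t₀ - x t₀| * Real.exp (4 / ε) := mul_le_of_le_one_right (by positivity) h1
      _ < η * Real.exp (-(4 / ε)) * Real.exp (4 / ε) := by gcongr
      _ = η := by rw [mul_assoc, ← Real.exp_add]; simp
  · intro t₀
    exact ⟨1, one_pos, fun y hy _ => large_amplitude_attracted hε hε1 hA (hx.solutionFrom t₀) hy⟩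

theorem large_amplitude_exists_unique (hε : 0 < ε) (hε1 : ε < 1 / 1000)
    (hA : 100 * ε ≤ A - lamC) :
    ∃ x, {z | IsPeriodicSolution ε A z} = {x} ∧ Function.Periodic x 1 ∧
      IsStableSolution ε A x := by
  have hA0 : 0 < A := by linarith [lamC_pos]
  have habs : |A + 2| ≤ A + 2 := by rw [abs_of_pos (by linarith)]
  obtain ⟨x, hx, hper, -⟩ := exists_periodic_of_displacement (p := -(A + 2)) (q := A + 2) hε
    hA0.le (by linarith) (by rwa [abs_neg]) habs (Or.inl fun y hy => ⟨fun h =>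
      hy.ge_const hε le_rfl (fun t _ => (force_neg_add_two_pos hA0.le t).le) h.ge 1
        ⟨zero_le_one, le_rfl⟩, fun h =>
      hy.le_const hε le_rfl (fun t _ => (force_add_two_neg hA0.le t).le) h.le 1
        ⟨zero_le_one, le_rfl⟩⟩)
  refine ⟨x, ?_, hper, large_amplitude_stable hε hε1 hA hx⟩
  ext z
  simp only [mem_ofPred_eq, mem_singleton_iff]
  constructor
  · intro hz
    exact hz.eq_of_attracted hε hA0 hper (large_amplitude_attracted hε hε1 hA
      (hx.solutionFrom 0) (hz.1.solutionFrom 0))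
  · rintro rfl
    exact ⟨hx, 1, one_pos, hper⟩

theorem IsPeriodicSolution.periodic_one (hε : 0 < ε) (hε1 : ε < 1 / 1000)
    (hA : 100 * ε ≤ A - lamC) (hx : IsPeriodicSolution ε A x) : Function.Periodic x 1 := by
  obtain ⟨z, hz, hper, -⟩ := large_amplitude_exists_unique hε hε1 hA
  have : x ∈ ({z} : Set (ℝ → ℝ)) := hz ▸ hx
  rw [mem_singleton_iff] at this
  rwa [this]

/-- The reflected half-period shift is again a periodic solution, so uniqueness makes it the same
one. -/
theorem IsPeriodicSolution.add_half (hε : 0 < ε) (hε1 : ε < 1 / 1000)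
    (hA : 100 * ε ≤ A - lamC) (hx : IsPeriodicSolution ε A x) (t : ℝ) :
    x (t + 1 / 2) = -x t := by
  obtain ⟨z, hz, -, -⟩ := large_amplitude_exists_unique hε hε1 hA
  have h1 : x ∈ ({z} : Set (ℝ → ℝ)) := hz ▸ hx
  have h2 : (fun t => -x (t + 1 / 2)) ∈ ({z} : Set (ℝ → ℝ)) := hz ▸ hx.antisymm_shift
  rw [mem_singleton_iff] at h1 h2
  have h3 : x t = -x (t + 1 / 2) := congrFun (h1.trans h2.symm) t
  linarith

end LargeAmplitude

/-! ### Large amplitude: the adiabatic limit -/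

section AdiabaticLimit

variable {ε A t₀ : ℝ} {x y : ℝ → ℝ}

/-- Where the force pushes down at a definite rate, solutions descend in time `O(ε)`. -/
theorem IsSolutionFrom.le_of_fast_descent (hε : 0 < ε) (hy : IsSolutionFrom ε A t₀ y)
    {p q z c : ℝ} (hp : t₀ ≤ p) (hpq : p ≤ q) (hc : 0 < c)
    (h : ∀ t ∈ Ico p q, z ≤ y t → force (y t) (drive A t) ≤ -c)
    (h0 : y p ≤ z + c * (q - p) / (2 * ε)) : y q ≤ z := by
  -- The comparison line descends at half the guaranteed speed, so the solution cannot touch it from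
  -- below.
  have hB : ∀ s, HasDerivAt (fun s => z + c * (q - s) / (2 * ε)) (c * (-1) / (2 * ε)) s := by
    intro s
    exact ((((hasDerivAt_id s).const_sub q).const_mul c).div_const (2 * ε)).const_add z
  have h1 := image_le_of_deriv_right_lt_deriv_boundary
    (hy.continuousOn.mono fun s (hs : s ∈ Icc p q) => hp.trans hs.1)
    (fun s hs => hy.hasDerivWithinAt_right (hp.trans hs.1)) h0 hB (fun s hs heq => by
      have h2 : 0 ≤ c * (q - s) / (2 * ε) :=
        div_nonneg (mul_nonneg hc.le (by linarith [hs.2])) (by linarith)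
      have h3 := h s hs (by rw [heq]; linarith)
      have h4 : force (y s) (drive A s) / ε ≤ -c / ε := by gcongr
      have h5 : -c / ε < c * (-1) / (2 * ε) := by
        rw [div_lt_div_iff₀ hε (by linarith)]
        nlinarith [mul_pos hc hε]
      linarith) (right_mem_Icc.2 hpq)
  simpa using h1

theorem IsSolutionFrom.ge_of_fast_ascent (hε : 0 < ε) (hy : IsSolutionFrom ε A t₀ y)
    {p q z c : ℝ} (hp : t₀ ≤ p) (hpq : p ≤ q) (hc : 0 < c)
    (h : ∀ t ∈ Ico p q, y t ≤ z → c ≤ force (y t) (drive A t))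
    (h0 : z - c * (q - p) / (2 * ε) ≤ y p) : z ≤ y q := by
  have h1 := hy.neg_subsolution_aux.le_of_fast_descent hε hp hpq hc (z := -z)
    (fun t ht hz => by
      have h2 : drive (-A) t = -drive A t := by unfold drive; ring
      rw [h2, force_neg]
      linarith [h t ht (by linarith)]) (by linarith)
  linarith

theorem force_le_of_le {a b l : ℝ} (hab : a ≤ b) (hb : b ≤ -xC) : force b l ≤ force a l := by
  have h1 := force_sub b a l
  have h2 := xC_sq
  have h3 := xC_pos
  have h4 : (b - a) * (1 - (b ^ 2 + b * a + a ^ 2)) ≤ 0 :=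
    mul_nonpos_of_nonneg_of_nonpos (by linarith) (by nlinarith)
  linarith

theorem force_lt_of_lt {a b l : ℝ} (hab : a < b) (hb : b ≤ -xC) : force b l < force a l := by
  have h1 := force_sub b a l
  have h2 := xC_sq
  have h3 := xC_pos
  have h4 : (b - a) * (1 - (b ^ 2 + b * a + a ^ 2)) < 0 :=
    mul_neg_of_pos_of_neg (by linarith) (by nlinarith)
  linarith

theorem eventually_drive_near (A t : ℝ) {c : ℝ} (hc : 0 < c) :
    ∃ δ > 0, ∀ s, |s - t| ≤ δ → |drive A s - drive A t| ≤ c := by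
  obtain ⟨δ, hδ, h⟩ := Metric.continuousAt_iff.1 ((continuous_drive A).continuousAt (x := t)) c hc
  refine ⟨δ / 2, by linarith, fun s hs => ?_⟩
  have := h (x := s) (by rw [Real.dist_eq]; linarith)
  rw [Real.dist_eq] at this
  exact this.le

/-- The bounds on `ε` under which the estimates for large amplitude apply. -/
def LargeRegime (A : ℝ) (z : ℝ → ℝ → ℝ) (ε : ℝ) : Prop :=
  0 < ε ∧ ε < 1 / 1000 ∧ 100 * ε ≤ A - lamC ∧ IsPeriodicSolution ε A (z ε)

theorem eventually_small {r : ℝ} (hr : 0 < r) : ∀ᶠ ε in 𝓝[>] (0 : ℝ), ε < r :=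
  Filter.Eventually.filter_mono nhdsWithin_le_nhds (eventually_lt_nhds hr)

/-- Below the lower branch the force is bounded away from zero, so the solution ascends from the
trapping bound within time `O(ε)`. No knowledge of the current branch is needed. -/
theorem eventually_ge_near_equilibrium {z : ℝ → ℝ → ℝ} (hA : 0 < A)
    (hz : ∀ᶠ ε in 𝓝[>] (0 : ℝ), LargeRegime A z ε) {t X ρ : ℝ} (hρ : 0 < ρ)
    (hX : force X (drive A t) = 0) (hX1 : X ≤ -xC) :
    ∀ᶠ ε in 𝓝[>] (0 : ℝ), X - ρ ≤ z ε t := by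
  set c := force (X - ρ) (drive A t) / 2 with hc
  have hc0 : 0 < c := by
    have := force_lt_of_lt (l := drive A t) (show X - ρ < X by linarith) hX1
    rw [hX] at this
    linarith
  obtain ⟨δ, hδ, hd⟩ := eventually_drive_near A t hc0
  filter_upwards [hz, eventually_small (show 0 < c * δ / (2 * (A + 2 + |X - ρ|)) by positivity)]
    with ε ⟨hε, _, _, hper⟩ hsmall
  refine (hper.1.solutionFrom (t - δ)).ge_of_fast_ascent hε le_rfl (by linarith) hc0
    (fun s hs hle => ?_) ?_
  · have h1 := hd s (abs_le.2 ⟨by linarith [hs.1], by linarith [hs.2]⟩)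
    have h2 := force_le_of_le (l := drive A t) hle (by linarith)
    have h3 : force (z ε s) (drive A s) =
        force (z ε s) (drive A t) + (drive A s - drive A t) := by unfold force; ring
    have h4 := (abs_le.1 h1).1
    rw [h3]; linarith
  · have h1 := (abs_le.1 (hper.abs_le_add_two hε hA.le (t - δ))).1
    have h2 : A + 2 + |X - ρ| ≤ c * (t - (t - δ)) / (2 * ε) := by
      rw [lt_div_iff₀ (by positivity)] at hsmall
      rw [le_div_iff₀ (by positivity), sub_sub_cancel]
      linarith
    have h3 := le_abs_self (X - ρ)
    linarith

/-- From above, descent to the lower branch requires that the solution already be below `-x_c`,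
where the force is decreasing; `hlow` supplies this. -/
theorem eventually_le_near_equilibrium {z : ℝ → ℝ → ℝ} (hA : 0 < A)
    (hz : ∀ᶠ ε in 𝓝[>] (0 : ℝ), LargeRegime A z ε) {t X η ρ : ℝ} (hη : 0 < η) (hρ : 0 < ρ)
    (hlow : ∀ᶠ ε in 𝓝[>] (0 : ℝ), ∀ s ∈ Icc (t - η) t, z ε s ≤ -xC)
    (hX : force X (drive A t) = 0) :
    ∀ᶠ ε in 𝓝[>] (0 : ℝ), z ε t ≤ X + ρ := by
  rcases le_or_gt (-xC) (X + ρ) with h | h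
  · filter_upwards [hlow] with ε h1
    exact (h1 t ⟨by linarith, le_rfl⟩).trans h
  set c := -force (X + ρ) (drive A t) / 2 with hc
  have hc0 : 0 < c := by
    have := force_lt_of_lt (l := drive A t) (show X < X + ρ by linarith) h.le
    rw [hX] at this
    linarith
  obtain ⟨δ, hδ, hd⟩ := eventually_drive_near A t hc0
  set d := min δ η with hd'
  have hd0 : 0 < d := lt_min hδ hη
  have hdδ : d ≤ δ := min_le_left _ _
  have hdη : d ≤ η := min_le_right _ _
  filter_upwards [hz, hlow,
    eventually_small (show 0 < c * d / (2 * (A + 2 + |X + ρ|)) by positivity)]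
    with ε ⟨hε, _, _, hper⟩ hl hsmall
  refine (hper.1.solutionFrom (t - d)).le_of_fast_descent hε le_rfl (by linarith) hc0
    (fun s hs hle => ?_) ?_
  · have h1 := hd s (abs_le.2 ⟨by linarith [hs.1], by linarith [hs.2]⟩)
    have h2 := force_le_of_le (l := drive A t) hle (hl s ⟨by linarith [hs.1], hs.2.le⟩)
    have h3 : force (z ε s) (drive A s) =
        force (z ε s) (drive A t) + (drive A s - drive A t) := by unfold force; ring
    have h4 := (abs_le.1 h1).2
    rw [h3]; linarith
  · have h1 := hper.le_add_two hε hA.le (t - d)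
    have h2 : A + 2 + |X + ρ| ≤ c * (t - (t - d)) / (2 * ε) := by
      rw [lt_div_iff₀ (by positivity)] at hsmall
      rw [le_div_iff₀ (by positivity), sub_sub_cancel]
      linarith
    have h3 := neg_abs_le (X + ρ)
    linarith

theorem eventually_low_of_drive_lt {z : ℝ → ℝ → ℝ}
    (hz : ∀ᶠ ε in 𝓝[>] (0 : ℝ), LargeRegime A z ε) {t : ℝ} (ht : drive A t < -lamC) :
    ∃ η > 0, ∀ᶠ ε in 𝓝[>] (0 : ℝ), ∀ s ∈ Icc (t - η) t, z ε s ≤ -xC := by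
  set b := (-lamC - drive A t) / 2 with hb
  have hb0 : 0 < b := by linarith
  obtain ⟨δ, hδ, hd⟩ := eventually_drive_near A t hb0
  have hs0 : 0 < Real.sqrt b := Real.sqrt_pos.2 hb0
  refine ⟨δ / 2, by linarith, ?_⟩
  filter_upwards [hz, eventually_small (show 0 < δ / 2 * Real.sqrt b / 6 by positivity)]
    with ε ⟨hε, _, _, hper⟩ hsmall s hs
  have h1 := (hper.1.solutionFrom (t - δ)).le_neg_two_xC_of_past_fold hε (p := t - δ) (q := s)
    (s := Real.sqrt b) le_rfl hs0 (fun u hu => by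
      rw [Real.sq_sqrt hb0.le]
      have := (abs_le.1 (hd u (abs_le.2 ⟨by linarith [hu.1], by linarith [hu.2, hs.2]⟩))).2
      linarith) (by
      rw [div_le_iff₀ hs0]
      have : δ / 2 * Real.sqrt b ≤ (s - (t - δ)) * Real.sqrt b := by
        gcongr; linarith [hs.1]
      linarith)
  linarith [xC_pos]

/-- The solution fell at the preceding integer time and stays below `-x_c` as long as `λ ≤ λ_c`,
since `F(-x_c, λ) = λ - λ_c`. The other time with vanishing derivative is excluded because there `λ
= A > λ_c`. -/
theorem eventually_low_of_rising {z : ℝ → ℝ → ℝ} (hA : lamC < A)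
    (hz : ∀ᶠ ε in 𝓝[>] (0 : ℝ), LargeRegime A z ε) {t : ℝ} (ht : drive A t ≤ lamC)
    (hd : 0 ≤ deriv (drive A) t) :
    ∃ η > 0, ∀ᶠ ε in 𝓝[>] (0 : ℝ), ∀ s ∈ Icc (t - η) t, z ε s ≤ -xC := by
  have hlam := lamC_pos
  have hpi := Real.pi_pos
  set n : ℤ := ⌊t + 1 / 2⌋ with hn
  have hn1 : (n : ℝ) ≤ t + 1 / 2 := Int.floor_le _
  have hn2 : t + 1 / 2 < n + 1 := Int.lt_floor_add_one _
  have hdrive : ∀ s, drive A s = -(A * Real.cos (2 * Real.pi * (s - n))) := by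
    intro s
    rw [show s = (s - n) + n by ring, drive_add_int]
    unfold drive
    rw [show s - n + n - n = s - n by ring]
  have hsin : 0 ≤ Real.sin (2 * Real.pi * (t - n)) := by
    rw [deriv_drive, show 2 * Real.pi * t = 2 * Real.pi * (t - n) + n * (2 * Real.pi) by ring,
      Real.sin_add_int_mul_two_pi] at hd
    have : 0 < 2 * Real.pi * A := by have : 0 < A := by linarith
                                     positivity
    exact nonneg_of_mul_nonneg_right hd this
  have hτ : 0 ≤ t - n := by
    by_contra! hneg
    rcases eq_or_lt_of_le (show -(1 / 2) ≤ t - n by linarith) with h | h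
    · rw [hdrive, ← h, show 2 * Real.pi * -(1 / 2) = -Real.pi by ring, Real.cos_neg,
        Real.cos_pi] at ht
      linarith
    · have := Real.sin_neg_of_neg_of_neg_pi_lt (x := 2 * Real.pi * (t - n)) (by nlinarith)
        (by nlinarith)
      linarith
  rcases eq_or_lt_of_le hτ with h | h
  · refine eventually_low_of_drive_lt hz ?_
    rw [hdrive, ← h]
    simpa using hA
  · refine ⟨t - n, h, ?_⟩
    filter_upwards [hz] with ε ⟨hε, hε1, hA1, hper⟩
    rw [sub_sub_cancel]
    refine (hper.1.solutionFrom (n - 1)).le_const hε (by linarith) (fun s hs => ?_) ?_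
    · rw [force_neg_xC]
      have h1 : Real.cos (2 * Real.pi * (t - n)) ≤ Real.cos (2 * Real.pi * (s - n)) := by
        apply Real.cos_le_cos_of_nonneg_of_le_pi
        · exact mul_nonneg (by linarith) (by linarith [hs.1])
        · nlinarith
        · have := hs.2
          gcongr
      rw [hdrive] at ht ⊢
      nlinarith
    · have := (hper.1.solutionFrom (n - 1)).le_neg_two_xC_at_int hε hε1 hA1 (n := n) (by linarith)
      linarith [xC_pos]

theorem tendsto_branchMinus {z : ℝ → ℝ → ℝ} (hA : lamC < A)
    (hz : ∀ᶠ ε in 𝓝[>] (0 : ℝ), LargeRegime A z ε) {t : ℝ}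
    (ht : ¬(lamC < drive A t ∨ (-lamC ≤ drive A t ∧ deriv (drive A) t < 0))) :
    Tendsto (fun ε => z ε t) (𝓝[>] 0) (𝓝 (branchMinus (drive A t))) := by
  push Not at ht
  obtain ⟨h1, h2⟩ := ht
  have hA0 : 0 < A := lamC_pos.trans hA
  have hlow : ∃ η > 0, ∀ᶠ ε in 𝓝[>] (0 : ℝ), ∀ s ∈ Icc (t - η) t, z ε s ≤ -xC := by
    rcases lt_or_ge (drive A t) (-lamC) with h | h
    · exact eventually_low_of_drive_lt hz h
    · exact eventually_low_of_rising hA hz h1 (h2 h)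
  obtain ⟨η, hη, hlow⟩ := hlow
  obtain ⟨X, hX, hX1⟩ := exists_lower_equilibrium h1
  rw [branchMinus_eq hX hX1]
  refine Metric.tendsto_nhds.2 fun ρ hρ => ?_
  filter_upwards [eventually_le_near_equilibrium hA0 hz hη (half_pos hρ) hlow hX,
    eventually_ge_near_equilibrium hA0 hz (half_pos hρ) hX hX1] with ε h3 h4
  rw [Real.dist_eq, abs_lt]
  constructor <;> linarith

theorem tendsto_adiabaticLimit {z : ℝ → ℝ → ℝ} (hA : lamC < A)
    (hz : ∀ ε ∈ Ioo (0 : ℝ) (1 / 1000), 100 * ε ≤ A - lamC → IsPeriodicSolution ε A (z ε))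
    (t : ℝ) : Tendsto (fun ε => z ε t) (𝓝[>] 0) (𝓝 (adiabaticLimit A t)) := by
  have hz' : ∀ᶠ ε in 𝓝[>] (0 : ℝ), LargeRegime A z ε := by
    filter_upwards [self_mem_nhdsWithin, eventually_small (show (0 : ℝ) < 1 / 1000 by norm_num),
      eventually_small (show 0 < (A - lamC) / 100 by linarith)] with ε h1 h2 h3
    have h4 : 100 * ε ≤ A - lamC := by linarith
    exact ⟨h1, h2, h4, hz ε ⟨h1, h2⟩ h4⟩
  unfold adiabaticLimit
  split_ifs with h
  · have h1 : ¬(lamC < drive A (t + 1 / 2) ∨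
        (-lamC ≤ drive A (t + 1 / 2) ∧ deriv (drive A) (t + 1 / 2) < 0)) := by
      have hd : deriv (drive A) (t + 1 / 2) = -deriv (drive A) t := by
        rw [deriv_drive, deriv_drive,
          show 2 * Real.pi * (t + 1 / 2) = 2 * Real.pi * t + Real.pi by ring, Real.sin_add_pi]
        ring
      rw [drive_add_half, hd]
      have := lamC_pos
      rintro (h' | ⟨h', h''⟩) <;> rcases h with h | ⟨h, h3⟩ <;> linarith
    have h2 := (tendsto_branchMinus hA hz' h1).neg
    rw [branchMinus_eq_neg (by push Not at h1; exact h1.1), neg_neg, drive_add_half, neg_neg] at h2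
    refine h2.congr' ?_
    filter_upwards [hz'] with ε ⟨hε, hε1, hA1, hper⟩
    rw [hper.add_half hε hε1 hA1, neg_neg]
  · exact tendsto_branchMinus hA hz' h

end AdiabaticLimit

/-! ### Large amplitude: the fold passage -/

section FoldPassage

variable {ε A t₀ : ℝ} {x y : ℝ → ℝ}

theorem hysteresisArea_eq_half (hε : 0 < ε) (hε1 : ε < 1 / 1000) (hA : 100 * ε ≤ A - lamC)
    (hx : IsPeriodicSolution ε A x) :
    hysteresisArea A x = 2 * ∫ t in (-1 / 2 : ℝ)..0, ε * velocity ε A x t ^ 2 := by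
  have hc : Continuous fun t => ε * velocity ε A x t ^ 2 := by
    have := continuous_velocity hx.1
    fun_prop
  rw [hysteresisArea_eq hx.1 hε (hx.periodic_one hε hε1 hA),
    ← intervalIntegral.integral_add_adjacent_intervals (b := 0) (hc.intervalIntegrable _ _)
      (hc.intervalIntegrable _ _)]
  have h1 : ∫ t in (0 : ℝ)..(1 / 2), ε * velocity ε A x t ^ 2 =
      ∫ t in (-1 / 2 : ℝ)..0, ε * velocity ε A x (t + 1 / 2) ^ 2 := by
    rw [intervalIntegral.integral_comp_add_right (fun t => ε * velocity ε A x t ^ 2)]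
    norm_num
  have h2 : ∀ t, velocity ε A x (t + 1 / 2) = -velocity ε A x t := by
    intro t
    unfold velocity
    rw [hx.add_half hε hε1 hA, drive_add_half, force_neg, neg_div]
  rw [h1]
  simp only [h2, neg_sq]
  ring

theorem drive_antitoneOn (hA : 0 ≤ A) : AntitoneOn (drive A) (Icc (-1 / 2) 0) := by
  intro a ha b hb hab
  unfold drive
  have hpi := Real.pi_pos
  have : Real.cos (2 * Real.pi * a) ≤ Real.cos (2 * Real.pi * b) := by
    rw [← Real.cos_neg (2 * Real.pi * a), ← Real.cos_neg (2 * Real.pi * b)]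
    apply Real.cos_le_cos_of_nonneg_of_le_pi
    · nlinarith [hb.2]
    · nlinarith [ha.1]
    · nlinarith
  nlinarith

/-- The time at which the decreasing driving passes the fold. -/
theorem exists_fold_time (hA : lamC < A) : ∃ t₁ ∈ Icc (-(1 / 4) : ℝ) 0, drive A t₁ = -lamC := by
  have h0 : drive A 0 = -A := by unfold drive; simp
  have h1 : drive A (-(1 / 4)) = 0 := by
    unfold drive
    rw [show 2 * Real.pi * -(1 / 4) = -(Real.pi / 2) by ring, Real.cos_neg, Real.cos_pi_div_two]
    simp
  have := intermediate_value_Icc' (show (-(1 / 4) : ℝ) ≤ 0 by norm_num)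
    (continuous_drive A).continuousOn
  exact this ⟨by rw [h0]; linarith, by rw [h1]; linarith [lamC_pos]⟩

/-- At the fold time `2A sin² (πt₁) = a₀`, and Jordan's inequality gives `|sin (πt₁)| ≥ 2 |t₁|`. -/
theorem fold_time_sq_le (hA : lamC < A) {t₁ : ℝ} (ht : t₁ ∈ Icc (-(1 / 4) : ℝ) 0)
    (h : drive A t₁ = -lamC) : 8 * A * t₁ ^ 2 ≤ A - lamC := by
  have h1 := drive_add_lamC A t₁
  have hpi := Real.pi_pos
  have h2 := Real.mul_le_sin (x := Real.pi * -t₁) (mul_nonneg hpi.le (by linarith [ht.2]))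
    (by nlinarith [ht.1])
  have h3 : 2 / Real.pi * (Real.pi * -t₁) = -(2 * t₁) := by field_simp
  rw [h3, mul_neg, Real.sin_neg] at h2
  have h4 : (2 * t₁) ^ 2 ≤ Real.sin (Real.pi * t₁) ^ 2 := by nlinarith [ht.2]
  have hA0 : 0 < A := lamC_pos.trans hA
  nlinarith

/-- On this interval the driving is convex in time, hence below its chord from the fold time to the
minimum at `0`. -/
theorem drive_past_fold_le (hA : lamC < A) {t₁ θ : ℝ} (ht : t₁ ∈ Icc (-(1 / 4) : ℝ) 0)
    (h : drive A t₁ = -lamC) (hθ : θ ∈ Icc (0 : ℝ) 1) :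
    drive A ((1 - θ) * t₁) ≤ -lamC - θ * (A - lamC) := by
  have hpi := Real.pi_pos
  have hA0 : 0 < A := lamC_pos.trans hA
  have hc := strictConcaveOn_cos_Icc.concaveOn.2 (x := 2 * Real.pi * t₁) (y := 0)
    ⟨by nlinarith [ht.1], by nlinarith [ht.2]⟩ ⟨by linarith, by linarith⟩
    (show 0 ≤ 1 - θ by linarith [hθ.2]) hθ.1 (by ring)
  simp only [smul_eq_mul, mul_zero, add_zero, Real.cos_zero, mul_one] at hc
  unfold drive at h ⊢
  rw [show 2 * Real.pi * ((1 - θ) * t₁) = (1 - θ) * (2 * Real.pi * t₁) by ring]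
  have h1 := mul_le_mul_of_nonneg_left hc hA0.le
  have h2 : A * ((1 - θ) * Real.cos (2 * Real.pi * t₁) + θ) = (1 - θ) * lamC + θ * A := by
    linear_combination (-(1 - θ)) * h
  linarith

theorem drive_past_fold_ge (hA : lamC < A) {t₁ θ : ℝ} (ht : t₁ ∈ Icc (-(1 / 4) : ℝ) 0)
    (h : drive A t₁ = -lamC) (hθ : θ ∈ Icc (0 : ℝ) 1) :
    -lamC - 5 * θ * (A - lamC) ≤ drive A ((1 - θ) * t₁) := by
  have hpi := Real.pi_pos
  have hA0 : 0 < A := lamC_pos.trans hA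
  have hsq := fold_time_sq_le hA ht h
  have hpi2 : Real.pi ^ 2 ≤ 10 := by nlinarith [Real.pi_lt_d2]
  have h1 : |Real.cos (2 * Real.pi * ((1 - θ) * t₁)) - Real.cos (2 * Real.pi * t₁)| ≤
      4 * Real.pi ^ 2 * θ * t₁ ^ 2 := by
    rw [Real.cos_sub_cos, abs_mul, abs_mul]
    have e1 := Real.abs_sin_le_abs
      (x := (2 * Real.pi * ((1 - θ) * t₁) + 2 * Real.pi * t₁) / 2)
    have e2 := Real.abs_sin_le_abs
      (x := (2 * Real.pi * ((1 - θ) * t₁) - 2 * Real.pi * t₁) / 2)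
    have e3 : |(2 * Real.pi * ((1 - θ) * t₁) + 2 * Real.pi * t₁) / 2| ≤ 2 * Real.pi * (-t₁) := by
      have := mul_nonneg (mul_nonneg hpi.le (neg_nonneg.2 ht.2)) hθ.1
      have := mul_nonneg (mul_nonneg hpi.le (neg_nonneg.2 ht.2)) (sub_nonneg.2 hθ.2)
      rw [abs_le]; constructor <;> nlinarith
    have e4 : |(2 * Real.pi * ((1 - θ) * t₁) - 2 * Real.pi * t₁) / 2| = Real.pi * θ * (-t₁) := by
      rw [show (2 * Real.pi * ((1 - θ) * t₁) - 2 * Real.pi * t₁) / 2 = Real.pi * θ * (-t₁) by ring]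
      exact abs_of_nonneg (mul_nonneg (mul_nonneg hpi.le hθ.1) (by linarith [ht.2]))
    calc _ ≤ |(-2 : ℝ)| * (2 * Real.pi * (-t₁)) * (Real.pi * θ * (-t₁)) := by
          gcongr
          · have := ht.2
            exact mul_nonneg (by norm_num) (mul_nonneg (by positivity) (by linarith))
          · exact e1.trans e3
          · exact e2.trans e4.le
      _ = 4 * Real.pi ^ 2 * θ * t₁ ^ 2 := by norm_num; ring
  have h2 := (abs_le.1 h1).2
  have h3 : 4 * Real.pi ^ 2 * θ * t₁ ^ 2 ≤ 40 * (θ * t₁ ^ 2) := by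
    have := mul_nonneg hθ.1 (sq_nonneg t₁)
    nlinarith
  have h4 := mul_le_mul_of_nonneg_left hsq hθ.1
  unfold drive at h ⊢
  nlinarith

theorem exists_first_hit {f : ℝ → ℝ} {a b z : ℝ} (hab : a ≤ b) (hf : ContinuousOn f (Icc a b))
    (ha : z ≤ f a) (hb : f b ≤ z) : ∃ τ ∈ Icc a b, f τ = z ∧
      (∀ t ∈ Icc a τ, z ≤ f t) ∧ ∀ t ∈ Icc a b, f t ≤ z → τ ≤ t := by
  have hclosed : IsClosed (Icc a b ∩ f ⁻¹' Iic z) := hf.preimage_isClosed_of_isClosed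
    isClosed_Icc isClosed_Iic
  have hcomp : IsCompact (Icc a b ∩ f ⁻¹' Iic z) :=
    isCompact_Icc.of_isClosed_subset hclosed inter_subset_left
  obtain ⟨τ, hτ, hmin⟩ := hcomp.exists_isLeast ⟨b, right_mem_Icc.2 hab, hb⟩
  have hfτ : f τ = z := by
    obtain ⟨s, hs, hsz⟩ := intermediate_value_Icc' hτ.1.1
      (hf.mono (Icc_subset_Icc_right hτ.1.2)) (show z ∈ Icc (f τ) (f a) from ⟨hτ.2, ha⟩)
    have : τ ≤ s := hmin ⟨⟨hs.1, hs.2.trans hτ.1.2⟩, hsz.le⟩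
    rwa [le_antisymm hs.2 this] at hsz
  refine ⟨τ, hτ.1, hfτ, fun t ht => ?_, fun t ht hft => hmin ⟨ht, hft⟩⟩
  by_contra! hlt
  have : τ ≤ t := hmin ⟨⟨ht.1, ht.2.trans hτ.1.2⟩, hlt.le⟩
  rw [le_antisymm ht.2 this, hfτ] at hlt
  exact lt_irrefl _ hlt

/-- The potential of the force at the fold, `Ψ' = -F(·, -λ_c)`. -/
noncomputable def foldPotential (x : ℝ) : ℝ := x ^ 4 / 4 - x ^ 2 / 2 + lamC * x

/-- The drop from `x_c` to `-2 x_c` is `3/4`, half the static area; the remainder is cubic in the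
distance from the fold. -/
theorem foldPotential_eq (x : ℝ) :
    foldPotential x - foldPotential (-(2 * xC)) =
      3 / 4 + (x - xC) ^ 3 * ((x - xC) / 4 + xC) := by
  unfold foldPotential
  rw [lamC_eq]
  have h := xC_sq
  have h4 : xC ^ 4 = 1 / 9 := by rw [show xC ^ 4 = (xC ^ 2) ^ 2 by ring, h]; norm_num
  linear_combination (3 / 2 * x ^ 2 - 2 * x * xC) * h + (-13 / 4 : ℝ) * h4 + (2 + 4 / 3 : ℝ) * h

theorem hasDerivAt_foldPotential (hx : IsGlobalSolution ε A x) (t : ℝ) :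
    HasDerivAt (fun t => foldPotential (x t))
      ((x t - xC) ^ 2 * (x t + 2 * xC) * velocity ε A x t) t := by
  have h1 := hx t
  have h2 := (((h1.pow 4).div_const 4).sub ((h1.pow 2).div_const 2)).add (h1.const_mul lamC)
  convert! h2 using 1
  have h3 := force_eq_fold (x t) (drive A t)
  have h4 : (x t - xC) ^ 2 * (x t + 2 * xC) = x t ^ 3 - x t + lamC := by
    unfold force at h3; linarith
  rw [h4]
  unfold velocity
  push_cast
  ring

theorem eps_mul_velocity (hε : 0 < ε) (t : ℝ) :
    ε * velocity ε A x t = (drive A t + lamC) - (x t - xC) ^ 2 * (x t + 2 * xC) := by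
  unfold velocity
  rw [mul_div_cancel₀ _ hε.ne', force_eq_fold]

theorem IsPeriodicSolution.at_zero_le (hε : 0 < ε) (hε1 : ε < 1 / 1000)
    (hA : 100 * ε ≤ A - lamC) (hx : IsPeriodicSolution ε A x) : x 0 ≤ -(2 * xC) := by
  have := (hx.1.solutionFrom (-1)).le_neg_two_xC_at_int hε hε1 hA (n := 0) (by norm_num)
  simpa using this

theorem IsPeriodicSolution.ge_xC_before_fold (hε : 0 < ε) (hε1 : ε < 1 / 1000)
    (hA : 100 * ε ≤ A - lamC) (hx : IsPeriodicSolution ε A x) {t₁ : ℝ}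
    (ht : t₁ ∈ Icc (-(1 / 4) : ℝ) 0) (h : drive A t₁ = -lamC) :
    ∀ t ∈ Icc (-1 / 2) t₁, xC ≤ x t := by
  have h0 := hx.at_zero_le hε hε1 hA
  have h1 := hx.add_half hε hε1 hA (-1 / 2)
  rw [show (-1 / 2 + 1 / 2 : ℝ) = 0 by norm_num] at h1
  refine (hx.1.solutionFrom (-1 / 2)).ge_const hε le_rfl (fun t ht' => ?_) (by linarith [xC_pos])
  rw [force_xC]
  have := drive_antitoneOn (A := A) (by linarith [lamC_pos]) ⟨ht'.1, by linarith [ht'.2, ht.2]⟩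
    ⟨by linarith [ht.1], ht.2⟩ ht'.2.le
  linarith

/-- The passage is delayed: shortly after the fold time the solution is still near the fold. -/
theorem IsPeriodicSolution.near_fold_after (hε : 0 < ε) (hε1 : ε < 1 / 1000)
    (hA : 100 * ε ≤ A - lamC) (hx : IsPeriodicSolution ε A x) {t₁ θ η : ℝ}
    (ht : t₁ ∈ Icc (-(1 / 4) : ℝ) 0) (h : drive A t₁ = -lamC) (hθ : θ ∈ Ioc (0 : ℝ) 1)
    (hη : η ∈ Ioc (0 : ℝ) (1 / 2))
    (hb : (5 * θ * (A - lamC) + 2 * η ^ 2) * (θ * (-t₁)) ≤ ε * η) :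
    ∀ t ∈ Icc t₁ ((1 - θ) * t₁), xC - 1 / 2 ≤ x t := by
  have hAl : lamC < A := by linarith
  have hA0 : 0 < A := lamC_pos.trans hAl
  have ht0 : 0 < -t₁ := by
    rcases eq_or_lt_of_le ht.2 with h0 | h0
    · rw [h0] at h; unfold drive at h; simp at h; linarith
    · linarith
  set Δ := θ * (-t₁) with hΔ
  have hΔ0 : 0 < Δ := mul_pos hθ.1 ht0
  have htL : (1 - θ) * t₁ = t₁ + Δ := by rw [hΔ]; ring
  -- A straight line falling by `η` during the delay `Δ` is a subsolution; `hb` is exactly the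
  -- condition that it descends fast enough.
  have hu : ∀ s, HasDerivAt (fun s => xC - η / Δ * (s - t₁)) (-(η / Δ)) s := by
    intro s
    have := (((hasDerivAt_id s).sub_const t₁).const_mul (η / Δ)).const_sub xC
    simpa using this
  have hge := hx.ge_xC_before_fold hε hε1 hA ht h t₁ ⟨by linarith [ht.1], le_rfl⟩
  have hL := drive_past_fold_ge hAl ht h ⟨hθ.1.le, hθ.2⟩
  rw [htL] at hL ⊢
  have key := (hx.1.solutionFrom t₁).ge_of_subsolution hε le_rfl hu (b := t₁ + Δ)
    (fun s hs => ?_) (by simpa using hge)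
  · intro t ht'
    have h1 := key t ht'
    have h2 : η / Δ * (t - t₁) ≤ η := by
      rw [div_mul_eq_mul_div, div_le_iff₀ hΔ0]
      exact mul_le_mul_of_nonneg_left (by linarith [ht'.2]) hη.1.le
    linarith [hη.2]
  · have h1 : drive A (t₁ + Δ) ≤ drive A s := by
      refine drive_antitoneOn hA0.le ⟨by linarith [ht.1, hs.1], ?_⟩ ⟨by linarith [ht.1], ?_⟩
        hs.2.le
      · have : t₁ + Δ ≤ 0 := by rw [← htL]; nlinarith [hθ.2]
        linarith [hs.2]
      · rw [← htL]; nlinarith [hθ.2]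
    set Y := η / Δ * (s - t₁) with hY
    have hY0 : 0 ≤ Y := mul_nonneg (div_nonneg hη.1.le hΔ0.le) (by linarith [hs.1])
    have hY1 : Y ≤ η := by
      rw [hY, div_mul_eq_mul_div, div_le_iff₀ hΔ0]
      exact mul_le_mul_of_nonneg_left (by linarith [hs.2]) hη.1.le
    rw [sub_eq_add_neg, force_xC_add]
    have h2 : (-Y) ^ 2 * (-Y + 3 * xC) ≤ 2 * η ^ 2 := by
      have e1 : (-Y) ^ 2 ≤ η ^ 2 := by rw [neg_sq]; gcongr
      have e2 : -Y + 3 * xC ≤ 2 := by linarith [xC_lt]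
      nlinarith [sq_nonneg Y]
    have h3 : 5 * θ * (A - lamC) + 2 * η ^ 2 ≤ ε * (η / Δ) := by
      rw [mul_div_assoc', le_div_iff₀ hΔ0]; exact hb
    linarith

/-- The drop of the fold potential yields `3/4` per half period. After the delay the driving is at
least `θ a₀` past the fold while the solution still has more than unit distance to fall, which adds
`θ a₀`; antisymmetry doubles both. -/
theorem hysteresisArea_ge_of_delay (hε : 0 < ε) (hε1 : ε < 1 / 1000)
    (hA : 100 * ε ≤ A - lamC) (hx : IsPeriodicSolution ε A x) {t₁ θ η : ℝ}
    (ht : t₁ ∈ Icc (-(1 / 4) : ℝ) 0) (h : drive A t₁ = -lamC) (hθ : θ ∈ Ioc (0 : ℝ) 1)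
    (hη : η ∈ Ioc (0 : ℝ) (1 / 2))
    (hb : (5 * θ * (A - lamC) + 2 * η ^ 2) * (θ * (-t₁)) ≤ ε * η) :
    3 / 2 + 2 * (θ * (A - lamC)) ≤ hysteresisArea A x := by
  have hAl : lamC < A := by linarith
  have hA0 : 0 < A := lamC_pos.trans hAl
  have hxC := xC_gt
  have hcont := hx.1.continuous
  have hnear := hx.near_fold_after hε hε1 hA ht h hθ hη hb
  set tL := (1 - θ) * t₁ with htL
  have htL1 : t₁ ≤ tL := by rw [htL]; nlinarith [hθ.1, ht.2]
  have htL0 : tL ≤ 0 := by rw [htL]; nlinarith [hθ.2, ht.2]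
  have hge := hx.ge_xC_before_fold hε hε1 hA ht h t₁ ⟨by linarith [ht.1], le_rfl⟩
  obtain ⟨tb, htb, hxb, hab, -⟩ := exists_first_hit (z := -(2 * xC)) ht.2 hcont.continuousOn
    (by linarith) (hx.at_zero_le hε hε1 hA)
  have htLb : tL ≤ tb := by
    by_contra! hlt
    have := hnear tb ⟨htb.1, hlt.le⟩
    linarith
  have hanti := drive_antitoneOn (A := A) hA0.le
  have hv : ∀ t ∈ Icc t₁ tb, velocity ε A x t ≤ 0 := by
    intro t ht'
    have h1 := eps_mul_velocity (A := A) (x := x) hε t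
    have h2 := hanti ⟨by linarith [ht.1], ht.2⟩ ⟨by linarith [ht.1, ht'.1], ht'.2.trans htb.2⟩
      ht'.1
    have h3 : 0 ≤ (x t - xC) ^ 2 * (x t + 2 * xC) :=
      mul_nonneg (sq_nonneg _) (by linarith [hab t ht'])
    by_contra! hpos
    nlinarith [mul_pos hε hpos]
  have hvc := continuous_velocity hx.1
  have hc : Continuous fun t => ε * velocity ε A x t ^ 2 := by fun_prop
  have hΨ := hasDerivAt_foldPotential hx.1
  have hI1 : -foldPotential (x tL) - -foldPotential (x t₁) ≤
      ∫ t in t₁..tL, ε * velocity ε A x t ^ 2 := by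
    refine intervalIntegral.sub_le_integral_of_hasDeriv_right_of_le htL1
      (fun t _ => (hΨ t).neg.continuousAt.continuousWithinAt)
      (fun t _ => (hΨ t).neg.hasDerivWithinAt) hc.integrableOn_Icc fun t ht' => ?_
    have h1 := eps_mul_velocity (A := A) (x := x) hε t
    have h2 := hv t ⟨ht'.1.le, ht'.2.le.trans htLb⟩
    have h3 := hanti ⟨by linarith [ht.1], ht.2⟩ ⟨by linarith [ht.1, ht'.1], ht'.2.le.trans htL0⟩
      ht'.1.le
    have h4 : 0 ≤ velocity ε A x t * (drive A t + lamC) :=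
      mul_nonneg_of_nonpos_of_nonpos h2 (by linarith)
    have h5 : ε * velocity ε A x t ^ 2 = velocity ε A x t * (ε * velocity ε A x t) := by ring
    rw [h5, h1]
    nlinarith
  have hI2 : (-foldPotential (x tb) - θ * (A - lamC) * x tb) -
      (-foldPotential (x tL) - θ * (A - lamC) * x tL) ≤
      ∫ t in tL..tb, ε * velocity ε A x t ^ 2 := by
    have hder := fun t => (hΨ t).neg.sub ((hx.1 t).const_mul (θ * (A - lamC)))
    refine intervalIntegral.sub_le_integral_of_hasDeriv_right_of_le htLb
      (fun t _ => (hder t).continuousAt.continuousWithinAt)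
      (fun t _ => (hder t).hasDerivWithinAt) hc.integrableOn_Icc fun t ht' => ?_
    have h1 := eps_mul_velocity (A := A) (x := x) hε t
    have h2 := hv t ⟨htL1.trans ht'.1.le, ht'.2.le⟩
    have h3 := hanti ⟨by linarith [ht.1], htL0⟩
      ⟨by linarith [ht.1, ht'.1], ht'.2.le.trans htb.2⟩ ht'.1.le
    have h4 := drive_past_fold_le hAl ht h ⟨hθ.1.le, hθ.2⟩
    have h5 : 0 ≤ velocity ε A x t * (drive A t + lamC + θ * (A - lamC)) :=
      mul_nonneg_of_nonpos_of_nonpos h2 (by linarith)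
    have h6 : ε * velocity ε A x t ^ 2 = velocity ε A x t * (ε * velocity ε A x t) := by ring
    change -((x t - xC) ^ 2 * (x t + 2 * xC) * velocity ε A x t) -
      θ * (A - lamC) * velocity ε A x t ≤ _
    rw [h6, h1]
    nlinarith
  have hI3 : (∫ t in t₁..tL, ε * velocity ε A x t ^ 2) + ∫ t in tL..tb, ε * velocity ε A x t ^ 2 ≤
      ∫ t in (-1 / 2 : ℝ)..0, ε * velocity ε A x t ^ 2 := by
    rw [intervalIntegral.integral_add_adjacent_intervals (hc.intervalIntegrable _ _)
      (hc.intervalIntegrable _ _)]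
    refine intervalIntegral.integral_mono_interval (by linarith [ht.1]) (by linarith) htb.2
      (Eventually.of_forall fun t => ?_) (hc.intervalIntegrable _ _)
    exact mul_nonneg hε.le (sq_nonneg _)
  rw [hysteresisArea_eq_half hε hε1 hA hx]
  have hp1 := foldPotential_eq (x t₁)
  have hp2 : 0 ≤ (x t₁ - xC) ^ 3 * ((x t₁ - xC) / 4 + xC) :=
    mul_nonneg (pow_nonneg (by linarith) 3) (by linarith)
  have hxL := hnear tL ⟨htL1, le_rfl⟩
  rw [hxb] at hI2
  have hpos : 0 < θ * (A - lamC) := mul_pos hθ.1 (by linarith)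
  have : θ * (A - lamC) * 1 ≤ θ * (A - lamC) * (x tL + 2 * xC) := by gcongr; linarith
  linarith

/-- Writing `ε = r³` and `a₀ = q⁶` turns the fractional powers into polynomials. -/
theorem exists_roots (hε : 0 < ε) (hA : 0 < A - lamC) :
    ∃ r > 0, ∃ q > 0, ε = r ^ 3 ∧ A - lamC = q ^ 6 ∧
      ε ^ (2 / 3 : ℝ) * (A - lamC) ^ (1 / 3 : ℝ) = r ^ 2 * q ^ 2 := by
  refine ⟨ε ^ (1 / 3 : ℝ), by positivity, (A - lamC) ^ (1 / 6 : ℝ), by positivity, ?_, ?_, ?_⟩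
  · rw [← Real.rpow_natCast, ← Real.rpow_mul hε.le]; norm_num
  · rw [← Real.rpow_natCast, ← Real.rpow_mul hA.le]; norm_num
  · rw [← Real.rpow_natCast, ← Real.rpow_mul hε.le, ← Real.rpow_natCast, ← Real.rpow_mul hA.le]
    norm_num

theorem large_amplitude_area_ge (hε : 0 < ε) (hε1 : ε < 1 / 1000)
    (hA : 100 * ε ≤ A - lamC) (hx : IsPeriodicSolution ε A x) :
    1 / 8 * (ε ^ (2 / 3 : ℝ) * (A - lamC) ^ (1 / 3 : ℝ)) ≤ hysteresisArea A x - staticArea := by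
  have hAl : lamC < A := by linarith
  obtain ⟨t₁, ht, h⟩ := exists_fold_time hAl
  have hsq := fold_time_sq_le hAl ht h
  obtain ⟨r, hr, q, hq, hεr, haq, hpow⟩ := exists_roots hε (show 0 < A - lamC by linarith)
  rw [hpow, staticArea_eq]
  have hr1 : r < 1 := by
    by_contra! h1
    have : (1 : ℝ) ≤ r ^ 3 := one_le_pow₀ h1
    linarith
  have hrq : r ≤ q ^ 2 := by
    have h1 : r ^ 3 ≤ (q ^ 2) ^ 3 := by
      rw [← pow_mul]; norm_num; rw [← haq, ← hεr]; linarith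
    exact (pow_le_pow_iff_left₀ hr.le (by positivity) (by norm_num)).1 h1
  have ht1 : -t₁ ≤ 1 := by linarith [ht.1]
  have ht3 : -t₁ ≤ q ^ 3 := by
    have h1 : (-t₁) ^ 2 ≤ (q ^ 3) ^ 2 := by
      rw [← pow_mul]; norm_num; rw [← haq]
      nlinarith [lamC_gt, sq_nonneg t₁]
    exact (abs_le_of_sq_le_sq' h1 (by positivity)).2
  have ht0 : 0 ≤ -t₁ := by linarith [ht.2]
  -- This delay makes the excess `θ a₀` a fixed multiple of `r² q² = ε^{2/3} a₀^{1/3}`.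
  set θ := r ^ 2 / (16 * q ^ 4) with hθ
  have hθ0 : 0 < θ := by positivity
  have hθ1 : θ ≤ 1 := by
    rw [hθ, div_le_one (by positivity)]
    have : r ^ 2 ≤ (q ^ 2) ^ 2 := by gcongr
    nlinarith [pow_pos hq 4]
  have hθa : θ * (A - lamC) = r ^ 2 * q ^ 2 / 16 := by rw [hθ, haq]; field_simp
  have key : ∃ η ∈ Ioc (0 : ℝ) (1 / 2),
      (5 * θ * (A - lamC) + 2 * η ^ 2) * (θ * (-t₁)) ≤ ε * η := by
    rw [mul_assoc 5, hθa]
    -- The natural displacement is of order `r q = ε^{1/3} a₀^{1/6}`. When this is not small the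
    -- displacement is capped at `1/2`, and `|t₁| ≤ 1` replaces `|t₁| ≤ q³`.
    rcases le_or_gt (r * q) 2 with hle | hgt
    · refine ⟨r * q / 4, ⟨by positivity, by linarith⟩, ?_⟩
      have h1 : (5 * (r ^ 2 * q ^ 2 / 16) + 2 * (r * q / 4) ^ 2) * (θ * (-t₁)) ≤
          (5 * (r ^ 2 * q ^ 2 / 16) + 2 * (r * q / 4) ^ 2) * (θ * q ^ 3) := by gcongr
      have h2 : (5 * (r ^ 2 * q ^ 2 / 16) + 2 * (r * q / 4) ^ 2) * (θ * q ^ 3) =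
          7 / 256 * (r ^ 4 * q) := by rw [hθ]; field_simp; ring
      have h3 : ε * (r * q / 4) = 1 / 4 * (r ^ 4 * q) := by rw [hεr]; ring
      have h4 : 0 < r ^ 4 * q := by positivity
      linarith
    · refine ⟨1 / 2, ⟨by norm_num, le_rfl⟩, ?_⟩
      have h0 : 4 < r ^ 2 * q ^ 2 := by nlinarith
      have h1 : (5 * (r ^ 2 * q ^ 2 / 16) + 2 * (1 / 2) ^ 2) * (θ * (-t₁)) ≤
          (7 * (r ^ 2 * q ^ 2 / 16)) * (θ * 1) := by
        gcongr; linarith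
      have h2 : (7 * (r ^ 2 * q ^ 2 / 16)) * (θ * 1) = 7 / 256 * (r ^ 4 / q ^ 2) := by
        rw [hθ]; field_simp; ring
      have h3 : r ^ 4 / q ^ 2 ≤ r ^ 3 := by
        rw [div_le_iff₀ (by positivity)]
        nlinarith [pow_pos hr 3]
      have h4 : 0 < r ^ 3 := by positivity
      rw [hεr]
      linarith
  obtain ⟨η, hη, hb⟩ := key
  have := hysteresisArea_ge_of_delay hε hε1 hA hx ht h ⟨hθ0, hθ1⟩ hη hb
  rw [hθa] at this
  linarith

end FoldPassage

/-! ### Large amplitude: the upper bound on the area -/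

section AreaUpper

variable {ε A t₀ : ℝ} {x y : ℝ → ℝ}

theorem deriv_drive_sq_le (hA : 0 ≤ A) (t : ℝ) :
    (2 * Real.pi * A * Real.sin (2 * Real.pi * t)) ^ 2 ≤ 80 * A * (A + drive A t) := by
  have h1 := Real.sin_sq_add_cos_sq (2 * Real.pi * t)
  have h2 := abs_le.1 (abs_drive_le hA t)
  have hpi2 : Real.pi ^ 2 ≤ 10 := by nlinarith [Real.pi_lt_d2, Real.pi_pos]
  have h3 : (2 * Real.pi * A * Real.sin (2 * Real.pi * t)) ^ 2 =
      4 * Real.pi ^ 2 * ((A - drive A t) * (A + drive A t)) := by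
    unfold drive
    linear_combination 4 * Real.pi ^ 2 * A ^ 2 * h1
  rw [h3]
  have h4 : (A - drive A t) * (A + drive A t) ≤ 2 * A * (A + drive A t) := by
    gcongr <;> linarith
  have h5 : 0 ≤ (A - drive A t) * (A + drive A t) := mul_nonneg (by linarith) (by linarith)
  nlinarith

theorem sin_nonpos_of_mem {t : ℝ} (ht : t ∈ Icc (-1 / 2 : ℝ) 0) :
    Real.sin (2 * Real.pi * t) ≤ 0 := by
  have := Real.pi_pos
  exact Real.sin_nonpos_of_nonpos_of_neg_pi_le (by nlinarith [ht.2]) (by nlinarith [ht.1])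

/-- While `x ≥ x_c` before the fold, the solution lags behind the branch by a bounded force. -/
theorem neg_eps_mul_velocity_le (hε : 0 < ε) (hx : IsGlobalSolution ε A x) {t₁ N L : ℝ}
    (hA : 0 < A) (hN : A + 4 ≤ N) (hL : 3 * N * ε ≤ L)
    (hL3 : 9 * N ^ 2 * ε ^ 2 * (A - lamC) < L ^ 3) (ha : lamC < A)
    (hl : ∀ t ∈ Icc (-1 / 2) t₁, -lamC ≤ drive A t)
    (hxC : ∀ t ∈ Icc (-1 / 2) t₁, xC ≤ x t) (hxA : ∀ t, x t ≤ A + 2)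
    (h0 : 0 ≤ velocity ε A x (-1 / 2)) :
    ∀ t ∈ Icc (-1 / 2) t₁, -(ε * velocity ε A x t) ≤ L := by
  have hL0 : 0 < L := lt_of_lt_of_le (by nlinarith) hL
  have hv := fun t => ((hasDerivAt_velocity hx t).const_mul ε).neg
  intro t ht
  refine image_le_of_deriv_right_lt_deriv_boundary (f := fun t => -(ε * velocity ε A x t))
    (B := fun _ => L) (B' := fun _ => 0)
    (fun t _ => (hv t).continuousAt.continuousWithinAt) (fun t _ => (hv t).hasDerivWithinAt)
    ?_ (fun _ => hasDerivAt_const _ _) (fun s hs hE => ?_) ht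
  · have := mul_nonneg hε.le h0
    linarith
  · have hs' := Ico_subset_Icc_self hs
    have h1 := eps_mul_velocity (A := A) (x := x) hε s
    have h2 := hxC s hs'
    have h3 := hl s hs'
    have h4 := hxA s
    have hc := xC_gt
    have hc' := xC_lt
    have hsq := xC_sq
    have hd := deriv_drive_sq_le hA.le s
    set D := 2 * Real.pi * A * Real.sin (2 * Real.pi * s) with hD
    set v := velocity ε A x s with hvdef
    set l := drive A s + lamC with hldef
    have hl0 : 0 ≤ l := by linarith
    obtain ⟨w, hw⟩ : ∃ w, x s = xC + w := ⟨x s - xC, by ring⟩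
    rw [hw] at h1 h2 h4 ⊢
    have hw0 : 0 ≤ w := by linarith
    rw [show ε * (((1 - 3 * (xC + w) ^ 2) * v + D) / ε) = (1 - 3 * (xC + w) ^ 2) * v + D by
      field_simp]
    have hE' : ε * v = -L := by linarith
    -- When the lag equals `L`, the equation ties `w²` to `L + l`. This makes the relaxation `3 w L`
    -- beat `ε |λ'|` in both regimes of `l`; the margin is `80 < 81`, and it forces the lag to
    -- decrease.
    have hyN : L + l ≤ w ^ 2 * N := by
      have e1 : L + l = w ^ 2 * (w + 3 * xC) := by rw [hE'] at h1; linear_combination -h1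
      rw [e1]; gcongr; linarith
    have e2 : 1 - 3 * (xC + w) ^ 2 = -(3 * w ^ 2 + 6 * xC * w) := by
      linear_combination -3 * hsq
    have e3 : 3 * w ≤ 3 * w ^ 2 + 6 * xC * w := by nlinarith
    have hN0 : 0 < N := by linarith
    have hDl : ε ^ 2 * D ^ 2 < (3 * w * L) ^ 2 := by
      have f1 : D ^ 2 ≤ 80 * A * ((A - lamC) + l) := by
        rw [hldef]; linarith
      have f2 : 80 * A * ((A - lamC) + l) ≤ 80 * N * ((A - lamC) + l) := by
        gcongr; linarith
      have f3 : ε ^ 2 * D ^ 2 ≤ ε ^ 2 * (80 * N * ((A - lamC) + l)) := by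
        gcongr; linarith
      have f4 : (3 * N * ε) ^ 2 ≤ L ^ 2 := by gcongr
      have f5 : (3 * N * ε) ^ 2 * l ≤ L ^ 2 * l := by gcongr
      have f6 : 9 * L ^ 2 * (L + l) ≤ 9 * L ^ 2 * (w ^ 2 * N) := by gcongr
      have f7 : N * (ε ^ 2 * (80 * N * ((A - lamC) + l))) < 9 * L ^ 2 * (L + l) := by
        nlinarith [pow_pos hL0 3]
      have f8 : N * (ε ^ 2 * D ^ 2) < N * (3 * w * L) ^ 2 := by
        calc _ ≤ N * (ε ^ 2 * (80 * N * ((A - lamC) + l))) := by gcongr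
          _ < _ := f7
          _ ≤ _ := f6
          _ = _ := by ring
      exact lt_of_mul_lt_mul_left f8 hN0.le
    have hDl' : -(3 * w * L) < ε * D := by
      have : (ε * D) ^ 2 < (3 * w * L) ^ 2 := by rw [mul_pow]; exact hDl
      exact (abs_lt_of_sq_lt_sq' this (by positivity)).1
    have hvn : v < 0 := by nlinarith
    have : 0 < ε * ((1 - 3 * (xC + w) ^ 2) * v + D) := by
      have g1 : ε * ((1 - 3 * (xC + w) ^ 2) * v + D) = (3 * w ^ 2 + 6 * xC * w) * L + ε * D := by
        rw [e2]; linear_combination (-(3 * w ^ 2 + 6 * xC * w)) * hE'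
      rw [g1]
      have := mul_le_mul_of_nonneg_right e3 hL0.le
      linarith
    have := (mul_pos_iff_of_pos_left hε).1 this
    linarith

/-- The driving at the time of arrival on the lower branch. -/
theorem neg_drive_le_at_arrival (hε : 0 < ε) (hx : IsGlobalSolution ε A x) {t₁ tb N L : ℝ}
    (hA : lamC < A) (hN : A + 4 ≤ N) (hL : 0 < L)
    (hL3 : 9 * N ^ 2 * ε ^ 2 * (A - lamC) < L ^ 3)
    (ht : t₁ ∈ Icc (-(1 / 4) : ℝ) 0) (h : drive A t₁ = -lamC) (htb : tb ∈ Icc t₁ 0)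
    (hfirst : ∀ t ∈ Icc t₁ 0, x t ≤ -(2 * xC) → tb ≤ t) :
    -(drive A tb + lamC) ≤ 25 * L := by
  have hA0 : 0 < A := lamC_pos.trans hA
  have hanti := drive_antitoneOn (A := A) hA0.le
  have h0 := (abs_le.1 (abs_drive_le hA0.le tb)).1
  rcases le_or_gt (A - lamC) L with hle | hgt
  · linarith
  have ha0 : 0 < A - lamC := by linarith
  -- With this fraction the driving at `tL` lies between `L` and `5 L` past the fold, so the fall
  -- from there takes at most `6ε/√L`.
  have hθ : L / (A - lamC) ∈ Icc (0 : ℝ) 1 := ⟨by positivity, (div_le_one ha0).2 hgt.le⟩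
  have h1 := drive_past_fold_le hA ht h hθ
  have h2 := drive_past_fold_ge hA ht h hθ
  rw [mul_assoc] at h2
  rw [div_mul_cancel₀ _ ha0.ne'] at h1 h2
  set tL := (1 - L / (A - lamC)) * t₁ with htL
  have htL1 : t₁ ≤ tL := by rw [htL]; nlinarith [hθ.1, ht.2]
  have htL0 : tL ≤ 0 := by rw [htL]; nlinarith [hθ.2, ht.2]
  rcases le_or_gt tb tL with hb | hb
  · have := hanti ⟨by linarith [ht.1, htb.1], htb.2⟩ ⟨by linarith [ht.1], htL0⟩ hb
    linarith
  set s := Real.sqrt L with hs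
  have hs0 : 0 < s := Real.sqrt_pos.2 hL
  have hs2 : s ^ 2 = L := Real.sq_sqrt hL.le
  have hdur : tb - tL ≤ 6 * ε / s := by
    by_contra! hlt
    have hq0 : tL + 6 * ε / s ≤ 0 := by linarith [htb.2]
    have hpos : 0 < 6 * ε / s := by positivity
    have hq := (hx.solutionFrom tL).le_neg_two_xC_of_past_fold hε (p := tL)
      (q := tL + 6 * ε / s) le_rfl hs0 (fun t ht' => by
        have := hanti ⟨by linarith [ht.1], htL0⟩ ⟨by linarith [ht.1, ht'.1], ht'.2.trans hq0⟩ ht'.1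
        rw [hs2]; linarith) (by linarith)
    have := hfirst _ ⟨by linarith, hq0⟩ hq
    linarith
  have hN0 : 0 < N := by linarith
  set S := Real.sqrt (80 * N * (A - lamC)) with hS
  have hS2 : S ^ 2 = 80 * N * (A - lamC) := Real.sq_sqrt (by positivity)
  have hS0 : 0 ≤ S := Real.sqrt_nonneg _
  have hmvt := (convex_Icc tL tb).mul_sub_le_image_sub_of_le_deriv (f := drive A) (C := -S)
    (continuous_drive A).continuousOn
    (fun t _ => (hasDerivAt_drive A t).differentiableAt.differentiableWithinAt)
    (fun t ht' => by
      rw [interior_Icc] at ht'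
      rw [deriv_drive]
      have h3 := deriv_drive_sq_le hA0.le t
      have h4 := hanti ⟨by linarith [ht.1], ht.2⟩
        ⟨by linarith [ht.1, ht'.1], ht'.2.le.trans htb.2⟩ (htL1.trans ht'.1.le)
      have h5 : 80 * A * (A + drive A t) ≤ 80 * N * (A - lamC) := by
        have := (abs_le.1 (abs_drive_le hA0.le t)).1
        gcongr <;> linarith
      exact (abs_le_of_sq_le_sq' (by rw [hS2]; exact h3.trans h5) hS0).1)
    tL ⟨le_rfl, hb.le⟩ tb ⟨hb.le, le_rfl⟩ hb.le
  have h6 : S * (tb - tL) ≤ S * (6 * ε / s) := by gcongr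
  -- During the fall the driving moves by at most speed times duration, at most `√320 L ≤ 18 L`;
  -- with the initial `5 L` this stays below `25 L`.
  have h7 : S * (6 * ε / s) ≤ 18 * L := by
    refine (abs_le_of_sq_le_sq' ?_ (by positivity)).2
    rw [mul_pow, div_pow, hS2, hs2, mul_div_assoc', div_le_iff₀ hL]
    have e1 : N * (80 * N * (A - lamC) * (6 * ε) ^ 2) ≤ 320 * L ^ 3 := by nlinarith
    have e2 : 80 * N * (A - lamC) * (6 * ε) ^ 2 ≤ N * (80 * N * (A - lamC) * (6 * ε) ^ 2) := by
      have : (1 : ℝ) ≤ N := by linarith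
      exact le_mul_of_one_le_left (by positivity) this
    nlinarith [pow_pos hL 3]
  linarith

/-- After arrival on the lower branch the force stays small. -/
theorem eps_mul_velocity_mem_after_arrival (hε : 0 < ε) (hx : IsGlobalSolution ε A x)
    {tb N L : ℝ} (hA : lamC < A) (hN : A + 4 ≤ N) (hL : 3 * N * ε ≤ L)
    (htb : tb ∈ Icc (-1 / 2 : ℝ) 0) (hl : ∀ t ∈ Icc tb 0, drive A t ≤ -lamC)
    (hlow : ∀ t ∈ Icc tb 0, x t ≤ -(2 * xC))
    (h0 : velocity ε A x tb ≤ 0) (h1 : -(ε * velocity ε A x tb) ≤ 25 * L) :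
    ∀ t ∈ Icc tb 0, velocity ε A x t ≤ 0 ∧ -(ε * velocity ε A x t) ≤ 25 * L := by
  have hA0 : 0 < A := lamC_pos.trans hA
  have hN0 : 0 < N := by linarith
  have hL0 : 0 < L := lt_of_lt_of_le (by positivity) hL
  have hv := hasDerivAt_velocity hx
  -- Below `-2 x_c` the relaxation rate is at least `3/ε`. It keeps the velocity negative, as `λ' ≤
  -- 0`, and at lag `25 L` it outweighs `ε |λ'|`.
  have hdiss : ∀ t ∈ Icc tb 0, 3 ≤ 3 * x t ^ 2 - 1 := by
    intro t ht
    have e1 := hlow t ht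
    have e2 : (2 * xC) ^ 2 ≤ x t ^ 2 := by nlinarith [xC_pos]
    rw [mul_pow, xC_sq] at e2
    linarith
  intro t ht
  constructor
  · refine nonpos_of_deriv_right_le_mul (c := 0)
      (fun t _ => (hv t).continuousAt.continuousWithinAt) (fun t _ => (hv t).hasDerivWithinAt)
      (fun s hs hpos => ?_) h0 t ht
    rw [zero_mul]
    refine div_nonpos_of_nonpos_of_nonneg ?_ hε.le
    have e1 := hdiss s (Ico_subset_Icc_self hs)
    have e2 : 2 * Real.pi * A * Real.sin (2 * Real.pi * s) ≤ 0 :=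
      mul_nonpos_of_nonneg_of_nonpos (by positivity)
        (sin_nonpos_of_mem ⟨by linarith [htb.1, hs.1], hs.2.le⟩)
    nlinarith
  · have hv' := fun t => ((hv t).const_mul ε).neg
    refine image_le_of_deriv_right_lt_deriv_boundary (f := fun t => -(ε * velocity ε A x t))
      (B := fun _ => 25 * L) (B' := fun _ => 0)
      (fun t _ => (hv' t).continuousAt.continuousWithinAt) (fun t _ => (hv' t).hasDerivWithinAt)
      h1 (fun _ => hasDerivAt_const _ _) (fun s hs hE => ?_) ht
    have hs' := Ico_subset_Icc_self hs
    have e1 := hdiss s hs'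
    have e2 := deriv_drive_sq_le hA0.le s
    have e3 := hl s hs'
    set D := 2 * Real.pi * A * Real.sin (2 * Real.pi * s) with hD
    set v := velocity ε A x s with hvdef
    rw [mul_div_cancel₀ _ hε.ne']
    have hD2 : (ε * D) ^ 2 < (75 * L) ^ 2 := by
      have f1 : 80 * A * (A + drive A s) ≤ 80 * N * N := by
        have := (abs_le.1 (abs_drive_le hA0.le s)).1
        gcongr
        · linarith
        · linarith
        · linarith [lamC_pos]
      have f2 : (3 * N * ε) ^ 2 ≤ L ^ 2 := by gcongr
      have f3 : ε ^ 2 * D ^ 2 ≤ ε ^ 2 * (80 * N * N) := by gcongr; linarith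
      rw [mul_pow]
      nlinarith [pow_pos hL0 2]
    have hD3 := (abs_lt_of_sq_lt_sq' hD2 (by positivity)).1
    have hE' : ε * v = -(25 * L) := by linarith
    have : 0 < ε * ((1 - 3 * x s ^ 2) * v + D) := by
      have g1 : ε * ((1 - 3 * x s ^ 2) * v + D) = (3 * x s ^ 2 - 1) * (25 * L) + ε * D := by
        linear_combination (1 - 3 * x s ^ 2) * hE'
      rw [g1]
      nlinarith
    have := (mul_pos_iff_of_pos_left hε).1 this
    linarith

/-- The dissipation along a monotone piece of a solution. -/
theorem integral_dissipation_le (hx : IsGlobalSolution ε A x) {a b B : ℝ}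
    (hab : a ≤ b) (h : ∀ t ∈ Icc a b, 0 ≤ velocity ε A x t ∧ ε * velocity ε A x t ≤ B) :
    ∫ t in a..b, ε * velocity ε A x t ^ 2 ≤ B * (x b - x a) := by
  have hvc := continuous_velocity hx
  have hc : Continuous fun t => ε * velocity ε A x t ^ 2 := by fun_prop
  have hder := fun t => (hx t).const_mul B
  rw [mul_sub]
  refine intervalIntegral.integral_le_sub_of_hasDeriv_right_of_le hab
    (fun t _ => (hder t).continuousAt.continuousWithinAt)
    (fun t _ => (hder t).hasDerivWithinAt) hc.integrableOn_Icc fun t ht => ?_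
  have h1 := h t (Ioo_subset_Icc_self ht)
  change _ ≤ B * velocity ε A x t
  rw [sq, ← mul_assoc]
  exact mul_le_mul_of_nonneg_right h1.2 h1.1

theorem integral_dissipation_le_of_nonpos (hx : IsGlobalSolution ε A x) {a b B : ℝ}
    (hab : a ≤ b) (h : ∀ t ∈ Icc a b, velocity ε A x t ≤ 0 ∧ -(ε * velocity ε A x t) ≤ B) :
    ∫ t in a..b, ε * velocity ε A x t ^ 2 ≤ B * (x a - x b) := by
  have hvc := continuous_velocity hx
  have hc : Continuous fun t => ε * velocity ε A x t ^ 2 := by fun_prop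
  have hder := fun t => ((hx t).const_mul B).neg
  rw [show B * (x a - x b) = -(B * x b) - -(B * x a) by ring]
  refine intervalIntegral.integral_le_sub_of_hasDeriv_right_of_le hab
    (fun t _ => (hder t).continuousAt.continuousWithinAt)
    (fun t _ => (hder t).hasDerivWithinAt) hc.integrableOn_Icc fun t ht => ?_
  have h1 := h t (Ioo_subset_Icc_self ht)
  change _ ≤ -(B * velocity ε A x t)
  nlinarith [h1.1, h1.2]

/-- The velocity changes sign only once: while it is nonnegative, relaxation and falling driving
make it decrease. Each monotone piece costs the maximal force times its bounded variation. -/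
theorem integral_dissipation_before_fold_le (hε : 0 < ε) (hx : IsGlobalSolution ε A x)
    {t₁ B L : ℝ} (hA : 0 < A) (ht : t₁ ∈ Icc (-1 / 2 : ℝ) 0)
    (hge : ∀ t ∈ Icc (-1 / 2) t₁, xC ≤ x t) (hxA : ∀ t, x t ≤ A + 2)
    (hstart : 0 ≤ velocity ε A x (-1 / 2)) (hB : ε * velocity ε A x (-1 / 2) ≤ B)
    (hv1 : velocity ε A x t₁ ≤ 0) (hlag : ∀ t ∈ Icc (-1 / 2) t₁, -(ε * velocity ε A x t) ≤ L) :
    ∫ t in (-1 / 2 : ℝ)..t₁, ε * velocity ε A x t ^ 2 ≤ (B + L) * (A + 2) := by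
  have hvc := continuous_velocity hx
  have hc : Continuous fun t => ε * velocity ε A x t ^ 2 := by fun_prop
  obtain ⟨τ, hτ, hvτ, hτpos, -⟩ := exists_first_hit (z := 0) ht.1 hvc.continuousOn hstart hv1
  have hdec : ∀ s ∈ Icc (-1 / 2) t₁, 0 ≤ velocity ε A x s →
      ((1 - 3 * x s ^ 2) * velocity ε A x s +
        2 * Real.pi * A * Real.sin (2 * Real.pi * s)) / ε ≤ 0 := by
    intro s hs hpos
    refine div_nonpos_of_nonpos_of_nonneg ?_ hε.le
    have e1 : xC ^ 2 ≤ x s ^ 2 := by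
      have := hge s hs
      have := xC_pos
      gcongr
    rw [xC_sq] at e1
    have e2 : 2 * Real.pi * A * Real.sin (2 * Real.pi * s) ≤ 0 :=
      mul_nonpos_of_nonneg_of_nonpos (by positivity)
        (sin_nonpos_of_mem ⟨hs.1, hs.2.trans ht.2⟩)
    nlinarith
  have hvd := hasDerivAt_velocity hx
  have hrise : ∀ t ∈ Icc (-1 / 2) τ, ε * velocity ε A x t ≤ B := by
    intro t ht'
    have := nonpos_of_deriv_right_le_mul (c := 0)
      (f := fun t => velocity ε A x t - velocity ε A x (-1 / 2))
      (fun t _ => ((hvd t).sub_const _).continuousAt.continuousWithinAt)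
      (fun t _ => ((hvd t).sub_const _).hasDerivWithinAt)
      (fun s hs _ => by
        rw [zero_mul]
        exact hdec s ⟨hs.1, hs.2.le.trans hτ.2⟩ (hτpos s (Ico_subset_Icc_self hs)))
      (by simp) t ht'
    have h2 : ε * velocity ε A x t ≤ ε * velocity ε A x (-1 / 2) := by
      gcongr; linarith
    linarith
  have hfall : ∀ t ∈ Icc τ t₁, velocity ε A x t ≤ 0 :=
    nonpos_of_deriv_right_le_mul (c := 0) hvc.continuousOn (fun t _ => (hvd t).hasDerivWithinAt)
      (fun s hs hpos => by
        rw [zero_mul]; exact hdec s ⟨hτ.1.trans hs.1, hs.2.le⟩ hpos.le) hvτ.le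
  have hI1 := integral_dissipation_le hx hτ.1 fun t ht' => ⟨hτpos t ht', hrise t ht'⟩
  have hI2 := integral_dissipation_le_of_nonpos hx hτ.2 fun t ht' =>
    ⟨hfall t ht', hlag t ⟨hτ.1.trans ht'.1, ht'.2⟩⟩
  have hxτ := hge τ ⟨hτ.1, hτ.2⟩
  have hxs := hge (-1 / 2) ⟨le_rfl, ht.1⟩
  have hx1 := hge t₁ ⟨ht.1, le_rfl⟩
  have hc1 := xC_pos
  have hB0 : 0 ≤ B := (mul_nonneg hε.le hstart).trans hB
  have hL0 : 0 ≤ L := by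
    have := mul_nonpos_of_nonneg_of_nonpos hε.le hv1
    linarith [hlag t₁ ⟨ht.1, le_rfl⟩]
  have b1 : B * (x τ - x (-1 / 2)) ≤ B * (A + 2) := by gcongr; linarith [hxA τ]
  have b2 : L * (x τ - x t₁) ≤ L * (A + 2) := by gcongr; linarith [hxA τ]
  rw [← intervalIntegral.integral_add_adjacent_intervals (b := τ) (hc.intervalIntegrable _ _)
      (hc.intervalIntegrable _ _)]
  linarith

/-- Past the fold the dissipation is the drop of the fold potential plus at most `B` times the
distance fallen, because the solution moves down and the driving is at most `B` past the fold. -/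
theorem integral_dissipation_fold_passage_le (hε : 0 < ε) (hx : IsGlobalSolution ε A x)
    {t₁ tb B : ℝ} (htb : t₁ ≤ tb) (hl : ∀ t ∈ Icc t₁ tb, drive A t ≤ -lamC)
    (hl' : ∀ t ∈ Icc t₁ tb, -(drive A t + lamC) ≤ B) (hab : ∀ t ∈ Icc t₁ tb, -(2 * xC) ≤ x t) :
    ∫ t in t₁..tb, ε * velocity ε A x t ^ 2 ≤
      (-foldPotential (x tb) - B * x tb) - (-foldPotential (x t₁) - B * x t₁) := by
  have hc : Continuous fun t => ε * velocity ε A x t ^ 2 := by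
    have := continuous_velocity hx
    fun_prop
  have hder := fun t => (hasDerivAt_foldPotential hx t).neg.sub ((hx t).const_mul (B))
  refine intervalIntegral.integral_le_sub_of_hasDeriv_right_of_le htb
    (fun t _ => (hder t).continuousAt.continuousWithinAt)
    (fun t _ => (hder t).hasDerivWithinAt) hc.integrableOn_Icc fun t ht' => ?_
  have h1 := eps_mul_velocity (A := A) (x := x) hε t
  have h2 := hl t (Ioo_subset_Icc_self ht')
  have h3 := hl' t (Ioo_subset_Icc_self ht')
  have h4 : 0 ≤ (x t - xC) ^ 2 * (x t + 2 * xC) :=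
    mul_nonneg (sq_nonneg _) (by linarith [hab t (Ioo_subset_Icc_self ht')])
  have h5 : velocity ε A x t ≤ 0 := by
    by_contra! hpos
    nlinarith [mul_pos hε hpos]
  have h6 : velocity ε A x t * (drive A t + lamC + B) ≤ 0 :=
    mul_nonpos_of_nonpos_of_nonneg h5 (by linarith)
  have h7 : ε * velocity ε A x t ^ 2 = velocity ε A x t * (ε * velocity ε A x t) := by ring
  change _ ≤ -((x t - xC) ^ 2 * (x t + 2 * xC) * velocity ε A x t) -
    B * velocity ε A x t
  rw [h7, h1]
  nlinarith

/-- The half period splits into lag before the fold (`26 N L`), potential drop (`3/4 + N L`),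
driving depth during the jump (`25 N L`) and relaxation after arrival (`25 N L`); antisymmetry
doubles the sum. -/
theorem hysteresisArea_le_of_scale (hε : 0 < ε) (hε1 : ε < 1 / 1000)
    (hA : 100 * ε ≤ A - lamC) (hx : IsPeriodicSolution ε A x) {N L : ℝ}
    (hN : A + 4 ≤ N) (hL : 3 * N * ε ≤ L) (hL3 : 9 * N ^ 2 * ε ^ 2 * (A - lamC) < L ^ 3) :
    hysteresisArea A x ≤ 3 / 2 + 154 * N * L := by
  have hAl : lamC < A := by linarith
  have hA0 : 0 < A := lamC_pos.trans hAl
  have hN0 : 0 < N := by linarith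
  have hL0 : 0 < L := lt_of_lt_of_le (by positivity) hL
  have hc1 := xC_gt
  have hc2 := xC_lt
  have hxA := fun t => abs_le.1 (hx.abs_le_add_two hε hA0.le t)
  obtain ⟨t₁, ht, h⟩ := exists_fold_time hAl
  have hanti := drive_antitoneOn (A := A) hA0.le
  have hge := hx.ge_xC_before_fold hε hε1 hA ht h
  have hge1 := hge t₁ ⟨by linarith [ht.1], le_rfl⟩
  obtain ⟨tb, htb, hxb, hab, hfirst⟩ := exists_first_hit (z := -(2 * xC)) ht.2
    hx.1.continuous.continuousOn (by linarith) (hx.at_zero_le hε hε1 hA)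
  have hΛ := neg_drive_le_at_arrival hε hx.1 hAl hN hL0 hL3 ht h htb hfirst
  have hlpast : ∀ t ∈ Icc t₁ 0, drive A t ≤ -lamC := fun t ht' => by
    rw [← h]; exact hanti ⟨by linarith [ht.1], ht.2⟩ ⟨by linarith [ht.1, ht'.1], ht'.2⟩ ht'.1
  have hlow : ∀ t ∈ Icc tb 0, x t ≤ -(2 * xC) :=
    (hx.1.solutionFrom tb).le_const hε le_rfl (fun t ht' => by
      rw [force_neg_two_xC]
      linarith [hlpast t ⟨htb.1.trans ht'.1, ht'.2.le⟩]) hxb.le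
  have hvb := eps_mul_velocity (A := A) (x := x) hε tb
  rw [hxb, neg_add_cancel, mul_zero, sub_zero] at hvb
  have hvb0 : velocity ε A x tb ≤ 0 := by
    by_contra! hpos
    nlinarith [mul_pos hε hpos, hlpast tb htb]
  have hafter := eps_mul_velocity_mem_after_arrival hε hx.1 hAl hN hL
    ⟨by linarith [ht.1, htb.1], htb.2⟩ (fun t ht' => hlpast t ⟨htb.1.trans ht'.1, ht'.2⟩) hlow hvb0
    (by rw [hvb]; exact hΛ)
  -- Antisymmetry closes the loop: the bound at the end of the half period supplies the initial
  -- bound, and its proof does not use the start.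
  have hstart : velocity ε A x (-1 / 2) = -velocity ε A x 0 := by
    have h1 := hx.add_half hε hε1 hA (-1 / 2)
    have h2 := drive_add_half A (-1 / 2)
    rw [show (-1 / 2 + 1 / 2 : ℝ) = 0 by norm_num] at h1 h2
    unfold velocity
    rw [h1, h2, force_neg]
    ring
  have hzero := hafter 0 ⟨htb.2, le_rfl⟩
  have hstart0 : 0 ≤ velocity ε A x (-1 / 2) := by rw [hstart]; linarith [hzero.1]
  have hlag := neg_eps_mul_velocity_le hε hx.1 hA0 hN hL hL3 hAl
    (fun t ht' => by
      rw [← h]; exact hanti ⟨ht'.1, ht'.2.trans ht.2⟩ ⟨by linarith [ht.1], ht.2⟩ ht'.2)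
    hge (fun t => (hxA t).2) hstart0
  have hv1 := eps_mul_velocity (A := A) (x := x) hε t₁
  rw [h, neg_add_cancel, zero_sub] at hv1
  have hv1le : velocity ε A x t₁ ≤ 0 := by
    have : 0 ≤ (x t₁ - xC) ^ 2 * (x t₁ + 2 * xC) := mul_nonneg (sq_nonneg _) (by linarith)
    by_contra! hpos
    nlinarith [mul_pos hε hpos]
  have hI1 := integral_dissipation_before_fold_le hε hx.1 hA0 ⟨by linarith [ht.1], ht.2⟩ hge
    (fun t => (hxA t).2) hstart0 (B := 25 * L) (by rw [hstart]; linarith [hzero.2]) hv1le hlag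
  have hI4 := integral_dissipation_le_of_nonpos hx.1 htb.2 hafter
  have hc : Continuous fun t => ε * velocity ε A x t ^ 2 := by
    have := continuous_velocity hx.1
    fun_prop
  have hI3 := integral_dissipation_fold_passage_le hε hx.1 htb.1
    (fun t ht' => hlpast t ⟨ht'.1, ht'.2.trans htb.2⟩)
    (fun t ht' => (neg_le_neg (add_le_add_left (hanti ⟨by linarith [ht.1, ht'.1],
      ht'.2.trans htb.2⟩ ⟨by linarith [ht.1, htb.1], htb.2⟩ ht'.2) lamC)).trans hΛ) hab
  have hsum : ∫ t in (-1 / 2 : ℝ)..0, ε * velocity ε A x t ^ 2 =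
      (∫ t in (-1 / 2 : ℝ)..t₁, ε * velocity ε A x t ^ 2) +
      (∫ t in t₁..tb, ε * velocity ε A x t ^ 2) +
      ∫ t in tb..0, ε * velocity ε A x t ^ 2 := by
    have hi := fun a b => hc.intervalIntegrable (μ := MeasureTheory.volume) a b
    rw [intervalIntegral.integral_add_adjacent_intervals (hi _ _) (hi _ _),
      intervalIntegral.integral_add_adjacent_intervals (hi _ _) (hi _ _)]
  rw [hysteresisArea_eq_half hε hε1 hA hx, hsum]
  have hp1 := foldPotential_eq (x t₁)
  have hlag1 := hlag t₁ ⟨by linarith [ht.1], le_rfl⟩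
  rw [hv1, neg_neg] at hlag1
  -- At the fold time the lag is itself quadratic in `x - x_c`, so its bound controls the cubic
  -- remainder of the potential.
  have hp2 : (x t₁ - xC) ^ 3 * ((x t₁ - xC) / 4 + xC) ≤ N * L := by
    have e1 : (x t₁ - xC) ^ 2 * ((x t₁ - xC) / 4 + xC) ≤ (x t₁ - xC) ^ 2 * (x t₁ + 2 * xC) :=
      mul_le_mul_of_nonneg_left (by linarith) (sq_nonneg _)
    calc _ = (x t₁ - xC) * ((x t₁ - xC) ^ 2 * ((x t₁ - xC) / 4 + xC)) := by ring
      _ ≤ (x t₁ - xC) * L := by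
        gcongr
        linarith
      _ ≤ N * L := by gcongr; linarith [(hxA t₁).2]
  rw [hxb] at hI3 hI4
  have b1 : (25 * L + L) * (A + 2) ≤ (25 * L + L) * N := by gcongr; linarith
  have b3 : 25 * L * (x t₁ + 2 * xC) ≤ 25 * L * N := by gcongr; linarith [(hxA t₁).2]
  have b4 : 25 * L * (-(2 * xC) - x 0) ≤ 25 * L * N := by gcongr; linarith [(hxA 0).1]
  linarith

theorem large_amplitude_area_le (hε : 0 < ε) (hε1 : ε < 1 / 1000)
    (hA : 100 * ε ≤ A - lamC) (hx : IsPeriodicSolution ε A x) {N : ℝ} (hN : A + 4 ≤ N) :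
    hysteresisArea A x - staticArea ≤
      462 * N ^ 2 * (ε ^ (2 / 3 : ℝ) * (A - lamC) ^ (1 / 3 : ℝ)) := by
  have hAl : lamC < A := by linarith
  have hN1 : 1 < N := by linarith [lamC_pos]
  obtain ⟨r, hr, q, hq, hεr, haq, hpow⟩ := exists_roots hε (show 0 < A - lamC by linarith)
  rw [hpow, staticArea_eq]
  have hrq : r ≤ q ^ 2 := by
    have h1 : r ^ 3 ≤ (q ^ 2) ^ 3 := by
      rw [← pow_mul]; norm_num; rw [← haq, ← hεr]; linarith
    exact (pow_le_pow_iff_left₀ hr.le (by positivity) (by norm_num)).1 h1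
  -- This `L` has the order `ε^{2/3} a₀^{1/3}`. Its factor `3 N` meets both the linear and the cubic
  -- condition, and `154 · 3 = 462`.
  have := hysteresisArea_le_of_scale hε hε1 hA hx (L := 3 * N * (r ^ 2 * q ^ 2)) hN
    (by
      rw [hεr]
      have : r ^ 3 ≤ r ^ 2 * q ^ 2 := by rw [pow_succ]; gcongr
      gcongr)
    (by
      rw [haq, hεr]
      have h1 : 0 < r ^ 6 * q ^ 6 := by positivity
      have h2 : 9 * N ^ 2 * (r ^ 3) ^ 2 * q ^ 6 = 9 * N ^ 2 * (r ^ 6 * q ^ 6) := by ring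
      have h3 : (3 * N * (r ^ 2 * q ^ 2)) ^ 3 = 27 * N ^ 3 * (r ^ 6 * q ^ 6) := by ring
      rw [h2, h3]
      have h4 : 9 * N ^ 2 < 27 * N ^ 3 := by nlinarith [pow_pos (zero_lt_one.trans hN1) 2]
      gcongr)
  linarith

end AreaUpper

theorem theorem2p1 :
    staticArea = 3 / 2 ∧
    ∃ γ₀ γ₁ ε₀ : ℝ, 0 < γ₀ ∧ γ₀ < γ₁ ∧ 0 < ε₀ ∧
      -- small amplitude: the periodic solutions, their stability, tracking and attraction
      (∃ K > 0, ∀ ε ∈ Set.Ioo 0 ε₀, ∀ A > 0, A - lamC ≤ γ₀ * ε →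
        ∃ xp xm x0 : ℝ → ℝ,
          xp ≠ xm ∧ xp ≠ x0 ∧ xm ≠ x0 ∧
          {x | IsPeriodicSolution ε A x} = {xp, xm, x0} ∧
          Function.Periodic xp 1 ∧ Function.Periodic xm 1 ∧ Function.Periodic x0 1 ∧
          IsStableSolution ε A xp ∧ IsStableSolution ε A xm ∧ IsUnstableSolution ε A x0 ∧
          (∀ t, -lamC ≤ drive A t →
            |xp t - branchPlus (drive A t)| ≤ K * trackingScale ε (A - lamC)) ∧
          (∀ t, drive A t ≤ lamC →
            |xm t - branchMinus (drive A t)| ≤ K * trackingScale ε (A - lamC)) ∧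
          (∀ t, |drive A t| ≤ lamC →
            |x0 t - branchZero (drive A t)| ≤ K * trackingScale ε (A - lamC)) ∧
          (∀ (t₀ : ℝ) (y : ℝ → ℝ), IsSolutionFrom ε A t₀ y → y t₀ ≠ x0 t₀ →
            AttractedBy y xp ∨ AttractedBy y xm)) ∧
      -- small amplitude: the area of each of the periodic solutions
      (∃ C > 0, ∀ ε ∈ Set.Ioo 0 ε₀, ∀ A > 0, A - lamC ≤ γ₀ * ε →
        ∀ x, IsPeriodicSolution ε A x → hysteresisArea A x ≤ C * (ε * A)) ∧
      (∀ Amin > 0, ∃ c > 0, ∀ ε ∈ Set.Ioo 0 ε₀, ∀ A ≥ Amin, A - lamC ≤ γ₀ * ε →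
        ∀ x, IsPeriodicSolution ε A x → c * (ε * A) ≤ hysteresisArea A x) ∧
      -- large amplitude: existence, uniqueness and stability of the periodic solution
      (∀ ε ∈ Set.Ioo 0 ε₀, ∀ A, γ₁ * ε ≤ A - lamC →
        ∃ x, {z | IsPeriodicSolution ε A z} = {x} ∧ Function.Periodic x 1 ∧
          IsStableSolution ε A x) ∧
      -- large amplitude: the adiabatic limit
      (∀ A > lamC, ∀ x : ℝ → ℝ → ℝ,
        (∀ ε ∈ Set.Ioo 0 ε₀, γ₁ * ε ≤ A - lamC → IsPeriodicSolution ε A (x ε)) →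
        ∀ t, Filter.Tendsto (fun ε => x ε t) (nhdsWithin 0 (Set.Ioi 0))
          (nhds (adiabaticLimit A t))) ∧
      -- large amplitude: the area
      (∃ c > 0, ∀ ε ∈ Set.Ioo 0 ε₀, ∀ A, γ₁ * ε ≤ A - lamC →
        ∀ x, IsPeriodicSolution ε A x →
          c * (ε ^ (2 / 3 : ℝ) * (A - lamC) ^ (1 / 3 : ℝ)) ≤ hysteresisArea A x - staticArea) ∧
      (∀ Amax > 0, ∃ C > 0, ∀ ε ∈ Set.Ioo 0 ε₀, ∀ A ≤ Amax, γ₁ * ε ≤ A - lamC →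
        ∀ x, IsPeriodicSolution ε A x →
          hysteresisArea A x - staticArea ≤
            C * (ε ^ (2 / 3 : ℝ) * (A - lamC) ^ (1 / 3 : ℝ))) := by
  -- `1/8000` is the overshoot past the fold that the descending barrier tolerates; `100` keeps the
  -- driving `50 ε` past the fold long enough for every solution to fall.
  refine ⟨staticArea_eq, 1 / 8000, 100, 1 / 1000, by norm_num, by norm_num, by norm_num,
    ⟨1000000000, by norm_num, fun ε hε A hA hA1 =>
      small_amplitude_dynamics hε.1 hε.2 hA (by linarith)⟩,
    ⟨3600000000, by norm_num, fun ε hε A hA hA1 x hx =>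
      small_amplitude_area_le hε.1 hε.2 hA (by linarith) hx⟩,
    fun Amin hmin => ⟨Amin / 3600, by positivity, fun ε hε A hA hA1 x hx => ?_⟩,
    fun ε hε A hA => large_amplitude_exists_unique hε.1 hε.2 hA,
    fun A hA x hx t => tendsto_adiabaticLimit hA hx t,
    ⟨1 / 8, by norm_num, fun ε hε A hA x hx => large_amplitude_area_ge hε.1 hε.2 hA hx⟩,
    fun Amax hmax => ⟨462 * (Amax + 4) ^ 2, by positivity, fun ε hε A hAm hA x hx =>
      large_amplitude_area_le hε.1 hε.2 hA hx (by linarith)⟩⟩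
  have hA0 : 0 < A := lt_of_lt_of_le hmin hA
  have h1 := small_amplitude_area_ge hε.1 hε.2 hA0 (by linarith) hx
  have h2 : ε * A * Amin ≤ ε * A * A := mul_le_mul_of_nonneg_left hA (mul_pos hε.1 hA0).le
  nlinarith
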